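/- Let $\mathbb{T}=\mathbb{R}/\mathbb{Z}$ with Lebesgue measure $|\cdot|$ (total mass $1$) and circle distance $\operatorname{dist}_{\mathbb T}$, and write $\langle u,v\rangle=\int_{\mathbb T}u\,\overline v\,dx$. The dyadic intervals are the arcs $I=[2^{-k}j,2^{-k}(j+1)]\subseteq\mathbb{T}$ with $k\ge 1$, $0\le j<2^k$, and $|I|=2^{-k}$. Given constants $(C_m)_{m\ge1}$, a family of smooth functions $\varphi_I:\mathbb{T}\to\mathbb{C}$ indexed by the dyadic intervals is an adapted family with constants $C_m$ if $$|\varphi_I(x)|\le C_m\Big(1+\tfrac{\operatorname{dist}_{\mathbb T}(x,I)}{|I|}\Big)^{-m},\qquad |\varphi_I'(x)|\le \frac{C_m}{|I|}\Big(1+\tfrac{\operatorname{dist}_{\mathbb T}(x,I)}{|I|}\Big)^{-m}$$ for all $I$, all $x\in\mathbb{T}$ and all $m\ge 1$; put $\phi_I=|I|^{-1/2}\varphi_I$. Let $a\in\{1,2,3\}$, let $\varphi^1_I,\varphi^2_I,\varphi^3_I$ be three adapted families with constants $C_m$ such that $\int_{\mathbb T}\varphi_I^i\,dx=0$ for all $I$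 whenever $i\ne a$, and let $(\epsilon_I)$ be complex numbers with $|\epsilon_I|\le 1$. The single-parameter bilinear paraproduct is $$T^a_\epsilon(f,g)=\sum_I \epsilon_I\,\frac{1}{|I|^{1/2}}\,\langle\phi_I^1,f\rangle\,\langle\phi_I^2,g\rangle\,\phi_I^3,$$ where the sum runs over all dyadic intervals and is understood as an unconditional limit in measure (the limit in measure of the net of finite partial sums). **Theorem.** Let $1\le p_1,p_2<\infty$ and $\frac1p=\frac1{p_1}+\frac1{p_2}$. There is a finite constant $C$, depending only on $p_1$, $p_2$ and $(C_m)$, and in particular not on $a$ or on the sequence $(\epsilon_I)$, such that for all data as above and all $f\in L^{p_1}(\mathbb{T})$, $g\in L^{p_2}(\mathbb{T})$ the series defining $T_\epsilon^a(f,g)$ converges unconditionally in measure, and: 1. if $p_1>1$ and $p_2>1$, then $T_\epsilon^a(f,g)\in L^p(\mathbb{T})$ and $\|T_\epsilon^a(f,g)\|_p\le C\,\|f\|_{p_1}\|g\|_{p_2}$; 2. if $p_1=1$ or $p_2=1$ (or both), then $T_\epsilon^a(f,g)\in L^{p,\infty}(\mathbb{T})$ and $\|T_\epsilon^a(f,g)\|_{p,\infty}\le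 C\,\|f\|_{p_1}\|g\|_{p_2}$, where $\|h\|_{p,\infty}=\sup_{\lambda>0}\lambda\,|\{x\in\mathbb T:|h(x)|>\lambda\}|^{1/p}$. -/

import Mathlib

open MeasureTheory Filter
open scoped ENNReal NNReal ContDiff ComplexConjugate

noncomputable section

namespace TorusParaproduct

/-- Index set of the dyadic intervals of the circle `ℝ/ℤ`: the pair `⟨k, j⟩` stands for the interval
`[j 2^{-(k+1)}, (j+1) 2^{-(k+1)}]`, `0 ≤ j < 2^(k+1)`. The whole circle is not a dyadic interval. -/
abbrev DyadicInterval : Type := Σ k : ℕ, Fin (2 ^ (k + 1))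

/-- The length `|I| = 2^{-(k+1)}`. -/
def DyadicInterval.length (I : DyadicInterval) : ℝ := (1 / 2 : ℝ) ^ (I.1 + 1)

/-- The closed arc of the circle given by a dyadic interval. -/
def DyadicInterval.toSet (I : DyadicInterval) : Set UnitAddCircle :=
  (fun t : ℝ => (t : UnitAddCircle)) ''
    Set.Icc ((I.2 : ℝ) * I.length) (((I.2 : ℝ) + 1) * I.length)

/-- `φ` is smooth on the circle and adapted to the interval `I` with constants `C m`, `m ≥ 1`.
Smoothness and the derivative are those of the associated `1`-periodic function on `ℝ`, and the
distance is the one of the circle. -/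
structure IsAdapted (C : ℕ → ℝ) (I : DyadicInterval) (φ : UnitAddCircle → ℂ) : Prop where
  smooth : ContDiff ℝ ∞ (fun t : ℝ => φ (t : UnitAddCircle))
  bound : ∀ m : ℕ, 1 ≤ m → ∀ x : UnitAddCircle,
    ‖φ x‖ ≤ C m / (1 + Metric.infDist x I.toSet / I.length) ^ m
  bound_deriv : ∀ m : ℕ, 1 ≤ m → ∀ t : ℝ,
    ‖deriv (fun s : ℝ => φ (s : UnitAddCircle)) t‖ ≤
      C m / I.length / (1 + Metric.infDist (t : UnitAddCircle) I.toSet / I.length) ^ m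

/-- An adapted family: each member is adapted to its interval with the same constants. -/
def IsAdaptedFamily (C : ℕ → ℝ) (φ : DyadicInterval → UnitAddCircle → ℂ) : Prop :=
  ∀ I, IsAdapted C I (φ I)

/-- The pairing `⟨f, g⟩ = ∫ f * conj g` over the circle. -/
def pairing (f g : UnitAddCircle → ℂ) : ℂ := ∫ x : UnitAddCircle, f x * conj (g x)

/-- The `L²`-normalization `|I|^{-1/2} φ_I` of a family. -/
def normalize (φ : DyadicInterval → UnitAddCircle → ℂ) (I : DyadicInterval) (x : UnitAddCircle) :
    ℂ :=
  ((I.length ^ (-(1 / 2) : ℝ) : ℝ) : ℂ) * φ I x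

/-- The term of the interval `I` in the bilinear paraproduct:
`ε_I |I|^{-1/2} ⟨φ_I^1, f⟩ ⟨φ_I^2, g⟩ φ_I^3(x)`, with `L²`-normalized `φ_I^i`. The three families
are indexed by `0, 1, 2 : Fin 3`. -/
def paraproductTerm (ε : DyadicInterval → ℂ) (φ : Fin 3 → DyadicInterval → UnitAddCircle → ℂ)
    (f g : UnitAddCircle → ℂ) (I : DyadicInterval) (x : UnitAddCircle) : ℂ :=
  ε I * ((I.length ^ (-(1 / 2) : ℝ) : ℝ) : ℂ) * pairing (normalize (φ 0) I) f *
    pairing (normalize (φ 1) I) g * normalize (φ 2) I x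

/-- `h` is the sum of the paraproduct series of `(f, g)` over all dyadic intervals, in the sense of
unconditional convergence in measure: the partial sums over finite sets of dyadic intervals tend to
`h` in measure, along the directed set of all those finite sets. This determines `h` a.e. -/
def IsParaproduct (ε : DyadicInterval → ℂ) (φ : Fin 3 → DyadicInterval → UnitAddCircle → ℂ)
    (f g h : UnitAddCircle → ℂ) : Prop :=
  TendstoInMeasure volume
    (fun (F : Finset DyadicInterval) (x : UnitAddCircle) => ∑ I ∈ F, paraproductTerm ε φ f g I x)
    atTop h

/-- The weak-`L^p` quasinorm `sup_{t > 0} t |{x : |h(x)| > t}|^{1/p}` on the circle. -/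
def weakLpNorm (h : UnitAddCircle → ℂ) (p : ℝ) : ℝ≥0∞ :=
  ⨆ (t : ℝ≥0) (_ : 0 < t), (t : ℝ≥0∞) * volume {x : UnitAddCircle | (t : ℝ) < ‖h x‖} ^ (1 / p)

end TorusParaproduct

end

namespace TorusParaproduct

/-! ### Dyadic cells of the circle -/

/-! Once the powers of `|I|` are collected, the term of an interval `I` with `|I| = 2^{-k}` is `ε_I
c_I(f) d_I(g) φ_I^3`, where `c_I(f) = 2^k ⟨φ_I^1, f⟩` and `d_I(g) = 2^k ⟨φ_I^2, g⟩` are smooth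
averages near `I`. Of adaptedness only decay of order 8 and a weighted Lipschitz bound survive
(`IsAdapted.isMolecule`). All estimates are proved for finite partial sums, with constants that do
not depend on the finite set.

The mean zero hypothesis acts through almost orthogonality alone: the pairing of a molecule with a
shorter one of mean zero gains the ratio of the lengths, so Schur's test gives an `L²` bound for
sums of molecules (`lintegral_sum_sq_le`) and, by duality, a Bessel inequality for coefficients
(`sum_coef_sq_le`). Two of the three families have mean zero, which is enough to bound the partial
sums in `L¹` or in `L²` when `f` and `g` are bounded (`psum_bounded`).

The endpoint `L¹ × L¹ → L^{1/2,∞}` follows from decomposing both functions by Calderón–Zygmund at a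
common height `t`, for the level `t²` (`mul_volume_psum_step_le`). The product of the good parts is
handled by Chebyshev's inequality. A term that contains a bad part is controlled pointwise off a
small set: long intervals see the cancellation of the bad part, short ones see only its distance,
and each gives a geometric gain.

All other exponents are derived from this endpoint without interpolating the bilinear operator. On a
dyadic cell, long intervals contribute nearly a constant, short intervals paired with a function
supported away from the cell contribute little, and the rest is a localized copy of the endpoint
bound. So the partial sum is within a multiple of `Mf · Mg` of a constant, except on a small
proportion of the cell (`mul_volume_local_le`). A good-`λ` argument for these local constants
(`IsLocallyApprox.volume_lt_supMean_le`) dominates the partial sum by `Mf · Mg` in `L^p` and in weak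
`L^p` for every `p > 0`; as `p` may be below 1, no duality is used there. Hölder's inequality,
strong or weak, and the bounds of the maximal function finish the estimate.

For convergence, the tails are small in measure for bounded functions because a summable family
dominates them, and in general by truncation, the error being controlled by the endpoint bound
uniformly in the finite set (`hasSmallTails`). Small tails give a limit in measure
(`exists_tendstoInMeasure`), and both quasinorm bounds pass to it. -/

instance : IsProbabilityMeasure (volume : Measure UnitAddCircle) :=
  ⟨UnitAddCircle.measure_univ⟩

/-- The representative in `[0, 1)` of a point of the circle. -/
noncomputable def rep (x : UnitAddCircle) : ℝ := (AddCircle.equivIco (1 : ℝ) 0 x : ℝ)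

/-- The index of the half-open dyadic cell of generation `k` that contains `x`. -/
noncomputable def cellIdx (k : ℕ) (x : UnitAddCircle) : ℕ := ⌊(2 : ℝ) ^ k * rep x⌋₊

/-- The half-open dyadic cell of generation `k` and index `j`. -/
def cell (k j : ℕ) : Set UnitAddCircle := {x | cellIdx k x = j}

/-- The left endpoint of the cell of generation `k` and index `j`. -/
noncomputable def pt (k j : ℕ) : UnitAddCircle := (((j : ℝ) / 2 ^ k : ℝ) : UnitAddCircle)

lemma rep_nonneg (x : UnitAddCircle) : 0 ≤ rep x := (AddCircle.equivIco (1 : ℝ) 0 x).2.1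

lemma rep_lt_one (x : UnitAddCircle) : rep x < 1 := by
  have := (AddCircle.equivIco (1 : ℝ) 0 x).2.2
  simpa [rep] using this

lemma coe_rep (x : UnitAddCircle) : ((rep x : ℝ) : UnitAddCircle) = x := AddCircle.coe_equivIco

lemma rep_coe {t : ℝ} (h0 : 0 ≤ t) (h1 : t < 1) : rep (t : UnitAddCircle) = t :=
  AddCircle.equivIco_coe_of_mem (p := (1 : ℝ)) (a := 0) ⟨h0, by simpa using h1⟩

lemma measurable_rep : Measurable rep :=
  measurable_subtype_coe.comp (AddCircle.measurableEquivIco (1 : ℝ) 0).measurable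

lemma dist_coe_le (a b : ℝ) : dist (a : UnitAddCircle) (b : UnitAddCircle) ≤ |a - b| := by
  rw [dist_eq_norm, ← AddCircle.coe_sub]
  exact QuotientAddGroup.norm_mk_le_norm

lemma measurable_cellIdx (k : ℕ) : Measurable (cellIdx k) :=
  Nat.measurable_floor.comp (measurable_rep.const_mul _)

lemma measurableSet_cell (k j : ℕ) : MeasurableSet (cell k j) :=
  measurable_cellIdx k (measurableSet_singleton j)

lemma cellIdx_lt (k : ℕ) (x : UnitAddCircle) : cellIdx k x < 2 ^ k := by
  have h := rep_lt_one x
  rw [cellIdx, Nat.floor_lt (by have := rep_nonneg x; positivity)]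
  push_cast
  nlinarith [pow_pos (zero_lt_two' ℝ) k]

lemma cellIdx_zero (x : UnitAddCircle) : cellIdx 0 x = 0 := by
  have := cellIdx_lt 0 x
  simpa using this

/-- Passing to the parent cell halves the index, rounding down; the nesting of the cells rests on
this identity. -/
lemma cellIdx_div (k : ℕ) (x : UnitAddCircle) : cellIdx (k + 1) x / 2 = cellIdx k x := by
  rw [cellIdx, cellIdx, ← Nat.cast_ofNat (R := ℝ), ← Nat.floor_div_natCast]
  congr 1
  push_cast
  rw [pow_succ]; ring

lemma cellIdx_eq_of_le {k m : ℕ} (hkm : k ≤ m) {x y : UnitAddCircle}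
    (h : cellIdx m x = cellIdx m y) : cellIdx k x = cellIdx k y := by
  induction m, hkm using Nat.le_induction with
  | base => exact h
  | succ m _ ih => exact ih (by rw [← cellIdx_div m, ← cellIdx_div m, h])

lemma mem_cell_iff {k j : ℕ} {x : UnitAddCircle} :
    x ∈ cell k j ↔ (j : ℝ) / 2 ^ k ≤ rep x ∧ rep x < ((j : ℝ) + 1) / 2 ^ k := by
  have h2 : (0 : ℝ) < 2 ^ k := by positivity
  have hr := rep_nonneg x
  change cellIdx k x = j ↔ _
  rw [cellIdx, Nat.floor_eq_iff (by positivity), div_le_iff₀ h2,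
    lt_div_iff₀ h2, mul_comm]

lemma dist_pt_le {k j : ℕ} {x : UnitAddCircle} (h : x ∈ cell k j) :
    dist (pt k j) x ≤ (2 ^ k : ℝ)⁻¹ := by
  rw [mem_cell_iff] at h
  rw [← coe_rep x]
  refine (dist_coe_le _ _).trans ?_
  rw [abs_le]
  have : ((j : ℝ) + 1) / 2 ^ k = j / 2 ^ k + (2 ^ k : ℝ)⁻¹ := by ring
  constructor <;> linarith [h.1, h.2]

lemma dist_le_of_cellIdx_eq {k : ℕ} {x y : UnitAddCircle} (h : cellIdx k x = cellIdx k y) :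
    dist x y ≤ (2 ^ k : ℝ)⁻¹ := by
  have hx : x ∈ cell k (cellIdx k x) := rfl
  have hy : y ∈ cell k (cellIdx k x) := h.symm
  rw [mem_cell_iff] at hx hy
  rw [← coe_rep x, ← coe_rep y]
  refine (dist_coe_le _ _).trans ?_
  rw [abs_le]
  have : ((cellIdx k x : ℝ) + 1) / 2 ^ k = (cellIdx k x : ℝ) / 2 ^ k + (2 ^ k : ℝ)⁻¹ := by ring
  constructor <;> linarith [hx.1, hx.2, hy.1, hy.2]

lemma pt_mem_cell {k j : ℕ} (hj : j < 2 ^ k) : pt k j ∈ cell k j := by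
  have h2 : (0 : ℝ) < 2 ^ k := by positivity
  have hj' : (j : ℝ) < 2 ^ k := by exact_mod_cast hj
  rw [mem_cell_iff, pt, rep_coe (by positivity) (by rwa [div_lt_one h2])]
  refine ⟨le_rfl, by gcongr; linarith⟩

lemma volume_cell {k j : ℕ} (hj : j < 2 ^ k) :
    volume (cell k j) = (2⁻¹ : ℝ≥0∞) ^ k := by
  have h2 : (0 : ℝ) < 2 ^ k := by positivity
  have hj' : (j : ℝ) + 1 ≤ 2 ^ k := by exact_mod_cast hj
  have h1 : ((j : ℝ) + 1) / 2 ^ k ≤ 1 := by rwa [div_le_one h2]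
  have h0 : (0 : ℝ) ≤ (j : ℝ) / 2 ^ k := by positivity
  rw [← (UnitAddCircle.measurePreserving_mk 0).measure_preimage
      (measurableSet_cell k j).nullMeasurableSet,
    ← restrict_Ico_eq_restrict_Ioc, Measure.restrict_apply'  measurableSet_Ico]
  have : (QuotientAddGroup.mk ⁻¹' cell k j : Set ℝ) ∩ Set.Ico 0 (0 + 1)
      = Set.Ico ((j : ℝ) / 2 ^ k) (((j : ℝ) + 1) / 2 ^ k) := by
    ext t
    simp only [zero_add, Set.mem_inter_iff, Set.mem_preimage, Set.mem_Ico]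
    constructor
    · rintro ⟨h, h3⟩
      have h' : ((t : ℝ) : UnitAddCircle) ∈ cell k j := h
      rw [mem_cell_iff, rep_coe h3.1 h3.2] at h'
      exact h'
    · rintro ⟨h3, h4⟩
      refine ⟨?_, by linarith, by linarith⟩
      change ((t : ℝ) : UnitAddCircle) ∈ cell k j
      rw [mem_cell_iff, rep_coe (by linarith) (by linarith)]
      exact ⟨h3, h4⟩
  rw [this, Real.volume_Ico]
  have e : ((j : ℝ) + 1) / 2 ^ k - (j : ℝ) / 2 ^ k = (2⁻¹ : ℝ) ^ k := by
    rw [inv_pow]; ring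
  rw [e, ENNReal.ofReal_pow (by norm_num), ENNReal.ofReal_inv_of_pos (by norm_num)]
  simp

lemma volume_cell_cellIdx (k : ℕ) (x : UnitAddCircle) :
    volume (cell k (cellIdx k x)) = (2⁻¹ : ℝ≥0∞) ^ k := volume_cell (cellIdx_lt k x)

lemma iUnion_cell (k : ℕ) : ⋃ j ∈ Finset.range (2 ^ k), cell k j = Set.univ := by
  ext x
  simp only [Set.mem_iUnion, Finset.mem_range, Set.mem_univ, iff_true]
  exact ⟨_, cellIdx_lt k x, rfl⟩

lemma disjoint_cell {k i j : ℕ} (h : i ≠ j) : Disjoint (cell k i) (cell k j) := by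
  rw [Set.disjoint_left]
  intro x hi hj
  exact h (hi.symm.trans hj)

lemma lintegral_eq_sum_cell (k : ℕ) (h : UnitAddCircle → ℝ≥0∞) :
    ∫⁻ x, h x = ∑ j ∈ Finset.range (2 ^ k), ∫⁻ x in cell k j, h x := by
  rw [← setLIntegral_univ, ← iUnion_cell k]
  exact lintegral_biUnion_finset (fun i _ j _ hij => disjoint_cell hij)
    (fun j _ => measurableSet_cell k j) _

/-! ### Polynomial weights -/

/-- The weight `(1 + 2^k dist x y)⁻¹`. -/
noncomputable def w (k : ℕ) (x y : UnitAddCircle) : ℝ := (1 + 2 ^ k * dist x y)⁻¹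

lemma w_den_pos (k : ℕ) (x y : UnitAddCircle) : 0 < 1 + (2 : ℝ) ^ k * dist x y := by positivity

lemma w_pos (k : ℕ) (x y : UnitAddCircle) : 0 < w k x y := inv_pos.2 (w_den_pos k x y)

lemma w_nonneg (k : ℕ) (x y : UnitAddCircle) : 0 ≤ w k x y := (w_pos k x y).le

lemma w_le_one (k : ℕ) (x y : UnitAddCircle) : w k x y ≤ 1 :=
  inv_le_one_of_one_le₀ (by have : 0 ≤ (2 : ℝ) ^ k * dist x y := by positivity
                            linarith)

lemma w_comm (k : ℕ) (x y : UnitAddCircle) : w k x y = w k y x := by rw [w, w, dist_comm]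

lemma w_pow_le (k : ℕ) (x y : UnitAddCircle) {m n : ℕ} (h : m ≤ n) : w k x y ^ n ≤ w k x y ^ m :=
  pow_le_pow_of_le_one (w_nonneg k x y) (w_le_one k x y) h

lemma w_mul_le (k : ℕ) (x y z : UnitAddCircle) : w k x y * w k y z ≤ w k x z := by
  rw [w, w, w, ← mul_inv]
  refine inv_anti₀ (w_den_pos _ _ _) ?_
  have h := dist_triangle x y z
  have h2 : (0 : ℝ) < 2 ^ k := by positivity
  have h3 : 0 ≤ (2 : ℝ) ^ k * dist x y := by positivity
  have h4 : 0 ≤ (2 : ℝ) ^ k * dist y z := by positivity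
  nlinarith [mul_le_mul_of_nonneg_left h h2.le, mul_nonneg h3 h4]

/-- A displacement of at most `2^{-k}` adds at most 1 to `1 + 2^k dist`, so it at most doubles it.
-/
lemma w_le_two_mul {k : ℕ} {x y z : UnitAddCircle} (h : dist y z ≤ (2 ^ k : ℝ)⁻¹) :
    w k x y ≤ 2 * w k x z := by
  rw [w, w, ← div_eq_mul_inv, le_div_iff₀ (w_den_pos _ _ _), inv_mul_le_iff₀ (w_den_pos _ _ _)]
  have h1 := dist_triangle x y z
  have h2 : (0 : ℝ) < 2 ^ k := by positivity
  have h3 : (2 : ℝ) ^ k * dist y z ≤ 1 := by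
    calc _ ≤ (2 : ℝ) ^ k * (2 ^ k)⁻¹ := by gcongr
      _ = 1 := mul_inv_cancel₀ h2.ne'
  have h4 : 0 ≤ (2 : ℝ) ^ k * dist x y := by positivity
  nlinarith [mul_le_mul_of_nonneg_left h1 h2.le]

/-- No scale enters: a displacement no longer than the distance to `x` at most doubles that
distance. This serves for cells much longer than `2^{-k}`, as long as `x` stays away from them. -/
lemma w_le_two_mul_of_dist_le {k : ℕ} {x y z : UnitAddCircle} (h : dist y z ≤ dist x y) :
    w k x y ≤ 2 * w k x z := by
  rw [w, w, ← div_eq_mul_inv, le_div_iff₀ (w_den_pos _ _ _), inv_mul_le_iff₀ (w_den_pos _ _ _)]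
  have h1 := dist_triangle x y z
  have h2 : (0 : ℝ) < 2 ^ k := by positivity
  nlinarith [mul_le_mul_of_nonneg_left h1 h2.le, mul_le_mul_of_nonneg_left h h2.le]

lemma w_anti {k m : ℕ} (h : k ≤ m) (x y : UnitAddCircle) : w m x y ≤ w k x y := by
  refine inv_anti₀ (w_den_pos _ _ _) ?_
  have : (2 : ℝ) ^ k ≤ 2 ^ m := pow_le_pow_right₀ (by norm_num) h
  gcongr

/-- When `2^k dist x y ≥ 1` the summand 1 in the denominator is harmless, and refining the scale
multiplies the other summand by `2^{m-k}`. -/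
lemma w_le_of_far {k m : ℕ} (h : k ≤ m) {x y : UnitAddCircle} (hd : (2 ^ k : ℝ)⁻¹ ≤ dist x y) :
    w m x y ≤ 2 * (2⁻¹ : ℝ) ^ (m - k) * w k x y := by
  obtain ⟨i, rfl⟩ := Nat.exists_eq_add_of_le h
  rw [Nat.add_sub_cancel_left, w, w, ← div_eq_mul_inv, le_div_iff₀ (w_den_pos _ _ _),
    inv_mul_le_iff₀ (w_den_pos _ _ _)]
  have h2 : (0 : ℝ) < 2 ^ k := by positivity
  have hi : (0 : ℝ) < 2 ^ i := by positivity
  have h3 : 1 ≤ (2 : ℝ) ^ k * dist x y := by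
    calc (1 : ℝ) = (2 : ℝ) ^ k * (2 ^ k)⁻¹ := (mul_inv_cancel₀ h2.ne').symm
      _ ≤ _ := by gcongr
  have : (1 + (2 : ℝ) ^ (k + i) * dist x y) * (2 * 2⁻¹ ^ i)
      = 2 * (2 ^ i)⁻¹ + 2 * (2 ^ k * dist x y) := by
    rw [inv_pow, pow_add]; field_simp
  rw [this]
  have : 0 ≤ 2 * ((2 : ℝ) ^ i)⁻¹ := by positivity
  linarith

/-- The term of the smallest ball containing `y` already dominates. In this form the integral over
`y` reduces to volumes of balls. -/
lemma w_sq_le_tsum (k : ℕ) (x y : UnitAddCircle) :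
    ENNReal.ofReal (w k x y ^ 2) ≤
      ∑' i : ℕ, (4 * (4⁻¹ : ℝ≥0∞) ^ i) *
        (Metric.closedBall x (2 ^ i * (2 ^ k : ℝ)⁻¹)).indicator 1 y := by
  have h2 : (0 : ℝ) < 2 ^ k := by positivity
  have hex : ∃ i : ℕ, (2 : ℝ) ^ k * dist x y ≤ 2 ^ i := by
    obtain ⟨i, hi⟩ := pow_unbounded_of_one_lt ((2 : ℝ) ^ k * dist x y) (by norm_num : (1 : ℝ) < 2)
    exact ⟨i, hi.le⟩
  classical
  set i := Nat.find hex with hi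
  have hspec : (2 : ℝ) ^ k * dist x y ≤ 2 ^ i := Nat.find_spec hex
  have hmem : y ∈ Metric.closedBall x (2 ^ i * (2 ^ k : ℝ)⁻¹) := by
    rw [Metric.mem_closedBall, dist_comm, ← div_eq_mul_inv, le_div_iff₀ h2, mul_comm]
    exact hspec
  refine le_trans ?_ (ENNReal.le_tsum i)
  rw [Set.indicator_of_mem hmem, Pi.one_apply, mul_one]
  have key : w k x y ^ 2 ≤ 4 * (4⁻¹ : ℝ) ^ i := by
    rcases Nat.eq_zero_or_pos i with h0 | h0
    · rw [h0]
      nlinarith [w_nonneg k x y, w_le_one k x y]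
    · have hlt : ¬ (2 : ℝ) ^ k * dist x y ≤ 2 ^ (i - 1) := Nat.find_min hex (by omega)
      push Not at hlt
      have e : (2 : ℝ) ^ i = 2 * 2 ^ (i - 1) := by
        rw [← pow_succ']; congr 1; omega
      have hw : w k x y ≤ 2 * (2⁻¹ : ℝ) ^ i := by
        rw [inv_pow, e, w, ← div_eq_mul_inv, le_div_iff₀ (by positivity),
          inv_mul_le_iff₀ (w_den_pos _ _ _)]
        linarith
      calc w k x y ^ 2 ≤ (2 * (2⁻¹ : ℝ) ^ i) ^ 2 := pow_le_pow_left₀ (w_nonneg _ _ _) hw 2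
        _ = 4 * (4⁻¹ : ℝ) ^ i := by
          rw [mul_pow, ← pow_mul, mul_comm i 2, pow_mul]; norm_num
  calc ENNReal.ofReal (w k x y ^ 2) ≤ ENNReal.ofReal (4 * (4⁻¹ : ℝ) ^ i) :=
        ENNReal.ofReal_le_ofReal key
    _ = _ := by
      rw [ENNReal.ofReal_mul (by norm_num), ENNReal.ofReal_pow (by norm_num),
        ENNReal.ofReal_inv_of_pos (by norm_num)]
      norm_num

lemma ofReal_two_pow (k : ℕ) : ENNReal.ofReal ((2 : ℝ) ^ k) = 2 ^ k := by
  rw [ENNReal.ofReal_pow (by norm_num)]; norm_num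

lemma ofReal_two_inv_pow (k : ℕ) : ENNReal.ofReal ((2⁻¹ : ℝ) ^ k) = 2⁻¹ ^ k := by
  rw [ENNReal.ofReal_pow (by norm_num), ENNReal.ofReal_inv_of_pos (by norm_num)]; norm_num

lemma two_pow_mul_inv_pow (k : ℕ) : (2 : ℝ≥0∞) ^ k * 2⁻¹ ^ k = 1 := by
  rw [← mul_pow, ENNReal.mul_inv_cancel (by norm_num) (by norm_num), one_pow]

lemma volume_closedBall_le (x : UnitAddCircle) (r : ℝ) :
    volume (Metric.closedBall x r) ≤ ENNReal.ofReal (2 * r) := by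
  rw [AddCircle.volume_closedBall]
  exact ENNReal.ofReal_le_ofReal (min_le_right _ _)

lemma measurable_w (k : ℕ) : Measurable fun p : UnitAddCircle × UnitAddCircle => w k p.1 p.2 := by
  unfold w
  fun_prop

lemma measurable_w_right (k : ℕ) (x : UnitAddCircle) : Measurable fun y => w k x y := by
  unfold w
  fun_prop

lemma lintegral_w_sq_le (k : ℕ) (x : UnitAddCircle) :
    ∫⁻ y, ENNReal.ofReal (w k x y ^ 2) ≤ 16 * 2⁻¹ ^ k := by
  calc ∫⁻ y, ENNReal.ofReal (w k x y ^ 2)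
      ≤ ∫⁻ y, ∑' i : ℕ, (4 * (4⁻¹ : ℝ≥0∞) ^ i) *
        (Metric.closedBall x (2 ^ i * (2 ^ k : ℝ)⁻¹)).indicator 1 y :=
        lintegral_mono fun y => w_sq_le_tsum k x y
    _ = ∑' i : ℕ, (4 * (4⁻¹ : ℝ≥0∞) ^ i) *
        volume (Metric.closedBall x (2 ^ i * (2 ^ k : ℝ)⁻¹)) := by
        rw [lintegral_tsum]
        · congr 1; ext i
          rw [lintegral_const_mul _ (measurable_one.indicator measurableSet_closedBall),
            lintegral_indicator_one measurableSet_closedBall]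
        · intro i
          exact ((measurable_one.indicator measurableSet_closedBall).const_mul _).aemeasurable
    _ ≤ ∑' i : ℕ, (8 * 2⁻¹ ^ k) * (2⁻¹ : ℝ≥0∞) ^ i := by
        refine ENNReal.tsum_le_tsum fun i => ?_
        refine (mul_le_mul_right (volume_closedBall_le _ _) _).trans (le_of_eq ?_)
        rw [ENNReal.ofReal_mul (by norm_num), ENNReal.ofReal_mul (by positivity), ofReal_two_pow,
          ← inv_pow, ofReal_two_inv_pow]
        have : (4⁻¹ : ℝ≥0∞) ^ i = 2⁻¹ ^ i * 2⁻¹ ^ i := by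
          rw [← mul_pow, ← ENNReal.mul_inv (by norm_num) (by norm_num)]; norm_num
        rw [this, show ENNReal.ofReal 2 = 2 by norm_num]
        calc _ = 8 * 2⁻¹ ^ k * 2⁻¹ ^ i * ((2 : ℝ≥0∞) ^ i * 2⁻¹ ^ i) := by ring
          _ = _ := by rw [two_pow_mul_inv_pow, mul_one]
    _ = 16 * 2⁻¹ ^ k := by
        rw [ENNReal.tsum_mul_left, ENNReal.tsum_geometric, ENNReal.one_sub_inv_two, inv_inv]
        ring

/-- A Riemann sum against its integral: the cells are no longer than `2^{-n}`, so the weight at the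
left endpoint is at most twice the weight anywhere in the cell. -/
lemma sum_w_sq_pt_le {n m : ℕ} (h : n ≤ m) (x : UnitAddCircle) :
    ∑ j ∈ Finset.range (2 ^ m), 2⁻¹ ^ m * ENNReal.ofReal (w n x (pt m j) ^ 2)
      ≤ 64 * 2⁻¹ ^ n := by
  calc _ ≤ ∑ j ∈ Finset.range (2 ^ m),
        ∫⁻ y in cell m j, 4 * ENNReal.ofReal (w n x y ^ 2) := by
        refine Finset.sum_le_sum fun j hj => ?_
        rw [← volume_cell (Finset.mem_range.1 hj), mul_comm, ← setLIntegral_const]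
        refine setLIntegral_mono' (measurableSet_cell m j) fun y hy => ?_
        have h1 : w n x (pt m j) ≤ 2 * w n x y := w_le_two_mul ((dist_pt_le hy).trans
          (inv_anti₀ (by positivity) (pow_le_pow_right₀ (by norm_num) h)))
        calc ENNReal.ofReal (w n x (pt m j) ^ 2) ≤ ENNReal.ofReal (4 * w n x y ^ 2) := by
              refine ENNReal.ofReal_le_ofReal ?_
              nlinarith [w_nonneg n x (pt m j)]
          _ = _ := by rw [ENNReal.ofReal_mul (by norm_num)]; norm_num
    _ = 4 * ∫⁻ y, ENNReal.ofReal (w n x y ^ 2) := by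
        rw [← lintegral_eq_sum_cell, lintegral_const_mul]
        exact ((measurable_w_right n x).pow_const 2).ennreal_ofReal
    _ ≤ 4 * (16 * 2⁻¹ ^ n) := by gcongr; exact lintegral_w_sq_le n x
    _ = _ := by ring

/-- The geometric weight `2^{-|n-m|}`. -/
noncomputable def geo (n m : ℕ) : ℝ≥0∞ := 2⁻¹ ^ ((m - n) + (n - m))

lemma geo_comm (n m : ℕ) : geo n m = geo m n := by rw [geo, geo, add_comm]

lemma geo_of_le {n m : ℕ} (h : n ≤ m) : geo n m = 2⁻¹ ^ (m - n) := by
  rw [geo, Nat.sub_eq_zero_of_le h, add_zero]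

lemma geo_le_one (n m : ℕ) : geo n m ≤ 1 := pow_le_one₀ (by simp) (by simp)

lemma tsum_geo_le (n : ℕ) : ∑' m, geo n m ≤ 3 := by
  -- The exact value of the sum is `3 - 2^{-n}`; written additively it admits an induction that
  -- shifts both indices.
  have key : ∀ n, ∑' m, geo n m + 2⁻¹ ^ n = 3 := by
    intro n
    induction n with
    | zero =>
      simp only [geo, Nat.sub_zero, Nat.zero_sub, add_zero]
      rw [ENNReal.tsum_geometric, ENNReal.one_sub_inv_two, inv_inv]
      norm_num
    | succ n ih =>
      rw [tsum_eq_zero_add' ENNReal.summable]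
      have : ∀ m, geo (n + 1) (m + 1) = geo n m := fun m => by
        rw [geo, geo, Nat.add_sub_add_right, Nat.add_sub_add_right]
      simp only [this]
      rw [← ih, geo_comm, geo_of_le (Nat.zero_le _), Nat.sub_zero]
      have h2 : (2⁻¹ : ℝ≥0∞) ^ n = 2⁻¹ ^ (n + 1) + 2⁻¹ ^ (n + 1) := by
        rw [pow_succ, ← mul_add, ENNReal.inv_two_add_inv_two, mul_one]
      rw [h2]; ring
  rw [← key n]
  exact le_self_add

/-! ### Molecules -/

/-- Functions of polynomial decay away from `c` at scale `2^{-k}`, with the corresponding weighted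
Lipschitz estimate. -/
structure IsMolecule (B : ℝ) (k : ℕ) (c : UnitAddCircle) (φ : UnitAddCircle → ℂ) : Prop where
  cont : Continuous φ
  size : ∀ x, ‖φ x‖ ≤ B * w k x c ^ 8
  lip : ∀ N ≤ 8, ∀ x y,
    ‖φ x - φ y‖ ≤ B * (2 ^ k * dist x y) * (1 + 2 ^ k * dist x y) ^ N * w k y c ^ N

/-- The generation of a dyadic interval: `|I| = 2^{-gen I}`. -/
def DyadicInterval.gen (I : DyadicInterval) : ℕ := I.1 + 1

/-- The left endpoint of a dyadic interval. -/
noncomputable def DyadicInterval.base (I : DyadicInterval) : UnitAddCircle := pt I.gen I.2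

lemma DyadicInterval.length_eq (I : DyadicInterval) : I.length = (2 ^ I.gen : ℝ)⁻¹ := by
  rw [DyadicInterval.length, DyadicInterval.gen, one_div, inv_pow]

lemma dist_base_le (I : DyadicInterval) {z : UnitAddCircle} (hz : z ∈ I.toSet) :
    dist z I.base ≤ (2 ^ I.gen : ℝ)⁻¹ := by
  obtain ⟨t, ht, rfl⟩ := hz
  rw [I.length_eq] at ht
  refine (dist_coe_le _ _).trans ?_
  rw [abs_le, div_eq_mul_inv]
  have : (0 : ℝ) ≤ (2 ^ I.gen : ℝ)⁻¹ := by positivity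
  constructor <;> nlinarith [ht.1, ht.2]

lemma toSet_nonempty (I : DyadicInterval) : I.toSet.Nonempty := by
  refine Set.Nonempty.image _ (Set.nonempty_Icc.2 ?_)
  have : 0 < I.length := by rw [I.length_eq]; positivity
  nlinarith

lemma inv_one_add_infDist_le (I : DyadicInterval) (x : UnitAddCircle) :
    (1 + Metric.infDist x I.toSet / I.length)⁻¹ ≤ 2 * w I.gen x I.base := by
  have h2 : (0 : ℝ) < 2 ^ I.gen := by positivity
  have h1 : dist x I.base - (2 ^ I.gen : ℝ)⁻¹ ≤ Metric.infDist x I.toSet := by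
    rw [Metric.le_infDist (toSet_nonempty I)]
    intro z hz
    have := dist_triangle x z I.base
    have := dist_base_le I hz
    linarith
  have h0 : 0 ≤ Metric.infDist x I.toSet := Metric.infDist_nonneg
  rw [I.length_eq, div_inv_eq_mul, w, ← div_eq_mul_inv, le_div_iff₀ (w_den_pos _ _ _),
    inv_mul_le_iff₀ (by positivity)]
  have h3 : 2 ^ I.gen * dist x I.base - 1 ≤ 2 ^ I.gen * Metric.infDist x I.toSet := by
    have := mul_le_mul_of_nonneg_left h1 h2.le
    rwa [mul_sub, mul_inv_cancel₀ h2.ne'] at this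
  nlinarith

/-- Subtracting the nearest integer from a representative of `x - y` yields a shortest arc. It
allows the mean value inequality on the line to be stated with the circle distance. -/
lemma exists_lift (x y : UnitAddCircle) :
    ∃ s t : ℝ, (s : UnitAddCircle) = x ∧ (t : UnitAddCircle) = y ∧ |s - t| = dist x y := by
  have hz : ((rep (x - y) - round (rep (x - y)) : ℝ) : UnitAddCircle) = x - y := by
    rw [AddCircle.coe_sub, coe_rep, sub_eq_self]
    exact (AddCircle.coe_eq_zero_iff (1 : ℝ)).2 ⟨round (rep (x - y)), by simp⟩
  refine ⟨rep y + (rep (x - y) - round (rep (x - y))), rep y, ?_, coe_rep y, ?_⟩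
  · rw [AddCircle.coe_add, hz, coe_rep]; abel
  · rw [dist_eq_norm, add_sub_cancel_left, ← UnitAddCircle.norm_eq, coe_rep]

lemma w_le_mul (k : ℕ) (u y c : UnitAddCircle) : w k u c ≤ (1 + 2 ^ k * dist u y) * w k y c := by
  have h := w_mul_le k y u c
  rwa [w, inv_mul_le_iff₀ (w_den_pos _ _ _), dist_comm] at h

/-- The decay bounds with `m = 8` suffice, and `2^8` comes from exchanging the distance to the
interval for the distance to its left endpoint. The Lipschitz estimate is the mean value inequality
along a shortest arc; on the arc the weight is at most `1 + 2^k dist x y` times its value at `y`,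
which produces the growing factor. -/
lemma IsAdapted.isMolecule {C : ℕ → ℝ} {I : DyadicInterval} {φ : UnitAddCircle → ℂ}
    (h : IsAdapted C I φ) : IsMolecule (2 ^ 8 * C 8) I.gen I.base φ := by
  have h2 : (0 : ℝ) < 2 ^ I.gen := by positivity
  have hpos : ∀ x, 0 < 1 + Metric.infDist x I.toSet / I.length := fun x => by
    have : 0 ≤ Metric.infDist x I.toSet := Metric.infDist_nonneg
    rw [I.length_eq]; positivity
  have hC : 0 ≤ C 8 := by
    have := (norm_nonneg _).trans (h.bound 8 (by norm_num) I.base)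
    rcases div_nonneg_iff.1 this with h | h
    · exact h.1
    · exact absurd h.2 (not_le.2 (pow_pos (hpos _) 8))
  have hw : ∀ x, ((1 + Metric.infDist x I.toSet / I.length) ^ 8)⁻¹
      ≤ 2 ^ 8 * w I.gen x I.base ^ 8 := fun x => by
    rw [← inv_pow, ← mul_pow]
    exact pow_le_pow_left₀ (inv_nonneg.2 (hpos x).le) (inv_one_add_infDist_le I x) 8
  refine ⟨?_, fun x => ?_, fun N hN x y => ?_⟩
  · refine (QuotientAddGroup.isQuotientMap_mk
      (N := AddSubgroup.zmultiples (1 : ℝ))).continuous_iff.2 ?_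
    exact h.smooth.continuous
  · refine (h.bound 8 (by norm_num) x).trans ?_
    rw [div_eq_mul_inv]
    nlinarith [mul_le_mul_of_nonneg_left (hw x) hC]
  · obtain ⟨s, t, rfl, rfl, hst⟩ := exists_lift x y
    set d := dist (s : UnitAddCircle) (t : UnitAddCircle) with hd
    have hd0 : 0 ≤ d := dist_nonneg
    set K := C 8 * 2 ^ I.gen * (2 ^ 8 * ((1 + 2 ^ I.gen * d) ^ N * w I.gen t I.base ^ N)) with hK
    have hderiv : ∀ u ∈ Set.uIcc t s, ‖deriv (fun s : ℝ => φ (s : UnitAddCircle)) u‖ ≤ K := by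
      intro u hu
      have hut : dist (u : UnitAddCircle) (t : UnitAddCircle) ≤ d :=
        (dist_coe_le u t).trans ((Set.abs_sub_left_of_mem_uIcc hu).trans hst.le)
      refine (h.bound_deriv 8 (by norm_num) u).trans ?_
      rw [I.length_eq, div_inv_eq_mul, ← I.length_eq, div_eq_mul_inv]
      refine mul_le_mul_of_nonneg_left ((hw u).trans ?_) (by positivity)
      refine mul_le_mul_of_nonneg_left ((w_pow_le _ _ _ hN).trans ?_) (by positivity)
      rw [← mul_pow]
      refine pow_le_pow_left₀ (w_nonneg _ _ _) ((w_le_mul I.gen u t I.base).trans ?_) N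
      have := w_nonneg I.gen t I.base
      gcongr
    have hmv := (convex_uIcc t s).norm_image_sub_le_of_norm_deriv_le
      (fun u _ => (h.smooth.differentiable (by simp)).differentiableAt) hderiv
      (Set.left_mem_uIcc) (Set.right_mem_uIcc)
    refine hmv.trans (le_of_eq ?_)
    rw [Real.norm_eq_abs, hst, hK]
    ring

lemma IsMolecule.nonneg {B : ℝ} {k : ℕ} {c : UnitAddCircle} {φ : UnitAddCircle → ℂ}
    (h : IsMolecule B k c φ) : 0 ≤ B :=
  nonneg_of_mul_nonneg_left ((norm_nonneg _).trans (h.size c)) (pow_pos (w_pos _ _ _) 8)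

lemma IsMolecule.norm_le {B : ℝ} {k : ℕ} {c : UnitAddCircle} {φ : UnitAddCircle → ℂ}
    (h : IsMolecule B k c φ) {N : ℕ} (hN : N ≤ 8) (x : UnitAddCircle) :
    ‖φ x‖ ≤ B * w k x c ^ N :=
  (h.size x).trans (mul_le_mul_of_nonneg_left (w_pow_le _ _ _ hN) h.nonneg)

lemma IsMolecule.enorm_le {B : ℝ} {k : ℕ} {c : UnitAddCircle} {φ : UnitAddCircle → ℂ}
    (h : IsMolecule B k c φ) {N : ℕ} (hN : N ≤ 8) (x : UnitAddCircle) :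
    ‖φ x‖ₑ ≤ ENNReal.ofReal B * ENNReal.ofReal (w k x c) ^ N := by
  rw [← ENNReal.ofReal_pow (w_nonneg _ _ _), ← ENNReal.ofReal_mul h.nonneg, ← ofReal_norm]
  exact ENNReal.ofReal_le_ofReal (h.norm_le hN x)

/-! ### Averages at scale `2^{-k}` -/

/-- The weight `w` with values in `[0, ∞]`. -/
noncomputable def ew (k : ℕ) (x y : UnitAddCircle) : ℝ≥0∞ := ENNReal.ofReal (w k x y)

lemma ew_comm (k : ℕ) (x y : UnitAddCircle) : ew k x y = ew k y x := by rw [ew, ew, w_comm]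

lemma ew_le_one (k : ℕ) (x y : UnitAddCircle) : ew k x y ≤ 1 :=
  ENNReal.ofReal_le_one.2 (w_le_one k x y)

lemma ew_pow_le (k : ℕ) (x y : UnitAddCircle) {m n : ℕ} (h : m ≤ n) :
    ew k x y ^ n ≤ ew k x y ^ m :=
  pow_le_pow_of_le_one zero_le (ew_le_one k x y) h

lemma ew_mul_le (k : ℕ) (x y z : UnitAddCircle) : ew k x y * ew k y z ≤ ew k x z := by
  rw [ew, ew, ← ENNReal.ofReal_mul (w_nonneg _ _ _)]
  exact ENNReal.ofReal_le_ofReal (w_mul_le k x y z)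

lemma ew_le_two_mul {k : ℕ} {x y z : UnitAddCircle} (h : dist y z ≤ (2 ^ k : ℝ)⁻¹) :
    ew k x y ≤ 2 * ew k x z := by
  rw [ew, ew, ← ENNReal.ofReal_ofNat, ← ENNReal.ofReal_mul (by norm_num)]
  exact ENNReal.ofReal_le_ofReal (w_le_two_mul h)

lemma ew_le_two_mul_of_dist_le {k : ℕ} {x y z : UnitAddCircle} (h : dist y z ≤ dist x y) :
    ew k x y ≤ 2 * ew k x z := by
  rw [ew, ew, ← ENNReal.ofReal_ofNat, ← ENNReal.ofReal_mul (by norm_num)]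
  exact ENNReal.ofReal_le_ofReal (w_le_two_mul_of_dist_le h)

lemma ew_anti {k m : ℕ} (h : k ≤ m) (x y : UnitAddCircle) : ew m x y ≤ ew k x y :=
  ENNReal.ofReal_le_ofReal (w_anti h x y)

lemma ew_le_of_far {k m : ℕ} (h : k ≤ m) {x y : UnitAddCircle}
    (hd : (2 ^ k : ℝ)⁻¹ ≤ dist x y) : ew m x y ≤ 2 * 2⁻¹ ^ (m - k) * ew k x y := by
  rw [ew, ew, ← ofReal_two_inv_pow, ← ENNReal.ofReal_ofNat, ← ENNReal.ofReal_mul (by norm_num),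
    ← ENNReal.ofReal_mul (by positivity)]
  exact ENNReal.ofReal_le_ofReal (w_le_of_far h hd)

lemma measurable_ew (k : ℕ) : Measurable fun p : UnitAddCircle × UnitAddCircle => ew k p.1 p.2 :=
  (measurable_w k).ennreal_ofReal

lemma measurable_ew_right (k : ℕ) (x : UnitAddCircle) : Measurable fun y => ew k x y :=
  (measurable_w_right k x).ennreal_ofReal

/-- The averaging kernel at scale `2^{-k}`. -/
noncomputable def ker (k : ℕ) (x y : UnitAddCircle) : ℝ≥0∞ := 2 ^ k * ew k x y ^ 3

lemma ker_comm (k : ℕ) (x y : UnitAddCircle) : ker k x y = ker k y x := by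
  rw [ker, ker, ew_comm]

lemma measurable_ker (k : ℕ) :
    Measurable fun p : UnitAddCircle × UnitAddCircle => ker k p.1 p.2 :=
  ((measurable_ew k).pow_const 3).const_mul _

lemma measurable_ker_right (k : ℕ) (x : UnitAddCircle) : Measurable fun y => ker k x y :=
  ((measurable_ew_right k x).pow_const 3).const_mul _

lemma lintegral_ew_sq_le (k : ℕ) (x : UnitAddCircle) : ∫⁻ y, ew k x y ^ 2 ≤ 16 * 2⁻¹ ^ k := by
  refine le_trans (le_of_eq ?_) (lintegral_w_sq_le k x)
  congr 1; ext y
  rw [ew, ENNReal.ofReal_pow (w_nonneg _ _ _)]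

lemma lintegral_ker_le (k : ℕ) (x : UnitAddCircle) : ∫⁻ y, ker k x y ≤ 16 := by
  calc ∫⁻ y, ker k x y ≤ ∫⁻ y, 2 ^ k * ew k x y ^ 2 :=
        lintegral_mono fun y => mul_le_mul_right (ew_pow_le _ _ _ (by norm_num)) _
    _ = 2 ^ k * ∫⁻ y, ew k x y ^ 2 :=
        lintegral_const_mul _ ((measurable_ew_right k x).pow_const 2)
    _ ≤ 2 ^ k * (16 * 2⁻¹ ^ k) := by gcongr; exact lintegral_ew_sq_le k x
    _ = 16 * (2 ^ k * 2⁻¹ ^ k) := by ring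
    _ = 16 := by rw [two_pow_mul_inv_pow, mul_one]

/-- The average of `h` around `x` at scale `2^{-k}`. -/
noncomputable def avg (k : ℕ) (h : UnitAddCircle → ℝ≥0∞) (x : UnitAddCircle) : ℝ≥0∞ :=
  ∫⁻ y, h y * ker k x y

/-- The maximal function. -/
noncomputable def maxFn (h : UnitAddCircle → ℝ≥0∞) (x : UnitAddCircle) : ℝ≥0∞ := ⨆ k, avg k h x

lemma avg_le_maxFn (k : ℕ) (h : UnitAddCircle → ℝ≥0∞) (x : UnitAddCircle) :
    avg k h x ≤ maxFn h x := le_iSup (fun k => avg k h x) k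

lemma measurable_avg (k : ℕ) {h : UnitAddCircle → ℝ≥0∞} (hh : Measurable h) :
    Measurable (avg k h) :=
  Measurable.lintegral_prod_right' (f := fun p : UnitAddCircle × UnitAddCircle =>
    h p.2 * ker k p.1 p.2) ((hh.comp measurable_snd).mul (measurable_ker k))

lemma measurable_maxFn {h : UnitAddCircle → ℝ≥0∞} (hh : Measurable h) : Measurable (maxFn h) :=
  Measurable.iSup fun k => measurable_avg k hh

lemma avg_mono (k : ℕ) {h h' : UnitAddCircle → ℝ≥0∞} (hh : ∀ y, h y ≤ h' y) (x : UnitAddCircle) :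
    avg k h x ≤ avg k h' x := lintegral_mono fun y => mul_le_mul_left (hh y) _

lemma avg_add (k : ℕ) {h : UnitAddCircle → ℝ≥0∞} (hh : Measurable h) (h' : UnitAddCircle → ℝ≥0∞)
    (x : UnitAddCircle) : avg k (fun y => h y + h' y) x = avg k h x + avg k h' x := by
  simp only [avg, add_mul]
  exact lintegral_add_left (hh.mul (measurable_ker_right k x)) _

lemma lintegral_avg_le (k : ℕ) {h : UnitAddCircle → ℝ≥0∞} (hh : Measurable h) :
    ∫⁻ x, avg k h x ≤ 16 * ∫⁻ y, h y := by
  have hm : Measurable fun p : UnitAddCircle × UnitAddCircle => h p.2 * ker k p.1 p.2 :=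
    (hh.comp measurable_snd).mul (measurable_ker k)
  calc ∫⁻ x, avg k h x = ∫⁻ y, ∫⁻ x, h y * ker k x y := lintegral_lintegral_swap hm.aemeasurable
    _ ≤ ∫⁻ y, 16 * h y := by
        refine lintegral_mono fun y => ?_
        simp only [ker_comm k _ y]
        rw [lintegral_const_mul _ (measurable_ker_right k y), mul_comm]
        exact mul_le_mul_left (lintegral_ker_le k y) _
    _ = 16 * ∫⁻ y, h y := lintegral_const_mul _ hh

lemma avg_le_of_le (k : ℕ) {h : UnitAddCircle → ℝ≥0∞} {c : ℝ≥0∞} (hh : ∀ y, h y ≤ c)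
    (x : UnitAddCircle) : avg k h x ≤ 16 * c := by
  calc avg k h x ≤ ∫⁻ y, c * ker k x y := lintegral_mono fun y => mul_le_mul_left (hh y) _
    _ = c * ∫⁻ y, ker k x y := lintegral_const_mul _ (measurable_ker_right k x)
    _ ≤ c * 16 := by gcongr; exact lintegral_ker_le k x
    _ = _ := mul_comm _ _

lemma avg_le_of_ker_le {k m : ℕ} {h : UnitAddCircle → ℝ≥0∞} {x x' : UnitAddCircle} {c : ℝ≥0∞}
    (hc : c ≠ ⊤) (hker : ∀ y, h y ≠ 0 → ker k x y ≤ c * ker m x' y) :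
    avg k h x ≤ c * avg m h x' := by
  rw [avg, avg, ← lintegral_const_mul' _ _ hc]
  refine lintegral_mono fun y => ?_
  by_cases hy : h y = 0
  · simp [hy]
  · calc h y * ker k x y ≤ h y * (c * ker m x' y) := by gcongr; exact hker y hy
      _ = _ := by ring

lemma ker_le_eight_mul {k : ℕ} {x y z : UnitAddCircle} (h : dist y z ≤ (2 ^ k : ℝ)⁻¹) :
    ker k x y ≤ 8 * ker k x z := by
  calc ker k x y ≤ 2 ^ k * (2 * ew k x z) ^ 3 := by
        rw [ker]; gcongr; exact ew_le_two_mul h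
    _ = 8 * ker k x z := by rw [ker]; ring

lemma ker_le_eight_mul_of_dist_le {k : ℕ} {x y z : UnitAddCircle} (h : dist y z ≤ dist x y) :
    ker k x y ≤ 8 * ker k x z := by
  calc ker k x y ≤ 2 ^ k * (2 * ew k x z) ^ 3 := by
        rw [ker]; gcongr; exact ew_le_two_mul_of_dist_le h
    _ = 8 * ker k x z := by rw [ker]; ring

lemma avg_le_avg_of_dist_le {k : ℕ} {x x' : UnitAddCircle} (h : dist x x' ≤ (2 ^ k : ℝ)⁻¹)
    (g : UnitAddCircle → ℝ≥0∞) : avg k g x ≤ 8 * avg k g x' := by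
  refine avg_le_of_ker_le (by norm_num) fun y _ => ?_
  rw [ker_comm, ker_comm k x']
  exact ker_le_eight_mul h

lemma avg_le_coarse {k m : ℕ} (h : k ≤ m) (g : UnitAddCircle → ℝ≥0∞) (x : UnitAddCircle) :
    avg m g x ≤ 2 ^ (m - k) * avg k g x := by
  refine avg_le_of_ker_le (by finiteness) fun y _ => ?_
  calc ker m x y ≤ 2 ^ m * ew k x y ^ 3 := by rw [ker]; gcongr; exact ew_anti h x y
    _ = 2 ^ (m - k) * ker k x y := by
      rw [ker, ← mul_assoc, ← pow_add, Nat.sub_add_cancel h]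

/-- The cubed weight gains `2^{-3(m-k)}` and the normalization of the kernel loses `2^{m-k}`. The
net exponent 2 leaves room to absorb the loss of `avg_le_coarse` for the other function. -/
lemma avg_le_of_far {k m : ℕ} (h : k ≤ m) {g : UnitAddCircle → ℝ≥0∞} {x : UnitAddCircle}
    (hg : ∀ y, g y ≠ 0 → (2 ^ k : ℝ)⁻¹ ≤ dist x y) :
    avg m g x ≤ 8 * 2⁻¹ ^ (2 * (m - k)) * avg k g x := by
  refine avg_le_of_ker_le (by finiteness) fun y hy => ?_
  obtain ⟨i, rfl⟩ := Nat.exists_eq_add_of_le h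
  calc ker (k + i) x y ≤ 2 ^ (k + i) * (2 * 2⁻¹ ^ (k + i - k) * ew k x y) ^ 3 := by
        rw [ker]; gcongr; exact ew_le_of_far h (hg y hy)
    _ = 8 * 2⁻¹ ^ (2 * (k + i - k)) * ker k x y * (2 ^ i * 2⁻¹ ^ i) := by
      rw [ker, Nat.add_sub_cancel_left]; ring
    _ = _ := by rw [two_pow_mul_inv_pow, mul_one]

/-! ### Stopping times -/

/-- `S` is a union of dyadic cells of generation `k`. -/
def IsSaturated (k : ℕ) (S : Set UnitAddCircle) : Prop :=
  ∀ ⦃x y⦄, cellIdx k x = cellIdx k y → x ∈ S → y ∈ S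

lemma IsSaturated.measurableSet {k : ℕ} {S : Set UnitAddCircle} (hS : IsSaturated k S) :
    MeasurableSet S := by
  have : S = cellIdx k ⁻¹' (cellIdx k '' S) := by
    refine subset_antisymm (Set.subset_preimage_image _ _) ?_
    rintro y ⟨x, hx, hxy⟩
    exact hS hxy hx
  rw [this]
  exact measurable_cellIdx k (MeasurableSet.of_discrete)

/-- Each cell lies inside `S` or outside it, according to its left endpoint, so only the cells
inside `S` contribute. -/
lemma IsSaturated.setLIntegral_le {k : ℕ} {S : Set UnitAddCircle} (hS : IsSaturated k S)
    {g h : UnitAddCircle → ℝ≥0∞} (hgh : ∀ j < 2 ^ k, cell k j ⊆ S →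
      ∫⁻ x in cell k j, g x ≤ ∫⁻ x in cell k j, h x) :
    ∫⁻ x in S, g x ≤ ∫⁻ x in S, h x := by
  rw [← lintegral_indicator hS.measurableSet, ← lintegral_indicator hS.measurableSet,
    lintegral_eq_sum_cell k, lintegral_eq_sum_cell k]
  refine Finset.sum_le_sum fun j hj => ?_
  have hj' := Finset.mem_range.1 hj
  by_cases hp : pt k j ∈ S
  · have hsub : cell k j ⊆ S := fun y hy => hS ((pt_mem_cell hj').trans hy.symm) hp
    have e : ∀ f : UnitAddCircle → ℝ≥0∞,
        ∫⁻ x in cell k j, S.indicator f x = ∫⁻ x in cell k j, f x := fun f =>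
      setLIntegral_congr_fun (measurableSet_cell k j) fun x hx =>
        Set.indicator_of_mem (hsub hx) f
    rw [e, e]
    exact hgh j hj' hsub
  · have e : ∫⁻ x in cell k j, S.indicator g x = ∫⁻ x in cell k j, 0 :=
      setLIntegral_congr_fun (measurableSet_cell k j) fun x hx =>
        Set.indicator_of_notMem (fun hx' => hp (hS (hx.trans (pt_mem_cell hj').symm) hx')) g
    rw [e, lintegral_zero]
    exact zero_le

/-- The neighbourhood of `S` of width `2^{-k}`. -/
def thick (k : ℕ) (S : Set UnitAddCircle) : Set UnitAddCircle :=
  {x | ∃ y ∈ S, dist x y ≤ (2 ^ k : ℝ)⁻¹}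

/-- The neighbourhood of a cell lies in the ball of radius `2 · 2^{-k}` about its left endpoint,
whose volume is at most four times that of the cell. -/
lemma IsSaturated.volume_thick_le {k : ℕ} {S : Set UnitAddCircle} (hS : IsSaturated k S) :
    volume (thick k S) ≤ 4 * volume S := by
  classical
  set J := (Finset.range (2 ^ k)).filter fun j => pt k j ∈ S with hJ
  have hJS : ∀ j ∈ J, cell k j ⊆ S := fun j hj y hy =>
    hS ((pt_mem_cell (Finset.mem_range.1 (Finset.mem_filter.1 hj).1)).trans hy.symm)
      (Finset.mem_filter.1 hj).2
  have h1 : thick k S ⊆ ⋃ j ∈ J, Metric.closedBall (pt k j) (2 * (2 ^ k : ℝ)⁻¹) := by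
    rintro x ⟨y, hy, hxy⟩
    simp only [Set.mem_iUnion, Metric.mem_closedBall]
    have hlt := cellIdx_lt k y
    refine ⟨cellIdx k y, Finset.mem_filter.2 ⟨Finset.mem_range.2 hlt,
      hS (pt_mem_cell hlt).symm hy⟩, ?_⟩
    have h2 := dist_triangle_right x (pt k (cellIdx k y)) y
    have h3 : dist (pt k (cellIdx k y)) y ≤ (2 ^ k : ℝ)⁻¹ := dist_pt_le rfl
    linarith
  calc volume (thick k S)
      ≤ ∑ j ∈ J, volume (Metric.closedBall (pt k j) (2 * (2 ^ k : ℝ)⁻¹)) :=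
        (measure_mono h1).trans (measure_biUnion_finset_le _ _)
    _ ≤ ∑ j ∈ J, 4 * volume (cell k j) := by
        refine Finset.sum_le_sum fun j hj => (volume_closedBall_le _ _).trans (le_of_eq ?_)
        rw [volume_cell (Finset.mem_range.1 (Finset.mem_filter.1 hj).1), ← mul_assoc,
          ENNReal.ofReal_mul (by norm_num), ← inv_pow, ofReal_two_inv_pow]
        norm_num
    _ = 4 * volume (⋃ j ∈ J, cell k j) := by
        rw [← Finset.mul_sum, measure_biUnion_finset (fun i _ j _ hij => disjoint_cell hij)
          fun j _ => measurableSet_cell k j]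
    _ ≤ 4 * volume S := by
        gcongr
        exact Set.iUnion₂_subset hJS

/-- The average of `h` over the dyadic cell of generation `k` that contains `x`. -/
noncomputable def cellAvg (k : ℕ) (h : UnitAddCircle → ℝ≥0∞) (x : UnitAddCircle) : ℝ≥0∞ :=
  2 ^ k * ∫⁻ y in cell k (cellIdx k x), h y

lemma cellAvg_congr {k : ℕ} (h : UnitAddCircle → ℝ≥0∞) {x y : UnitAddCircle}
    (hxy : cellIdx k x = cellIdx k y) : cellAvg k h x = cellAvg k h y := by
  rw [cellAvg, cellAvg, hxy]

lemma cellAvg_zero (h : UnitAddCircle → ℝ≥0∞) (x : UnitAddCircle) :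
    cellAvg 0 h x = ∫⁻ y, h y := by
  have : cell 0 (cellIdx 0 x) = Set.univ := by
    ext y; simp [cell, cellIdx_zero]
  rw [cellAvg, this, setLIntegral_univ, pow_zero, one_mul]

lemma cell_subset {k m : ℕ} (hkm : k ≤ m) (x : UnitAddCircle) :
    cell m (cellIdx m x) ⊆ cell k (cellIdx k x) := fun _ hy => cellIdx_eq_of_le hkm hy

lemma cellAvg_succ_le (k : ℕ) (h : UnitAddCircle → ℝ≥0∞) (x : UnitAddCircle) :
    cellAvg (k + 1) h x ≤ 2 * cellAvg k h x := by
  rw [cellAvg, cellAvg, pow_succ, ← mul_assoc, mul_comm 2]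
  gcongr
  exact cell_subset (Nat.le_succ k) x

/-- The union of the cells of generation `k` that are stopped at height `t`: those on which the
average of `h` exceeds `t` while it does not on any of their ancestors. -/
def stopCells (h : UnitAddCircle → ℝ≥0∞) (t : ℝ≥0∞) (k : ℕ) : Set UnitAddCircle :=
  {x | t < cellAvg k h x ∧ ∀ i < k, cellAvg i h x ≤ t}

lemma isSaturated_stopCells (h : UnitAddCircle → ℝ≥0∞) (t : ℝ≥0∞) (k : ℕ) :
    IsSaturated k (stopCells h t k) := by
  rintro x y hxy ⟨h1, h2⟩
  refine ⟨by rwa [← cellAvg_congr h hxy], fun i hi => ?_⟩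
  rw [← cellAvg_congr h (cellIdx_eq_of_le hi.le hxy)]
  exact h2 i hi

lemma disjoint_stopCells (h : UnitAddCircle → ℝ≥0∞) (t : ℝ≥0∞) {k m : ℕ} (hkm : k ≠ m) :
    Disjoint (stopCells h t k) (stopCells h t m) := by
  rw [Set.disjoint_left]
  rintro x ⟨h1, h2⟩ ⟨h3, h4⟩
  rcases lt_or_gt_of_ne hkm with h5 | h5
  · exact absurd h1 (not_lt.2 (h4 _ h5))
  · exact absurd h3 (not_lt.2 (h2 _ h5))

lemma mul_volume_stopCells_le (h : UnitAddCircle → ℝ≥0∞) (t : ℝ≥0∞) (k : ℕ) :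
    t * volume (stopCells h t k) ≤ ∫⁻ x in stopCells h t k, h x := by
  rw [← setLIntegral_const]
  refine (isSaturated_stopCells h t k).setLIntegral_le fun j hj hsub => ?_
  have h1 := (hsub (pt_mem_cell hj)).1
  have h2 : cellIdx k (pt k j) = j := pt_mem_cell hj
  rw [cellAvg, h2] at h1
  rw [setLIntegral_const, volume_cell hj]
  calc t * 2⁻¹ ^ k ≤ (2 ^ k * ∫⁻ y in cell k j, h y) * 2⁻¹ ^ k := by gcongr
    _ = (2 ^ k * 2⁻¹ ^ k) * ∫⁻ y in cell k j, h y := by ring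
    _ = _ := by rw [two_pow_mul_inv_pow, one_mul]

lemma mul_sum_volume_stopCells_le (h : UnitAddCircle → ℝ≥0∞) (t : ℝ≥0∞) (s : Finset ℕ) :
    t * ∑ k ∈ s, volume (stopCells h t k) ≤ ∫⁻ x, h x := by
  rw [Finset.mul_sum]
  calc _ ≤ ∑ k ∈ s, ∫⁻ x in stopCells h t k, h x :=
        Finset.sum_le_sum fun k _ => mul_volume_stopCells_le h t k
    _ = ∫⁻ x in ⋃ k ∈ s, stopCells h t k, h x :=
        (lintegral_biUnion_finset (fun i _ j _ hij => disjoint_stopCells h t hij)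
          (fun j _ => (isSaturated_stopCells h t j).measurableSet) _).symm
    _ ≤ _ := setLIntegral_le_lintegral _ _

/-- The parent is not stopped, and halving a cell at most doubles the average. The hypothesis on the
total mass replaces the parent at generation 0. -/
lemma cellAvg_le_of_mem_stopCells {h : UnitAddCircle → ℝ≥0∞} {t : ℝ≥0∞} (ht : ∫⁻ x, h x ≤ t) {k : ℕ}
    {x : UnitAddCircle} (hx : ∀ i < k, cellAvg i h x ≤ t) : cellAvg k h x ≤ 2 * t := by
  rcases k with _ | k
  · rw [cellAvg_zero]
    exact ht.trans (le_mul_of_one_le_left zero_le (by norm_num))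
  · exact (cellAvg_succ_le k h x).trans (by gcongr; exact hx k (Nat.lt_succ_self k))

lemma exists_mem_stopCells {h : UnitAddCircle → ℝ≥0∞} {t : ℝ≥0∞} {x : UnitAddCircle} {k : ℕ}
    (hx : t < cellAvg k h x) : ∃ i ≤ k, x ∈ stopCells h t i := by
  classical
  have hex : ∃ i, t < cellAvg i h x := ⟨k, hx⟩
  exact ⟨Nat.find hex, Nat.find_min' hex hx, Nat.find_spec hex,
    fun i hi => not_lt.1 (Nat.find_min hex hi)⟩

/-! ### Weak type bounds of the dyadic and the smooth maximal functions -/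

lemma mul_volume_cellAvg_le (h : UnitAddCircle → ℝ≥0∞) (t : ℝ≥0∞) (K : ℕ) :
    t * volume {x | ∃ k ≤ K, t < cellAvg k h x} ≤ ∫⁻ x, h x := by
  refine le_trans ?_ (mul_sum_volume_stopCells_le h t (Finset.range (K + 1)))
  gcongr
  refine (measure_mono ?_).trans (measure_biUnion_finset_le _ _)
  rintro x ⟨k, hk, hx⟩
  obtain ⟨i, hi, hxi⟩ := exists_mem_stopCells hx
  simp only [Set.mem_iUnion, Finset.mem_range]
  exact ⟨i, by omega, hxi⟩

/-- On each cell `q` is constant up to the factor 8, so it may be replaced by 8 times its infimum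
there; what remains is the integral of `h` over the cell. -/
lemma IsSaturated.setLIntegral_mul_le {k : ℕ} {S : Set UnitAddCircle} (hS : IsSaturated k S)
    {h q : UnitAddCircle → ℝ≥0∞} {s : ℝ≥0∞} (hs : s ≠ ⊤) (hq' : ∀ y, q y ≠ ⊤)
    (hq : ∀ x ∈ S, ∀ y, cellIdx k x = cellIdx k y → q x ≤ 8 * q y)
    (hav : ∀ x ∈ S, cellAvg k h x ≤ s) :
    ∫⁻ y in S, h y * q y ≤ 8 * s * ∫⁻ y in S, q y := by
  rw [← lintegral_const_mul' _ _ (by finiteness)]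
  refine hS.setLIntegral_le fun j hj hsub => ?_
  have hp : cellIdx k (pt k j) = j := pt_mem_cell hj
  have h1 := hav _ (hsub (pt_mem_cell hj))
  rw [cellAvg, hp] at h1
  set m := ⨅ y ∈ cell k j, q y with hm
  have hmt : m ≠ ⊤ := ((iInf₂_le _ (pt_mem_cell hj)).trans_lt (lt_top_iff_ne_top.2 (hq' _))).ne
  have hle : ∀ y ∈ cell k j, q y ≤ 8 * m := by
    intro y hy
    rw [mul_comm, ← ENNReal.div_le_iff (by norm_num) (by norm_num)]
    refine le_iInf₂ fun z hz => ?_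
    rw [ENNReal.div_le_iff (by norm_num) (by norm_num), mul_comm]
    exact hq y (hsub hy) z (hy.trans hz.symm)
  calc ∫⁻ y in cell k j, h y * q y ≤ ∫⁻ y in cell k j, (8 * m) * h y :=
        setLIntegral_mono' (measurableSet_cell k j) fun y hy => by
          rw [mul_comm]; gcongr; exact hle y hy
    _ = (8 * m) * ((2 ^ k * ∫⁻ y in cell k j, h y) * 2⁻¹ ^ k) := by
        rw [lintegral_const_mul' _ _ (by finiteness)]
        congr 1
        calc _ = (2 ^ k * 2⁻¹ ^ k) * ∫⁻ y in cell k j, h y := by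
              rw [two_pow_mul_inv_pow, one_mul]
          _ = _ := by ring
    _ ≤ (8 * m) * (s * 2⁻¹ ^ k) := by gcongr
    _ = (8 * s * m) * volume (cell k j) := by rw [volume_cell hj]; ring
    _ = ∫⁻ y in cell k j, 8 * s * m := (setLIntegral_const _ _).symm
    _ ≤ ∫⁻ y in cell k j, 8 * s * q y :=
        setLIntegral_mono' (measurableSet_cell k j) fun y hy => by
          gcongr; exact iInf₂_le y hy

lemma ker_ne_top (k : ℕ) (x y : UnitAddCircle) : ker k x y ≠ ⊤ := by
  rw [ker, ew]; finiteness

/-- The circle is partitioned into the stopped cells and the cells of generation `K` with no stopped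
ancestor. On every piece `h` has average at most `2t` and the kernel varies by a factor at most 8: a
stopped cell is farther from `x` than its own length, and a leftover cell is no longer than
`2^{-k}`. So `h` may be exchanged for `2t`, and the bound is `8 · 2 · 16`. -/
lemma avg_le_off_thick {h : UnitAddCircle → ℝ≥0∞} {t : ℝ≥0∞} (ht' : t ≠ ⊤) (ht : ∫⁻ x, h x ≤ t)
    {k K : ℕ} (hk : k ≤ K) {x : UnitAddCircle} (hx : ∀ m ≤ K, x ∉ thick m (stopCells h t m)) :
    avg k h x ≤ 256 * t := by
  classical
  let T : ℕ → Set UnitAddCircle := fun m =>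
    {y | (t < cellAvg m h y ∨ m = K) ∧ ∀ i < m, cellAvg i h y ≤ t}
  have hT : ∀ m, IsSaturated m (T m) := by
    rintro m y z hyz ⟨h1, h2⟩
    refine ⟨by rwa [← cellAvg_congr h hyz], fun i hi => ?_⟩
    rw [← cellAvg_congr h (cellIdx_eq_of_le hi.le hyz)]
    exact h2 i hi
  have hcov : (Set.univ : Set UnitAddCircle) ⊆ ⋃ m ∈ Finset.range (K + 1), T m := by
    intro y _
    have hex : ∃ i, t < cellAvg i h y ∨ i = K := ⟨K, Or.inr rfl⟩
    simp only [Set.mem_iUnion, Finset.mem_range]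
    refine ⟨Nat.find hex, Nat.lt_succ_of_le (Nat.find_min' hex (Or.inr rfl)), Nat.find_spec hex,
      fun i hi => not_lt.1 fun hc => Nat.find_min hex hi (Or.inl hc)⟩
  have hdisj : ∀ i ∈ (Finset.range (K + 1) : Set ℕ), ∀ j ∈ (Finset.range (K + 1) : Set ℕ),
      i ≠ j → Disjoint (T i) (T j) := by
    have aux : ∀ i j, i < j → j < K + 1 → Disjoint (T i) (T j) := by
      intro i j hij hj
      rw [Set.disjoint_left]
      rintro y ⟨h1, _⟩ ⟨_, h4⟩
      rcases h1 with h1 | h1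
      · exact absurd h1 (not_lt.2 (h4 i hij))
      · omega
    intro i hi j hj hij
    simp only [Finset.coe_range, Set.mem_Iio] at hi hj
    rcases lt_or_gt_of_ne hij with h5 | h5
    · exact aux i j h5 hj
    · exact (aux j i h5 hi).symm
  have hu : ⋃ m ∈ Finset.range (K + 1), T m = Set.univ := Set.univ_subset_iff.1 hcov
  have hsplit : ∀ g : UnitAddCircle → ℝ≥0∞,
      ∫⁻ y, g y = ∑ m ∈ Finset.range (K + 1), ∫⁻ y in T m, g y := fun g => by
    rw [← lintegral_biUnion_finset hdisj (fun j _ => (hT j).measurableSet), hu, setLIntegral_univ]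
  calc avg k h x = ∑ m ∈ Finset.range (K + 1), ∫⁻ y in T m, h y * ker k x y := hsplit _
    _ ≤ ∑ m ∈ Finset.range (K + 1), 8 * (2 * t) * ∫⁻ y in T m, ker k x y := by
        refine Finset.sum_le_sum fun m hm => ?_
        have hm' : m ≤ K := Nat.lt_succ_iff.1 (Finset.mem_range.1 hm)
        refine (hT m).setLIntegral_mul_le (by finiteness) (ker_ne_top k x) ?_
          fun y hy => cellAvg_le_of_mem_stopCells ht hy.2
        rintro y ⟨hy1, hy2⟩ z hyz
        have hd := dist_le_of_cellIdx_eq hyz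
        by_cases hy3 : t < cellAvg m h y
        · refine ker_le_eight_mul_of_dist_le (hd.trans ?_)
          by_contra hcon
          exact hx m hm' ⟨y, ⟨hy3, hy2⟩, (not_le.1 hcon).le⟩
        · obtain rfl : m = K := hy1.resolve_left hy3
          exact ker_le_eight_mul (hd.trans (inv_anti₀ (by positivity)
            (pow_le_pow_right₀ (by norm_num) hk)))
    _ = 16 * t * ∫⁻ y, ker k x y := by
        rw [← Finset.mul_sum, ← hsplit]; ring
    _ ≤ 16 * t * 16 := by gcongr; exact lintegral_ker_le k x
    _ = _ := by ring

/-- The union of the neighbourhoods of the stopped cells up to generation `K`. -/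
def badSet (h : UnitAddCircle → ℝ≥0∞) (t : ℝ≥0∞) (K : ℕ) : Set UnitAddCircle :=
  ⋃ m ∈ Finset.range (K + 1), thick m (stopCells h t m)

lemma mul_volume_badSet_le (h : UnitAddCircle → ℝ≥0∞) (t : ℝ≥0∞) (K : ℕ) :
    t * volume (badSet h t K) ≤ 4 * ∫⁻ x, h x := by
  calc t * volume (badSet h t K)
      ≤ t * ∑ m ∈ Finset.range (K + 1), volume (thick m (stopCells h t m)) := by
        gcongr; exact measure_biUnion_finset_le _ _
    _ ≤ t * ∑ m ∈ Finset.range (K + 1), 4 * volume (stopCells h t m) := by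
        gcongr; exact (isSaturated_stopCells _ _ _).volume_thick_le
    _ = 4 * (t * ∑ m ∈ Finset.range (K + 1), volume (stopCells h t m)) := by
        rw [← Finset.mul_sum]; ring
    _ ≤ _ := by gcongr; exact mul_sum_volume_stopCells_le h t _

/-- The weak type `(1,1)` bound of the maximal function. -/
lemma mul_volume_maxFn_le (h : UnitAddCircle → ℝ≥0∞) {t : ℝ≥0∞} (ht' : t ≠ ⊤) :
    t * volume {x | 256 * t < maxFn h x} ≤ 4 * ∫⁻ x, h x := by
  -- The stopping argument needs the whole circle not to be stopped; otherwise the mass exceeds `t`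
  -- and total measure 1 settles the bound.
  by_cases ht : ∫⁻ x, h x ≤ t
  · have hun : {x | 256 * t < maxFn h x} = ⋃ K : ℕ, {x | ∃ k ≤ K, 256 * t < avg k h x} := by
      ext x
      simp only [maxFn, lt_iSup_iff, Set.mem_iUnion]
      exact ⟨fun ⟨k, hk⟩ => ⟨k, k, le_rfl, hk⟩, fun ⟨_, k, _, hk⟩ => ⟨k, hk⟩⟩
    have hmono : Monotone fun K : ℕ => {x | ∃ k ≤ K, 256 * t < avg k h x} :=
      fun K L hKL x ⟨k, hk, hx⟩ => ⟨k, hk.trans hKL, hx⟩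
    rw [hun, hmono.measure_iUnion, ENNReal.mul_iSup]
    refine iSup_le fun K => le_trans ?_ (mul_volume_badSet_le h t K)
    gcongr
    rintro x ⟨k, hk, hx⟩
    by_contra hcon
    refine absurd hx (not_lt.2 (avg_le_off_thick ht' ht hk fun m hm hxm => hcon ?_))
    simp only [badSet, Set.mem_iUnion, Finset.mem_range]
    exact ⟨m, by omega, hxm⟩
  · calc t * volume {x | 256 * t < maxFn h x} ≤ t * 1 := by gcongr; exact prob_le_one
      _ ≤ ∫⁻ x, h x := by rw [mul_one]; exact (not_le.1 ht).le
      _ ≤ 4 * ∫⁻ x, h x := le_mul_of_one_le_left zero_le (by norm_num)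

/-! ### Almost orthogonality -/

lemma sum_ew_sq_pt_le {n m : ℕ} (h : n ≤ m) (x : UnitAddCircle) :
    ∑ j ∈ Finset.range (2 ^ m), 2⁻¹ ^ m * ew n x (pt m j) ^ 2 ≤ 64 * 2⁻¹ ^ n := by
  refine le_trans (le_of_eq ?_) (sum_w_sq_pt_le h x)
  refine Finset.sum_congr rfl fun j _ => ?_
  rw [ew, ENNReal.ofReal_pow (w_nonneg _ _ _)]

lemma sum_ew_sq_le (m : ℕ) (x : UnitAddCircle) :
    ∑ j ∈ Finset.range (2 ^ m), ew m x (pt m j) ^ 2 ≤ 64 := by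
  have h := mul_le_mul_right (sum_ew_sq_pt_le (le_refl m) x) (2 ^ m)
  rw [← Finset.mul_sum, ← mul_assoc, two_pow_mul_inv_pow, one_mul] at h
  refine h.trans (le_of_eq ?_)
  calc _ = 64 * ((2 : ℝ≥0∞) ^ m * 2⁻¹ ^ m) := by ring
    _ = 64 := by rw [two_pow_mul_inv_pow, mul_one]

/-- The dyadic intervals start at generation 1; generation 0 only enlarges the right-hand side. -/
lemma tsum_dyadic_le {a : ℕ → ℕ → ℝ≥0∞} {b : ℕ → ℝ≥0∞}
    (h : ∀ m, ∑ j ∈ Finset.range (2 ^ m), a m j ≤ b m) :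
    ∑' I : DyadicInterval, a I.gen I.2 ≤ ∑' m, b m := by
  rw [ENNReal.tsum_sigma']
  calc _ ≤ ∑' k : ℕ, b (k + 1) := by
        refine ENNReal.tsum_le_tsum fun k => ?_
        rw [tsum_fintype]
        refine le_trans (le_of_eq ?_) (h (k + 1))
        rw [Finset.sum_range]
        rfl
    _ ≤ ∑' m, b m := ENNReal.tsum_comp_le_tsum_of_injective (add_left_injective 1) b

/-- The bound for the correlation of two molecules. -/
noncomputable def corr (I J : DyadicInterval) : ℝ≥0∞ :=
  if I.gen ≤ J.gen then 2⁻¹ ^ J.gen * geo I.gen J.gen * ew I.gen I.base J.base ^ 2 else 0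

/-- Row sums for Schur's test, over shorter intervals: at a fixed generation the positions form a
Riemann sum at the coarse scale of `I`, and the generations are summed by `tsum_geo_le`. -/
lemma tsum_corr_right_le (I : DyadicInterval) : ∑' J, corr I J ≤ 192 * 2⁻¹ ^ I.gen := by
  refine (tsum_dyadic_le (a := fun m j => if I.gen ≤ m then
    2⁻¹ ^ m * geo I.gen m * ew I.gen I.base (pt m j) ^ 2 else 0)
    (b := fun m => 64 * 2⁻¹ ^ I.gen * geo I.gen m) fun m => ?_).trans ?_
  · by_cases hm : I.gen ≤ m
    · simp only [hm, if_true]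
      calc _ = (∑ j ∈ Finset.range (2 ^ m), 2⁻¹ ^ m * ew I.gen I.base (pt m j) ^ 2)
            * geo I.gen m := by
            rw [Finset.sum_mul]; exact Finset.sum_congr rfl fun j _ => by ring
        _ ≤ _ := by gcongr; exact sum_ew_sq_pt_le hm _
    · simp [hm]
  · rw [ENNReal.tsum_mul_left]
    calc _ ≤ (64 : ℝ≥0∞) * 2⁻¹ ^ I.gen * 3 := by gcongr; exact tsum_geo_le _
      _ = _ := by ring

/-- Column sums for Schur's test, over longer intervals: the weight lives at the scale of these
intervals, so their positions sum to at most 64. -/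
lemma tsum_corr_left_le (I : DyadicInterval) : ∑' J, corr J I ≤ 192 * 2⁻¹ ^ I.gen := by
  refine (tsum_dyadic_le (a := fun m j => if m ≤ I.gen then
    2⁻¹ ^ I.gen * geo m I.gen * ew m (pt m j) I.base ^ 2 else 0)
    (b := fun m => 64 * 2⁻¹ ^ I.gen * geo I.gen m) fun m => ?_).trans ?_
  · by_cases hm : m ≤ I.gen
    · simp only [hm, if_true]
      calc _ = 2⁻¹ ^ I.gen * geo I.gen m *
            (∑ j ∈ Finset.range (2 ^ m), ew m I.base (pt m j) ^ 2) := by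
            rw [Finset.mul_sum]
            exact Finset.sum_congr rfl fun j _ => by rw [geo_comm, ew_comm]
        _ ≤ 2⁻¹ ^ I.gen * geo I.gen m * 64 := by gcongr; exact sum_ew_sq_le m _
        _ = _ := by ring
    · simp [hm]
  · rw [ENNReal.tsum_mul_left]
    calc _ ≤ (64 : ℝ≥0∞) * 2⁻¹ ^ I.gen * 3 := by gcongr; exact tsum_geo_le _
      _ = _ := by ring

lemma IsMolecule.integrable {B : ℝ} {k : ℕ} {c : UnitAddCircle} {φ : UnitAddCircle → ℂ}
    (h : IsMolecule B k c φ) : Integrable φ :=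
  h.cont.integrable_of_hasCompactSupport (HasCompactSupport.of_compactSpace φ)

/-- The finer function has mean zero, so the coarser one may be diminished by its value at `c'`. The
Lipschitz bound then gains the ratio of the scales, and its growth is absorbed by the decay of `ψ`.
-/
lemma enorm_integral_mul_conj_le {B : ℝ} {n m : ℕ} (hnm : n ≤ m) {c c' : UnitAddCircle}
    {φ ψ : UnitAddCircle → ℂ} (hφ : IsMolecule B n c φ) (hψ : IsMolecule B m c' ψ)
    (hψ0 : ∫ x, ψ x = 0) :
    ‖∫ x, φ x * conj (ψ x)‖ₑ ≤
      16 * ENNReal.ofReal B ^ 2 * (2⁻¹ ^ m * geo n m * ew n c c' ^ 2) := by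
  have hB := hφ.nonneg
  have hψ0' : ∫ x, conj (ψ x) = 0 := by rw [integral_conj, hψ0, map_zero]
  have hcψ : Continuous fun x => conj (ψ x) := Complex.continuous_conj.comp hψ.cont
  have e : ∫ x, φ x * conj (ψ x) = ∫ x, (φ x - φ c') * conj (ψ x) := by
    simp only [sub_mul]
    rw [integral_sub, integral_const_mul, hψ0', mul_zero, sub_zero]
    · exact (hφ.cont.mul hcψ).integrable_of_hasCompactSupport (HasCompactSupport.of_compactSpace _)
    · exact (continuous_const.mul hcψ).integrable_of_hasCompactSupport
        (HasCompactSupport.of_compactSpace _)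
  have hpt : ∀ x, ‖(φ x - φ c') * conj (ψ x)‖ₑ ≤
      ENNReal.ofReal B ^ 2 * geo n m * ew n c c' ^ 2 * ew m c' x ^ 2 := by
    intro x
    obtain ⟨i, rfl⟩ := Nat.exists_eq_add_of_le hnm
    have hw := w_pos (n + i) x c'
    have hr : 2 ^ n * dist x c' ≤ (2⁻¹ : ℝ) ^ i * (w (n + i) x c')⁻¹ := by
      rw [w, inv_inv, pow_add, inv_pow, mul_add, ← mul_assoc, mul_one]
      have : ((2 : ℝ) ^ i)⁻¹ * (2 ^ n * 2 ^ i * dist x c') = 2 ^ n * dist x c' := by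
        field_simp
      rw [mul_assoc, this]
      have : (0 : ℝ) < (2 ^ i)⁻¹ := by positivity
      linarith
    have hr' : 1 + 2 ^ n * dist x c' ≤ (w (n + i) x c')⁻¹ := by
      rw [w, inv_inv, pow_add]
      have h1 : (1 : ℝ) ≤ 2 ^ i := one_le_pow₀ (by norm_num)
      have h2 : (0 : ℝ) ≤ 2 ^ n * dist x c' := by positivity
      nlinarith
    have h1 := hφ.lip 2 (by norm_num) x c'
    have h2 := hψ.size x
    have hreal : ‖(φ x - φ c') * conj (ψ x)‖ ≤
        B ^ 2 * (2⁻¹ : ℝ) ^ i * w n c c' ^ 2 * w (n + i) c' x ^ 2 := by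
      rw [norm_mul, RCLike.norm_conj]
      set u := w (n + i) x c' with hu
      calc ‖φ x - φ c'‖ * ‖ψ x‖
          ≤ (B * ((2⁻¹ : ℝ) ^ i * u⁻¹) * u⁻¹ ^ 2 * w n c' c ^ 2) * (B * u ^ 8) := by
            have := w_nonneg n c' c
            have h3 : B * (2 ^ n * dist x c') * (1 + 2 ^ n * dist x c') ^ 2 * w n c' c ^ 2 ≤
                B * ((2⁻¹ : ℝ) ^ i * u⁻¹) * u⁻¹ ^ 2 * w n c' c ^ 2 := by gcongr
            exact mul_le_mul (h1.trans h3) h2 (norm_nonneg _) (by positivity)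
        -- Of the eight powers of decay of `ψ`, one pays for the increment and two for the growth
        -- factor; five remain and two are needed.
        _ = B ^ 2 * (2⁻¹ : ℝ) ^ i * w n c' c ^ 2 * u ^ 5 := by
            field_simp
        _ ≤ B ^ 2 * (2⁻¹ : ℝ) ^ i * w n c' c ^ 2 * u ^ 2 := by
            exact mul_le_mul_of_nonneg_left (w_pow_le _ _ _ (by norm_num))
              (by have := w_nonneg n c' c; positivity)
        _ = _ := by rw [w_comm n c', hu, w_comm (n + i) x]
    rw [geo_of_le hnm, Nat.add_sub_cancel_left, ← ofReal_norm, ew, ew, ← ofReal_two_inv_pow,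
      ← ENNReal.ofReal_pow hB, ← ENNReal.ofReal_pow (w_nonneg _ _ _),
      ← ENNReal.ofReal_pow (w_nonneg _ _ _), ← ENNReal.ofReal_mul (by positivity),
      ← ENNReal.ofReal_mul (by positivity),
      ← ENNReal.ofReal_mul (by have := w_nonneg n c c'; positivity)]
    exact ENNReal.ofReal_le_ofReal hreal
  rw [e]
  calc _ ≤ ∫⁻ x, ‖(φ x - φ c') * conj (ψ x)‖ₑ := enorm_integral_le_lintegral_enorm _
    _ ≤ ∫⁻ x, ENNReal.ofReal B ^ 2 * geo n m * ew n c c' ^ 2 * ew m c' x ^ 2 := lintegral_mono hpt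
    _ = ENNReal.ofReal B ^ 2 * geo n m * ew n c c' ^ 2 * ∫⁻ x, ew m c' x ^ 2 :=
        lintegral_const_mul _ ((measurable_ew_right m c').pow_const 2)
    _ ≤ ENNReal.ofReal B ^ 2 * geo n m * ew n c c' ^ 2 * (16 * 2⁻¹ ^ m) := by
        gcongr; exact lintegral_ew_sq_le m c'
    _ = _ := by ring

/-- A family of molecules with common constant, indexed by the dyadic intervals. -/
def IsMolecules (B : ℝ) (φ : DyadicInterval → UnitAddCircle → ℂ) : Prop :=
  ∀ I, IsMolecule B I.gen I.base (φ I)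

lemma enorm_gram_le {B : ℝ} {φ : DyadicInterval → UnitAddCircle → ℂ} (hφ : IsMolecules B φ)
    (h0 : ∀ I, ∫ x, φ I x = 0) (I J : DyadicInterval) :
    ‖∫ x, φ I x * conj (φ J x)‖ₑ ≤ 16 * ENNReal.ofReal B ^ 2 * (corr I J + corr J I) := by
  rcases le_total I.gen J.gen with h | h
  · refine (enorm_integral_mul_conj_le h (hφ I) (hφ J) (h0 J)).trans ?_
    gcongr
    refine le_trans (le_of_eq ?_) le_self_add
    rw [corr, if_pos h]
  · have e : ‖∫ x, φ I x * conj (φ J x)‖ₑ = ‖∫ x, φ J x * conj (φ I x)‖ₑ := by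
      rw [← RCLike.enorm_conj, ← integral_conj]
      congr 1
      refine integral_congr_ae (ae_of_all _ fun x => ?_)
      simp [mul_comm]
    rw [e]
    refine (enorm_integral_mul_conj_le h (hφ J) (hφ I) (h0 I)).trans ?_
    gcongr
    refine le_trans (le_of_eq ?_) le_add_self
    rw [corr, if_pos h]

lemma lintegral_enorm_sq_eq {S : UnitAddCircle → ℂ} (hS : Continuous S) :
    ∫⁻ x, ‖S x‖ₑ ^ 2 = ‖∫ x, S x * conj (S x)‖ₑ := by
  have h1 : ∀ x, S x * conj (S x) = ((‖S x‖ ^ 2 : ℝ) : ℂ) := fun x => by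
    rw [Complex.mul_conj, Complex.normSq_eq_norm_sq]
  simp only [h1]
  rw [integral_complex_ofReal, ← ofReal_norm, Complex.norm_real, Real.norm_of_nonneg
    (integral_nonneg fun x => by positivity), ofReal_integral_eq_lintegral_ofReal]
  · refine lintegral_congr fun x => ?_
    rw [ENNReal.ofReal_pow (norm_nonneg _), ofReal_norm]
  · exact (hS.norm.pow 2).integrable_of_hasCompactSupport (HasCompactSupport.of_compactSpace _)
  · exact ae_of_all _ fun x => by positivity

/-- The square function bound for sums of molecules of mean zero. -/
lemma lintegral_sum_sq_le {B : ℝ} {φ : DyadicInterval → UnitAddCircle → ℂ} (hφ : IsMolecules B φ)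
    (h0 : ∀ I, ∫ x, φ I x = 0) (F : Finset DyadicInterval) (c : DyadicInterval → ℂ) :
    ∫⁻ x, ‖∑ I ∈ F, c I * φ I x‖ₑ ^ 2 ≤
      12288 * ENNReal.ofReal B ^ 2 * ∑ I ∈ F, ‖c I‖ₑ ^ 2 * 2⁻¹ ^ I.gen := by
  have hcont : Continuous fun x => ∑ I ∈ F, c I * φ I x :=
    continuous_finsetSum _ fun I _ => continuous_const.mul (hφ I).cont
  rw [lintegral_enorm_sq_eq hcont]
  have e : ∫ x, (∑ I ∈ F, c I * φ I x) * conj (∑ I ∈ F, c I * φ I x)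
      = ∑ I ∈ F, ∑ J ∈ F, (c I * conj (c J)) * ∫ x, φ I x * conj (φ J x) := by
    have hint : ∀ I J : DyadicInterval,
        Integrable fun x => (c I * conj (c J)) * (φ I x * conj (φ J x)) := fun I J =>
      (continuous_const.mul ((hφ I).cont.mul (Complex.continuous_conj.comp
        (hφ J).cont))).integrable_of_hasCompactSupport (HasCompactSupport.of_compactSpace _)
    have e1 : ∀ x, (∑ I ∈ F, c I * φ I x) * conj (∑ I ∈ F, c I * φ I x)
        = ∑ I ∈ F, ∑ J ∈ F, (c I * conj (c J)) * (φ I x * conj (φ J x)) := fun x => by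
      rw [map_sum, Finset.sum_mul_sum]
      refine Finset.sum_congr rfl fun I _ => Finset.sum_congr rfl fun J _ => ?_
      rw [map_mul]; ring
    simp only [e1]
    rw [integral_finsetSum _ fun I _ => integrable_finsetSum _ fun J _ => hint I J]
    refine Finset.sum_congr rfl fun I _ => ?_
    rw [integral_finsetSum _ fun J _ => hint I J]
    exact Finset.sum_congr rfl fun J _ => integral_const_mul _ _
  rw [e]
  set A : DyadicInterval → DyadicInterval → ℝ≥0∞ := fun I J => corr I J + corr J I with hA
  have hAsum : ∀ I, ∑ J ∈ F, A I J ≤ 384 * 2⁻¹ ^ I.gen := fun I => by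
    rw [Finset.sum_add_distrib]
    calc _ ≤ 192 * 2⁻¹ ^ I.gen + 192 * 2⁻¹ ^ I.gen := add_le_add
          ((ENNReal.sum_le_tsum F).trans (tsum_corr_right_le I))
          ((ENNReal.sum_le_tsum F).trans (tsum_corr_left_le I))
      _ = _ := by ring
  have hmul : ∀ a b : ℝ≥0∞, a * b ≤ a ^ 2 + b ^ 2 := fun a b => by
    rcases le_total a b with h | h
    · calc a * b ≤ b * b := by gcongr
        _ = b ^ 2 := by ring
        _ ≤ _ := le_add_self
    · calc a * b ≤ a * a := by gcongr
        _ = a ^ 2 := by ring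
        _ ≤ _ := le_self_add
  -- Schur's test: each product of coefficients is split into squares, and the symmetric kernel is
  -- summed over the free index.
  calc _ ≤ ∑ I ∈ F, ∑ J ∈ F, (‖c I‖ₑ ^ 2 + ‖c J‖ₑ ^ 2) * (16 * ENNReal.ofReal B ^ 2 * A I J) := by
        refine (enorm_sum_le _ _).trans (Finset.sum_le_sum fun I _ =>
          (enorm_sum_le _ _).trans (Finset.sum_le_sum fun J _ => ?_))
        rw [enorm_mul, enorm_mul, RCLike.enorm_conj]
        exact mul_le_mul' (hmul _ _) (enorm_gram_le hφ h0 I J)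
    _ = 16 * ENNReal.ofReal B ^ 2 * (∑ I ∈ F, ‖c I‖ₑ ^ 2 * ∑ J ∈ F, A I J +
          ∑ J ∈ F, ‖c J‖ₑ ^ 2 * ∑ I ∈ F, A J I) := by
        simp only [add_mul, Finset.sum_add_distrib]
        rw [mul_add]
        congr 1
        · simp only [Finset.mul_sum]
          exact Finset.sum_congr rfl fun I _ => Finset.sum_congr rfl fun J _ => by ring
        · rw [Finset.sum_comm]
          simp only [Finset.mul_sum]
          refine Finset.sum_congr rfl fun I _ => Finset.sum_congr rfl fun J _ => ?_
          have : A J I = A I J := add_comm _ _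
          rw [this]; ring
    _ ≤ 16 * ENNReal.ofReal B ^ 2 * (∑ I ∈ F, ‖c I‖ₑ ^ 2 * (384 * 2⁻¹ ^ I.gen) +
          ∑ J ∈ F, ‖c J‖ₑ ^ 2 * (384 * 2⁻¹ ^ J.gen)) := by
        gcongr <;> exact hAsum _
    _ = _ := by
        have : ∑ I ∈ F, ‖c I‖ₑ ^ 2 * (384 * 2⁻¹ ^ I.gen)
            = 384 * ∑ I ∈ F, ‖c I‖ₑ ^ 2 * 2⁻¹ ^ I.gen := by
          rw [Finset.mul_sum]; exact Finset.sum_congr rfl fun I _ => by ring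
        rw [this]; ring

/-- The coefficient of `f`, normalized by averages. -/
noncomputable def coef (I : DyadicInterval) (φ f : UnitAddCircle → ℂ) : ℂ :=
  2 ^ I.gen * pairing φ f

lemma lintegral_mul_sq_le {a b : UnitAddCircle → ℝ≥0∞} (ha : Measurable a) (hb : Measurable b) :
    (∫⁻ x, a x * b x) ^ 2 ≤ (∫⁻ x, a x ^ 2) * ∫⁻ x, b x ^ 2 := by
  have h := ENNReal.lintegral_mul_le_Lp_mul_Lq volume Real.HolderConjugate.two_two
    ha.aemeasurable hb.aemeasurable
  simp only [Pi.mul_apply, ENNReal.rpow_two] at h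
  calc _ ≤ ((∫⁻ x, a x ^ 2) ^ (1 / 2 : ℝ) * (∫⁻ x, b x ^ 2) ^ (1 / 2 : ℝ)) ^ 2 := by gcongr
    _ = _ := by
      rw [mul_pow, ← ENNReal.rpow_natCast, ← ENNReal.rpow_mul, ← ENNReal.rpow_natCast,
        ← ENNReal.rpow_mul]
      norm_num

/-- The Bessel inequality for molecules of mean zero. -/
lemma sum_coef_sq_le {B : ℝ} {φ : DyadicInterval → UnitAddCircle → ℂ} (hφ : IsMolecules B φ)
    (h0 : ∀ I, ∫ x, φ I x = 0) (F : Finset DyadicInterval) {f : UnitAddCircle → ℂ}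
    (hf : Measurable f) (hfi : Integrable f) :
    ∑ I ∈ F, ‖coef I (φ I) f‖ₑ ^ 2 * 2⁻¹ ^ I.gen ≤
      12288 * ENNReal.ofReal B ^ 2 * ∫⁻ x, ‖f x‖ₑ ^ 2 := by
  set X := ∑ I ∈ F, ‖coef I (φ I) f‖ₑ ^ 2 * 2⁻¹ ^ I.gen with hX
  -- With these coefficients `X` is the pairing of `∑ c I * φ I` with `f`. Cauchy–Schwarz and the
  -- dual bound give `X² ≤ C X ‖f‖²`.
  set c : DyadicInterval → ℂ := fun I => conj (coef I (φ I) f) with hc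
  have hcont : Continuous fun x => ∑ I ∈ F, c I * φ I x :=
    continuous_finsetSum _ fun I _ => continuous_const.mul (hφ I).cont
  have hXtop : X ≠ ⊤ := ENNReal.sum_ne_top.2 fun I _ => by finiteness
  have hfc : Integrable fun x => conj (f x) :=
    hfi.congr' (Complex.continuous_conj.comp_aestronglyMeasurable hfi.1)
      (ae_of_all _ fun x => (RCLike.norm_conj _).symm)
  have hbd : ∀ I, Integrable fun x => φ I x * conj (f x) := fun I =>
    hfc.bdd_mul (hφ I).cont.aestronglyMeasurable (c := B) (ae_of_all _ fun x => by
      simpa using (hφ I).norm_le (Nat.zero_le 8) x)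
  have e : ∫ x, (∑ I ∈ F, c I * φ I x) * conj (f x)
      = ((∑ I ∈ F, ‖coef I (φ I) f‖ ^ 2 * (2⁻¹ : ℝ) ^ I.gen : ℝ) : ℂ) := by
    simp only [Finset.sum_mul, mul_assoc]
    rw [integral_finsetSum _ fun I _ => (hbd I).const_mul _]
    push_cast
    refine Finset.sum_congr rfl fun I _ => ?_
    rw [integral_const_mul]
    change c I * pairing (φ I) f = _
    have h2 : pairing (φ I) f = coef I (φ I) f * (2⁻¹ : ℂ) ^ I.gen := by
      rw [coef, inv_pow]; field_simp
    rw [h2, hc, ← mul_assoc, mul_comm (conj _), Complex.mul_conj, Complex.normSq_eq_norm_sq]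
    push_cast
    rfl
  have hXle : X ≤ ∫⁻ x, ‖∑ I ∈ F, c I * φ I x‖ₑ * ‖f x‖ₑ := by
    calc X = ‖∫ x, (∑ I ∈ F, c I * φ I x) * conj (f x)‖ₑ := by
          rw [e, ← ofReal_norm, Complex.norm_real, Real.norm_of_nonneg
            (Finset.sum_nonneg fun I _ => by positivity), ENNReal.ofReal_sum_of_nonneg
            fun I _ => by positivity]
          refine Finset.sum_congr rfl fun I _ => ?_
          rw [ENNReal.ofReal_mul (by positivity), ENNReal.ofReal_pow (norm_nonneg _), ofReal_norm,
            ofReal_two_inv_pow]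
      _ ≤ _ := (enorm_integral_le_lintegral_enorm _).trans (le_of_eq (lintegral_congr fun x => by
          rw [enorm_mul, RCLike.enorm_conj]))
  have hX2 : X * X ≤ X * (12288 * ENNReal.ofReal B ^ 2 * ∫⁻ x, ‖f x‖ₑ ^ 2) := by
    calc X * X = X ^ 2 := (sq X).symm
      _ ≤ (∫⁻ x, ‖∑ I ∈ F, c I * φ I x‖ₑ * ‖f x‖ₑ) ^ 2 := by gcongr
      _ ≤ (∫⁻ x, ‖∑ I ∈ F, c I * φ I x‖ₑ ^ 2) * ∫⁻ x, ‖f x‖ₑ ^ 2 :=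
          lintegral_mul_sq_le hcont.measurable.enorm hf.enorm
      _ ≤ (12288 * ENNReal.ofReal B ^ 2 * X) * ∫⁻ x, ‖f x‖ₑ ^ 2 := by
          gcongr
          refine (lintegral_sum_sq_le hφ h0 F c).trans (le_of_eq ?_)
          rw [hX]
          simp only [hc, RCLike.enorm_conj]
      _ = _ := by ring
  -- A finite sum is finite, so a nonzero factor `X` cancels.
  rcases eq_or_ne X 0 with hX0 | hX0
  · rw [hX0]; exact zero_le
  · exact (ENNReal.mul_le_mul_iff_right hX0 hXtop).1 hX2

/-! ### Coefficients -/

lemma integrable_conj {f : UnitAddCircle → ℂ} (hf : Integrable f) :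
    Integrable fun x => conj (f x) :=
  hf.congr' (Complex.continuous_conj.comp_aestronglyMeasurable hf.1)
    (ae_of_all _ fun _ => (RCLike.norm_conj _).symm)

lemma IsMolecule.integrable_mul_conj {B : ℝ} {k : ℕ} {c : UnitAddCircle} {φ : UnitAddCircle → ℂ}
    (h : IsMolecule B k c φ) {f : UnitAddCircle → ℂ} (hf : Integrable f) :
    Integrable fun x => φ x * conj (f x) :=
  (integrable_conj hf).bdd_mul h.cont.aestronglyMeasurable (c := B) (ae_of_all _ fun x => by
    simpa using h.norm_le (Nat.zero_le 8) x)

lemma coef_add {B : ℝ} {k : ℕ} {c : UnitAddCircle} {φ : UnitAddCircle → ℂ}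
    (h : IsMolecule B k c φ) (I : DyadicInterval) {f g : UnitAddCircle → ℂ} (hf : Integrable f)
    (hg : Integrable g) : coef I φ (fun x => f x + g x) = coef I φ f + coef I φ g := by
  simp only [coef, pairing, map_add, mul_add]
  rw [integral_add (h.integrable_mul_conj hf) (h.integrable_mul_conj hg), mul_add]

lemma coef_sum {B : ℝ} {k : ℕ} {c : UnitAddCircle} {φ : UnitAddCircle → ℂ}
    (h : IsMolecule B k c φ) (I : DyadicInterval) (s : Finset ℕ) {f : ℕ → UnitAddCircle → ℂ}
    (hf : ∀ i, Integrable (f i)) :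
    coef I φ (fun x => ∑ i ∈ s, f i x) = ∑ i ∈ s, coef I φ (f i) := by
  simp only [coef, pairing, map_sum, Finset.mul_sum]
  rw [integral_finsetSum _ fun i _ => h.integrable_mul_conj (hf i), Finset.mul_sum]

lemma coef_smul (I : DyadicInterval) (φ f : UnitAddCircle → ℂ) (r : ℝ) :
    coef I φ (fun x => r * f x) = r * coef I φ f := by
  have : ∀ x, φ x * conj ((r : ℂ) * f x) = r * (φ x * conj (f x)) := fun x => by
    rw [map_mul, Complex.conj_ofReal]; ring
  simp only [coef, pairing, this]
  rw [integral_const_mul]; ring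

lemma coef_congr_ae (I : DyadicInterval) (φ : UnitAddCircle → ℂ) {f g : UnitAddCircle → ℂ}
    (h : f =ᵐ[volume] g) : coef I φ f = coef I φ g := by
  rw [coef, coef, pairing, pairing]
  congr 1
  refine integral_congr_ae ?_
  filter_upwards [h] with x hx
  rw [hx]

lemma enorm_two_pow (k : ℕ) : ‖(2 : ℂ) ^ k‖ₑ = 2 ^ k := by
  rw [enorm_pow, ← ofReal_norm]; norm_num

lemma enorm_coef_le {B : ℝ} {I : DyadicInterval} {φ : UnitAddCircle → ℂ}
    (h : IsMolecule B I.gen I.base φ) {f : UnitAddCircle → ℂ} :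
    ‖coef I φ f‖ₑ ≤ ENNReal.ofReal B * avg I.gen (fun y => ‖f y‖ₑ) I.base := by
  rw [coef, enorm_mul, enorm_two_pow]
  calc _ ≤ 2 ^ I.gen * ∫⁻ x, ENNReal.ofReal B * (‖f x‖ₑ * ew I.gen I.base x ^ 3) := by
        gcongr
        refine (enorm_integral_le_lintegral_enorm _).trans (lintegral_mono fun x => ?_)
        rw [enorm_mul, RCLike.enorm_conj, ew_comm]
        calc _ ≤ ENNReal.ofReal B * ew I.gen x I.base ^ 3 * ‖f x‖ₑ := by
              gcongr; exact h.enorm_le (by norm_num) x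
          _ = _ := by ring
    _ = _ := by
        rw [avg, ← lintegral_const_mul' _ _ (by finiteness),
          ← lintegral_const_mul' _ _ (by finiteness)]
        refine lintegral_congr fun x => ?_
        rw [ker]; ring

/-- Submultiplicativity of the weight lets three of its powers move the centre of the average from
`c` to `x`. Thus coefficients of all intervals of one generation are measured at a single point. -/
lemma avg_mul_ew_le (k : ℕ) (h : UnitAddCircle → ℝ≥0∞) (x c : UnitAddCircle) :
    avg k h c * ew k x c ^ 3 ≤ avg k h x := by
  rw [avg, avg, ← lintegral_mul_const' _ _ (by rw [ew]; finiteness)]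
  refine lintegral_mono fun y => ?_
  calc h y * ker k c y * ew k x c ^ 3 = h y * (2 ^ k * (ew k x c * ew k c y) ^ 3) := by
        rw [ker]; ring
    _ ≤ h y * ker k x y := by rw [ker]; gcongr; exact ew_mul_le k x c y

lemma enorm_coef_mul_le {B : ℝ} {I : DyadicInterval} {φ : UnitAddCircle → ℂ}
    (h : IsMolecule B I.gen I.base φ) (f : UnitAddCircle → ℂ) (x : UnitAddCircle) :
    ‖coef I φ f‖ₑ * ew I.gen x I.base ^ 3 ≤
      ENNReal.ofReal B * avg I.gen (fun y => ‖f y‖ₑ) x := by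
  calc _ ≤ ENNReal.ofReal B * avg I.gen (fun y => ‖f y‖ₑ) I.base * ew I.gen x I.base ^ 3 := by
        gcongr; exact enorm_coef_le h
    _ = ENNReal.ofReal B * (avg I.gen (fun y => ‖f y‖ₑ) I.base * ew I.gen x I.base ^ 3) := by ring
    _ ≤ _ := by gcongr; exact avg_mul_ew_le _ _ _ _

/-- The gain from the cancellation of `b` on the cells of a finer generation. -/
lemma enorm_coef_le_of_cancel {B : ℝ} {I : DyadicInterval} {φ : UnitAddCircle → ℂ}
    (h : IsMolecule B I.gen I.base φ) {k : ℕ} (hk : I.gen ≤ k) {b : UnitAddCircle → ℂ}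
    (hb : Integrable b) (hb0 : ∀ j < 2 ^ k, ∫ x in cell k j, b x = 0) :
    ‖coef I φ b‖ₑ ≤
      8 * ENNReal.ofReal B * geo I.gen k * avg I.gen (fun y => ‖b y‖ₑ) I.base := by
  have hB := h.nonneg
  have hbc := integrable_conj hb
  -- The step function equal to `φ` at the left endpoints integrates to zero against `b` on each
  -- cell, so only the oscillation of `φ` on cells of length `2^{-k}` is left.
  have hstep : ∀ y, φ (pt k (cellIdx k y)) * conj (b y)
      = ∑ j ∈ Finset.range (2 ^ k), φ (pt k j) * (cell k j).indicator (fun y => conj (b y)) y := by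
    intro y
    rw [Finset.sum_eq_single_of_mem (cellIdx k y) (Finset.mem_range.2 (cellIdx_lt k y)),
      Set.indicator_of_mem (show y ∈ cell k (cellIdx k y) from rfl)]
    intro j _ hj
    have hy : y ∉ cell k j := fun hy => hj (Eq.symm hy)
    rw [Set.indicator_of_notMem hy, mul_zero]
  have hstep_int : ∀ j, Integrable fun y =>
      φ (pt k j) * (cell k j).indicator (fun y => conj (b y)) y := fun j =>
    (hbc.indicator (measurableSet_cell k j)).const_mul _
  have hint1 : Integrable fun y => φ (pt k (cellIdx k y)) * conj (b y) := by
    simp only [hstep]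
    exact integrable_finsetSum _ fun j _ => hstep_int j
  have hzero : ∫ y, φ (pt k (cellIdx k y)) * conj (b y) = 0 := by
    simp only [hstep]
    rw [integral_finsetSum _ fun j _ => hstep_int j]
    refine Finset.sum_eq_zero fun j hj => ?_
    rw [integral_const_mul, integral_indicator (measurableSet_cell k j), integral_conj,
      hb0 j (Finset.mem_range.1 hj), map_zero, mul_zero]
  have e : pairing φ b = ∫ y, (φ y - φ (pt k (cellIdx k y))) * conj (b y) := by
    simp only [sub_mul]
    rw [integral_sub (h.integrable_mul_conj hb) hint1, hzero, sub_zero, pairing]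
  have hpt : ∀ y, ‖φ y - φ (pt k (cellIdx k y))‖ₑ ≤
      8 * ENNReal.ofReal B * geo I.gen k * ew I.gen I.base y ^ 3 := by
    intro y
    have hd : dist (pt k (cellIdx k y)) y ≤ (2 ^ k : ℝ)⁻¹ := dist_pt_le rfl
    obtain ⟨i, rfl⟩ := Nat.exists_eq_add_of_le hk
    set p := pt (I.gen + i) (cellIdx (I.gen + i) y)
    have hd2 : 2 ^ I.gen * dist p y ≤ (2⁻¹ : ℝ) ^ i := by
      calc 2 ^ I.gen * dist p y ≤ 2 ^ I.gen * (2 ^ (I.gen + i) : ℝ)⁻¹ := by gcongr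
        _ = _ := by rw [pow_add, inv_pow]; field_simp
    have hi : (2⁻¹ : ℝ) ^ i ≤ 1 := pow_le_one₀ (by norm_num) (by norm_num)
    have h1 := h.lip 3 (by norm_num) p y
    have hw := w_nonneg I.gen y I.base
    have h2 : ‖φ y - φ p‖ ≤ 8 * B * (2⁻¹ : ℝ) ^ i * w I.gen I.base y ^ 3 := by
      rw [norm_sub_rev, w_comm I.gen I.base]
      calc _ ≤ _ := h1
        _ ≤ B * (2⁻¹ : ℝ) ^ i * (1 + 1) ^ 3 * w I.gen y I.base ^ 3 := by
            gcongr; exact hd2.trans hi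
        _ = _ := by ring
    rw [geo_of_le hk, Nat.add_sub_cancel_left, ← ofReal_norm, ew, ← ofReal_two_inv_pow,
      ← ENNReal.ofReal_ofNat, ← ENNReal.ofReal_pow (w_nonneg _ _ _),
      ← ENNReal.ofReal_mul (by positivity), ← ENNReal.ofReal_mul (by positivity),
      ← ENNReal.ofReal_mul (by positivity)]
    exact ENNReal.ofReal_le_ofReal h2
  rw [coef, enorm_mul, enorm_two_pow, e]
  calc _ ≤ 2 ^ I.gen * ∫⁻ y, (8 * ENNReal.ofReal B * geo I.gen k) *
        (‖b y‖ₑ * ew I.gen I.base y ^ 3) := by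
        gcongr
        refine (enorm_integral_le_lintegral_enorm _).trans (lintegral_mono fun y => ?_)
        rw [enorm_mul, RCLike.enorm_conj]
        calc _ ≤ (8 * ENNReal.ofReal B * geo I.gen k * ew I.gen I.base y ^ 3) * ‖b y‖ₑ := by
              gcongr; exact hpt y
          _ = _ := by ring
    _ = _ := by
        have hg : geo I.gen k ≠ ⊤ := ((geo_le_one _ _).trans_lt ENNReal.one_lt_top).ne
        rw [avg, ← lintegral_const_mul' _ _ (by finiteness),
          ← lintegral_const_mul' _ _ (by finiteness)]
        refine lintegral_congr fun x => ?_
        rw [ker]; ring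

/-- If the interval is at least as long as the cells, the cancellation of `b` gives the geometric
factor. If it is at most as long, no cancellation is used: the support of `b` is at distance at
least `2^{-k}` from `x` and the decay suffices, with a power to spare. -/
lemma enorm_coef_mul_le_of_cancel {B : ℝ} {I : DyadicInterval} {φ : UnitAddCircle → ℂ}
    (h : IsMolecule B I.gen I.base φ) {k : ℕ} {b : UnitAddCircle → ℂ}
    (hb : Integrable b) (hb0 : ∀ j < 2 ^ k, ∫ x in cell k j, b x = 0) {x : UnitAddCircle}
    (hx : ∀ y, b y ≠ 0 → (2 ^ k : ℝ)⁻¹ ≤ dist x y) :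
    ‖coef I φ b‖ₑ * ew I.gen x I.base ^ 3 ≤ 8 * ENNReal.ofReal B *
      (geo I.gen k * (avg I.gen (fun y => ‖b y‖ₑ) x + avg k (fun y => ‖b y‖ₑ) x)) := by
  rcases le_total I.gen k with hk | hk
  · calc _ ≤ 8 * ENNReal.ofReal B * geo I.gen k * avg I.gen (fun y => ‖b y‖ₑ) I.base *
          ew I.gen x I.base ^ 3 := by gcongr; exact enorm_coef_le_of_cancel h hk hb hb0
      _ = 8 * ENNReal.ofReal B * (geo I.gen k * (avg I.gen (fun y => ‖b y‖ₑ) I.base *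
          ew I.gen x I.base ^ 3)) := by ring
      _ ≤ _ := by
          gcongr
          exact (avg_mul_ew_le _ _ _ _).trans le_self_add
  · calc _ ≤ ENNReal.ofReal B * avg I.gen (fun y => ‖b y‖ₑ) x := enorm_coef_mul_le h b x
      _ ≤ ENNReal.ofReal B * (8 * 2⁻¹ ^ (2 * (I.gen - k)) * avg k (fun y => ‖b y‖ₑ) x) := by
          gcongr
          exact avg_le_of_far hk fun y hy => hx y (by simpa using hy)
      _ ≤ ENNReal.ofReal B * (8 * 2⁻¹ ^ (I.gen - k) * avg k (fun y => ‖b y‖ₑ) x) := by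
          gcongr ENNReal.ofReal B * (8 * ?_ * _)
          exact pow_le_pow_of_le_one zero_le (by simp) (by omega)
      _ = 8 * ENNReal.ofReal B * (geo I.gen k * avg k (fun y => ‖b y‖ₑ) x) := by
          rw [geo_comm, geo_of_le hk]; ring
      _ ≤ _ := by gcongr; exact le_add_self

/-! ### The Calderón–Zygmund decomposition -/

/-- The mean of `f` over the dyadic cell of generation `k` that contains `x`. -/
noncomputable def cellMean (k : ℕ) (f : UnitAddCircle → ℂ) (x : UnitAddCircle) : ℂ :=
  2 ^ k * ∫ y in cell k (cellIdx k x), f y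

lemma cellMean_congr {k : ℕ} (f : UnitAddCircle → ℂ) {x y : UnitAddCircle}
    (hxy : cellIdx k x = cellIdx k y) : cellMean k f x = cellMean k f y := by
  rw [cellMean, cellMean, hxy]

lemma measurable_of_cellIdx {β : Type*} [MeasurableSpace β] {k : ℕ} {f : UnitAddCircle → β}
    (h : ∀ x y, cellIdx k x = cellIdx k y → f x = f y) : Measurable f := by
  have hS : ∀ s : Set β, IsSaturated k (f ⁻¹' s) := fun s x y hxy hx => by
    rw [Set.mem_preimage, ← h x y hxy]; exact hx
  exact fun s _ => (hS s).measurableSet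

lemma measurable_cellMean (k : ℕ) (f : UnitAddCircle → ℂ) : Measurable (cellMean k f) :=
  measurable_of_cellIdx fun _ _ h => cellMean_congr f h

lemma enorm_cellMean_le (k : ℕ) (f : UnitAddCircle → ℂ) (x : UnitAddCircle) :
    ‖cellMean k f x‖ₑ ≤ cellAvg k (fun y => ‖f y‖ₑ) x := by
  rw [cellMean, cellAvg, enorm_mul, enorm_two_pow]
  gcongr
  exact enorm_integral_le_lintegral_enorm _

lemma setLIntegral_cellAvg_le {k : ℕ} {S : Set UnitAddCircle} (hS : IsSaturated k S)
    (h : UnitAddCircle → ℝ≥0∞) : ∫⁻ x in S, cellAvg k h x ≤ ∫⁻ x in S, h x := by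
  refine hS.setLIntegral_le fun j hj _ => ?_
  have e : ∫⁻ x in cell k j, cellAvg k h x = ∫⁻ x in cell k j, 2 ^ k * ∫⁻ y in cell k j, h y :=
    setLIntegral_congr_fun (measurableSet_cell k j) fun x hx => by
      have hx' : cellIdx k x = j := hx
      simp only [cellAvg, hx']
  rw [e, setLIntegral_const, volume_cell hj]
  refine le_of_eq ?_
  calc _ = (2 ^ k * 2⁻¹ ^ k) * ∫⁻ y in cell k j, h y := by ring
    _ = _ := by rw [two_pow_mul_inv_pow, one_mul]

/-- The part of `f` on `S` with its means over the cells of generation `k` removed. -/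
noncomputable def badPart (k : ℕ) (S : Set UnitAddCircle) (f : UnitAddCircle → ℂ) :
    UnitAddCircle → ℂ := S.indicator fun x => f x - cellMean k f x

lemma lintegral_enorm_badPart_le {k : ℕ} {S : Set UnitAddCircle} (hS : IsSaturated k S)
    {f : UnitAddCircle → ℂ} (hf : Measurable f) :
    ∫⁻ x, ‖badPart k S f x‖ₑ ≤ 2 * ∫⁻ x in S, ‖f x‖ₑ := by
  calc ∫⁻ x, ‖badPart k S f x‖ₑ = ∫⁻ x in S, ‖f x - cellMean k f x‖ₑ := by
        rw [← lintegral_indicator hS.measurableSet]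
        refine lintegral_congr fun x => ?_
        rw [badPart, enorm_indicator_eq_indicator_enorm]
    _ ≤ ∫⁻ x in S, (‖f x‖ₑ + cellAvg k (fun y => ‖f y‖ₑ) x) :=
        lintegral_mono fun x => enorm_sub_le.trans (by gcongr; exact enorm_cellMean_le k f x)
    _ = (∫⁻ x in S, ‖f x‖ₑ) + ∫⁻ x in S, cellAvg k (fun y => ‖f y‖ₑ) x :=
        lintegral_add_left hf.enorm _
    _ ≤ (∫⁻ x in S, ‖f x‖ₑ) + ∫⁻ x in S, ‖f x‖ₑ := by
        exact add_le_add le_rfl (setLIntegral_cellAvg_le hS _)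
    _ = _ := (two_mul _).symm

lemma measurable_badPart {k : ℕ} {S : Set UnitAddCircle} (hS : IsSaturated k S)
    {f : UnitAddCircle → ℂ} (hf : Measurable f) : Measurable (badPart k S f) :=
  (hf.sub (measurable_cellMean k f)).indicator hS.measurableSet

lemma integrable_badPart {k : ℕ} {S : Set UnitAddCircle} (hS : IsSaturated k S)
    {f : UnitAddCircle → ℂ} (hf : Measurable f) (hfi : Integrable f) :
    Integrable (badPart k S f) := by
  refine ⟨(measurable_badPart hS hf).aestronglyMeasurable,
    (lintegral_enorm_badPart_le hS hf).trans_lt ?_⟩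
  have : ∫⁻ x in S, ‖f x‖ₑ ≠ ⊤ := ((setLIntegral_le_lintegral _ _).trans_lt hfi.2).ne
  finiteness

lemma integral_cell_badPart {k : ℕ} {S : Set UnitAddCircle} (hS : IsSaturated k S)
    {f : UnitAddCircle → ℂ} (hfi : Integrable f) {j : ℕ} (hj : j < 2 ^ k) :
    ∫ x in cell k j, badPart k S f x = 0 := by
  by_cases hp : pt k j ∈ S
  · have e : ∫ x in cell k j, badPart k S f x
        = ∫ x in cell k j, (f x - 2 ^ k * ∫ y in cell k j, f y) :=
      setIntegral_congr_fun (measurableSet_cell k j) fun x hx => by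
        have hx' : cellIdx k x = j := hx
        change S.indicator _ x = _
        rw [Set.indicator_of_mem (hS ((pt_mem_cell hj).trans hx'.symm) hp)]
        simp only [cellMean, hx']
    rw [e, integral_sub hfi.integrableOn (integrable_const _), setIntegral_const, measureReal_def,
      volume_cell hj, ENNReal.toReal_pow, ENNReal.toReal_inv]
    simp
  · have e : ∫ x in cell k j, badPart k S f x = ∫ x in cell k j, 0 :=
      setIntegral_congr_fun (measurableSet_cell k j) fun x hx => by
        have hx' : cellIdx k x = j := hx
        exact Set.indicator_of_notMem (fun hx2 => hp (hS (hx'.trans (pt_mem_cell hj).symm) hx2)) _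
    rw [e, integral_zero]

lemma cellAvg_eq_of_step {K : ℕ} {h : UnitAddCircle → ℝ≥0∞}
    (hh : ∀ x y, cellIdx K x = cellIdx K y → h x = h y) (x : UnitAddCircle) :
    cellAvg K h x = h x := by
  have e : ∫⁻ y in cell K (cellIdx K x), h y = ∫⁻ _ in cell K (cellIdx K x), h x :=
    setLIntegral_congr_fun (measurableSet_cell K _) fun y hy => hh y x hy
  rw [cellAvg, e, setLIntegral_const, volume_cell_cellIdx]
  calc _ = (2 ^ K * 2⁻¹ ^ K) * h x := by ring
    _ = _ := by rw [two_pow_mul_inv_pow, one_mul]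

/-- The Calderón–Zygmund decomposition at height `t` of a dyadic step function, with the bounds of
the coefficients of its bad part. -/
lemma exists_calderon_zygmund {K : ℕ} {f : UnitAddCircle → ℂ}
    (hstep : ∀ x y, cellIdx K x = cellIdx K y → f x = f y) (hfi : Integrable f) {t : ℝ≥0∞}
    (hf1 : ∫⁻ x, ‖f x‖ₑ ≤ 1) (ht : 1 ≤ t) :
    ∃ (F b : UnitAddCircle → ℂ) (R : ℕ → UnitAddCircle → ℝ≥0∞) (E : Set UnitAddCircle),
      Measurable F ∧ Integrable F ∧ Integrable b ∧ (∀ x, f x = F x + b x) ∧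
      (∀ x, ‖F x‖ₑ ≤ 2 * t) ∧ ∫⁻ x, ‖F x‖ₑ ≤ 3 ∧
      (∀ m, Measurable (R m)) ∧ ∫⁻ x, ∑' m, R m x ≤ 192 ∧ t * volume E ≤ 4 ∧
      ∀ (B : ℝ) (I : DyadicInterval) (φ : UnitAddCircle → ℂ), IsMolecule B I.gen I.base φ →
        ∀ x ∉ E, ‖coef I φ b‖ₑ * ew I.gen x I.base ^ 3 ≤ 8 * ENNReal.ofReal B * R I.gen x := by
  have hf : Measurable f := measurable_of_cellIdx hstep
  set h : UnitAddCircle → ℝ≥0∞ := fun y => ‖f y‖ₑ with hh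
  have hht : ∫⁻ x, h x ≤ t := hf1.trans ht
  set S := stopCells h t with hSdef
  have hS : ∀ k, IsSaturated k (S k) := isSaturated_stopCells h t
  set N := Finset.range (K + 1) with hN
  set bk : ℕ → UnitAddCircle → ℂ := fun k => badPart k (S k) f with hbk
  have hbki : ∀ k, Integrable (bk k) := fun k => integrable_badPart (hS k) hf hfi
  have hbkm : ∀ k, Measurable (bk k) := fun k => measurable_badPart (hS k) hf
  set b : UnitAddCircle → ℂ := fun x => ∑ k ∈ N, bk k x with hb
  have hbi : Integrable b := integrable_finsetSum _ fun k _ => hbki k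
  have hbm : Measurable b := Finset.measurable_fun_sum _ fun k _ => hbkm k
  have hbsum : ∑ k ∈ N, ∫⁻ x, ‖bk k x‖ₑ ≤ 2 := by
    calc _ ≤ ∑ k ∈ N, 2 * ∫⁻ x in S k, h x :=
          Finset.sum_le_sum fun k _ => lintegral_enorm_badPart_le (hS k) hf
      _ = 2 * ∫⁻ x in ⋃ k ∈ N, S k, h x := by
          rw [← Finset.mul_sum, lintegral_biUnion_finset
            (fun i _ j _ hij => disjoint_stopCells h t hij) (fun j _ => (hS j).measurableSet)]
      _ ≤ 2 * 1 := by gcongr; exact (setLIntegral_le_lintegral _ _).trans hf1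
      _ = 2 := mul_one _
  -- This bound depends on the generation `m` but not on the molecule. The integral over `x`, summed
  -- over `m`, is at most `3 · 32 · 2`: the geometric weights, two averages of norm 16, and the
  -- total mass of the bad parts.
  set R : ℕ → UnitAddCircle → ℝ≥0∞ := fun m x => ∑ k ∈ N, geo m k *
    (avg m (fun y => ‖bk k y‖ₑ) x + avg k (fun y => ‖bk k y‖ₑ) x) with hR
  have hbk_avg : ∀ m k, Measurable (avg m fun y => ‖bk k y‖ₑ) := fun m k =>
    measurable_avg m (hbkm k).enorm
  have hRk : ∀ m k, Measurable fun x => geo m k *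
      (avg m (fun y => ‖bk k y‖ₑ) x + avg k (fun y => ‖bk k y‖ₑ) x) := fun m k =>
    ((hbk_avg m k).add (hbk_avg k k)).const_mul _
  have hRm : ∀ m, Measurable (R m) := fun m => Finset.measurable_fun_sum _ fun k _ => hRk m k
  refine ⟨fun x => f x - b x, b, R, badSet h t K, hf.sub hbm, hfi.sub hbi, hbi,
    fun x => (sub_add_cancel _ _).symm, ?_, ?_, hRm, ?_, ?_, ?_⟩
  · intro x
    change ‖f x - b x‖ₑ ≤ 2 * t
    by_cases hx : ∃ k ≤ K, t < cellAvg k h x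
    · obtain ⟨k, hk, hxk⟩ := hx
      obtain ⟨i, hi, hxi⟩ := exists_mem_stopCells hxk
      have hbx : b x = f x - cellMean i f x := by
        rw [hb]
        simp only
        rw [Finset.sum_eq_single_of_mem i (Finset.mem_range.2 (by omega))]
        · exact Set.indicator_of_mem hxi _
        · intro j _ hj
          exact Set.indicator_of_notMem
            (fun hxj => Set.disjoint_left.1 (disjoint_stopCells h t hj) hxj hxi) _
      rw [hbx, sub_sub_cancel]
      exact (enorm_cellMean_le i f x).trans (cellAvg_le_of_mem_stopCells hht hxi.2)
    -- No ancestor up to generation `K` is stopped. There the step function equals its own average,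
    -- so it is bounded by `t` without any differentiation theorem.
    · push Not at hx
      have hbx : b x = 0 := Finset.sum_eq_zero fun k hk => Set.indicator_of_notMem
        (fun hxk => absurd hxk.1 (not_lt.2 (hx k (Nat.lt_succ_iff.1 (Finset.mem_range.1 hk))))) _
      rw [hbx, sub_zero]
      have := hx K le_rfl
      rw [cellAvg_eq_of_step (fun x y hxy => by rw [hh]; simp only [hstep x y hxy])] at this
      exact this.trans (le_mul_of_one_le_left zero_le (by norm_num))
  · calc ∫⁻ x, ‖f x - b x‖ₑ ≤ ∫⁻ x, (‖f x‖ₑ + ∑ k ∈ N, ‖bk k x‖ₑ) :=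
          lintegral_mono fun x => enorm_sub_le.trans (by gcongr; exact enorm_sum_le _ _)
      _ = (∫⁻ x, ‖f x‖ₑ) + ∑ k ∈ N, ∫⁻ x, ‖bk k x‖ₑ := by
          rw [lintegral_add_left hf.enorm, lintegral_finsetSum _ fun k _ => (hbkm k).enorm]
      _ ≤ 1 + 2 := add_le_add hf1 hbsum
      _ = 3 := by norm_num
  · rw [lintegral_tsum fun m => (hRm m).aemeasurable]
    calc _ ≤ ∑' m, ∑ k ∈ N, geo k m * (32 * ∫⁻ x, ‖bk k x‖ₑ) := by
          refine ENNReal.tsum_le_tsum fun m => ?_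
          rw [hR]
          simp only
          rw [lintegral_finsetSum _ fun k _ => hRk m k]
          refine Finset.sum_le_sum fun k _ => ?_
          have hgt : geo m k ≠ ⊤ := ((geo_le_one _ _).trans_lt ENNReal.one_lt_top).ne
          rw [lintegral_const_mul' _ _ hgt, lintegral_add_left (hbk_avg m k), geo_comm]
          gcongr
          calc _ ≤ (16 * ∫⁻ x, ‖bk k x‖ₑ) + 16 * ∫⁻ x, ‖bk k x‖ₑ :=
                add_le_add (lintegral_avg_le m (hbkm k).enorm) (lintegral_avg_le k (hbkm k).enorm)
            _ = _ := by ring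
      _ = ∑ k ∈ N, (∑' m, geo k m) * (32 * ∫⁻ x, ‖bk k x‖ₑ) := by
          rw [Summable.tsum_finsetSum fun k _ => ENNReal.summable]
          exact Finset.sum_congr rfl fun k _ => ENNReal.tsum_mul_right
      _ ≤ ∑ k ∈ N, 3 * (32 * ∫⁻ x, ‖bk k x‖ₑ) := by gcongr; exact tsum_geo_le _
      _ = 96 * ∑ k ∈ N, ∫⁻ x, ‖bk k x‖ₑ := by
          rw [Finset.mul_sum]; exact Finset.sum_congr rfl fun k _ => by ring
      _ ≤ 96 * 2 := by gcongr
      _ = 192 := by norm_num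
  · calc _ ≤ 4 * ∫⁻ x, h x := mul_volume_badSet_le h t K
      _ ≤ 4 * 1 := by gcongr
      _ = 4 := mul_one _
  · intro B I φ hφ x hx
    rw [hb, coef_sum hφ I N hbki, hR]
    calc _ ≤ (∑ k ∈ N, ‖coef I φ (bk k)‖ₑ) * ew I.gen x I.base ^ 3 := by
          gcongr; exact enorm_sum_le _ _
      _ ≤ _ := by
          rw [Finset.sum_mul, Finset.mul_sum]
          refine Finset.sum_le_sum fun k hk => enorm_coef_mul_le_of_cancel hφ (hbki k)
            (fun j hj => integral_cell_badPart (hS k) hfi hj) fun y hy => ?_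
          by_contra hcon
          have hyS : y ∈ S k := by
            by_contra hyS
            exact hy (Set.indicator_of_notMem hyS _)
          exact hx (Set.mem_biUnion hk ⟨y, hyS, (not_le.1 hcon).le⟩)

section

/-! ### Partial sums of the paraproduct -/

/-- The hypotheses of the theorem on the three families, in terms of molecules. -/
structure IsParaData (B : ℝ) (a : Fin 3) (φ : Fin 3 → DyadicInterval → UnitAddCircle → ℂ)
    (ε : DyadicInterval → ℂ) : Prop where
  mol : ∀ i, IsMolecules B (φ i)
  mean : ∀ i, i ≠ a → ∀ I, ∫ x : UnitAddCircle, φ i I x = 0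
  eps : ∀ I, ‖ε I‖ ≤ 1

/-- The partial sum of the paraproduct over a finite set of dyadic intervals. -/
noncomputable def psum (ε : DyadicInterval → ℂ)
    (φ : Fin 3 → DyadicInterval → UnitAddCircle → ℂ) (F : Finset DyadicInterval)
    (f g : UnitAddCircle → ℂ) (x : UnitAddCircle) : ℂ :=
  ∑ I ∈ F, ε I * coef I (φ 0 I) f * coef I (φ 1 I) g * φ 2 I x

lemma pairing_normalize (φ : DyadicInterval → UnitAddCircle → ℂ) (I : DyadicInterval)
    (f : UnitAddCircle → ℂ) :
    pairing (normalize φ I) f = ((I.length ^ (-(1 / 2) : ℝ) : ℝ) : ℂ) * pairing (φ I) f := by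
  simp only [pairing, normalize, mul_assoc]
  exact integral_const_mul _ _

/-- There are four factors `|I|^{-1/2}`, one explicit and three from normalizations; together they
make `2^k` for each of the two coefficients. -/
lemma paraproductTerm_eq (ε : DyadicInterval → ℂ)
    (φ : Fin 3 → DyadicInterval → UnitAddCircle → ℂ) (f g : UnitAddCircle → ℂ)
    (I : DyadicInterval) (x : UnitAddCircle) :
    paraproductTerm ε φ f g I x = ε I * coef I (φ 0 I) f * coef I (φ 1 I) g * φ 2 I x := by
  set r : ℝ := I.length ^ (-(1 / 2) : ℝ) with hr
  have h2 : (0 : ℝ) < 2 ^ I.gen := by positivity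
  have hr2 : r ^ 2 = 2 ^ I.gen := by
    rw [hr, I.length_eq, ← Real.rpow_natCast, ← Real.rpow_mul (by positivity)]
    norm_num
    rw [Real.rpow_neg_one, inv_inv]
  have hr2' : (r : ℂ) ^ 2 = 2 ^ I.gen := by exact_mod_cast hr2
  rw [paraproductTerm, pairing_normalize, pairing_normalize, normalize, coef, coef, ← hr,
    ← hr2']
  ring

lemma sum_paraproductTerm_eq (ε : DyadicInterval → ℂ)
    (φ : Fin 3 → DyadicInterval → UnitAddCircle → ℂ) (F : Finset DyadicInterval)
    (f g : UnitAddCircle → ℂ) :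
    (fun x => ∑ I ∈ F, paraproductTerm ε φ f g I x) = psum ε φ F f g := by
  ext x
  exact Finset.sum_congr rfl fun I _ => paraproductTerm_eq ε φ f g I x

variable {B : ℝ} {a : Fin 3} {φ : Fin 3 → DyadicInterval → UnitAddCircle → ℂ}
  {ε : DyadicInterval → ℂ}

lemma continuous_psum (hD : IsParaData B a φ ε) (F : Finset DyadicInterval)
    (f g : UnitAddCircle → ℂ) : Continuous (psum ε φ F f g) :=
  continuous_finsetSum _ fun I _ => continuous_const.mul (hD.mol 2 I).cont

lemma psum_add_left (hD : IsParaData B a φ ε) (F : Finset DyadicInterval)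
    {f f' : UnitAddCircle → ℂ} (hf : Integrable f) (hf' : Integrable f') (g : UnitAddCircle → ℂ)
    (x : UnitAddCircle) :
    psum ε φ F (fun y => f y + f' y) g x = psum ε φ F f g x + psum ε φ F f' g x := by
  rw [psum, psum, psum, ← Finset.sum_add_distrib]
  refine Finset.sum_congr rfl fun I _ => ?_
  rw [coef_add (hD.mol 0 I) I hf hf']; ring

lemma psum_add_right (hD : IsParaData B a φ ε) (F : Finset DyadicInterval)
    (f : UnitAddCircle → ℂ) {g g' : UnitAddCircle → ℂ} (hg : Integrable g) (hg' : Integrable g')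
    (x : UnitAddCircle) :
    psum ε φ F f (fun y => g y + g' y) x = psum ε φ F f g x + psum ε φ F f g' x := by
  rw [psum, psum, psum, ← Finset.sum_add_distrib]
  refine Finset.sum_congr rfl fun I _ => ?_
  rw [coef_add (hD.mol 1 I) I hg hg']; ring

lemma psum_smul (F : Finset DyadicInterval) (f g : UnitAddCircle → ℂ) (r s : ℝ)
    (x : UnitAddCircle) : psum ε φ F (fun y => r * f y) (fun y => s * g y) x
      = (r * s : ℝ) * psum ε φ F f g x := by
  rw [psum, psum, Finset.mul_sum]
  refine Finset.sum_congr rfl fun I _ => ?_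
  rw [coef_smul, coef_smul]; push_cast; ring

lemma psum_congr_ae (F : Finset DyadicInterval) {f f' g g' : UnitAddCircle → ℂ}
    (hf : f =ᵐ[volume] f') (hg : g =ᵐ[volume] g') : psum ε φ F f g = psum ε φ F f' g' := by
  ext x
  refine Finset.sum_congr rfl fun I _ => ?_
  rw [coef_congr_ae I _ hf, coef_congr_ae I _ hg]

lemma IsParaData.enorm_eps_le (hD : IsParaData B a φ ε) (I : DyadicInterval) : ‖ε I‖ₑ ≤ 1 := by
  rw [← ofReal_norm]
  exact ENNReal.ofReal_le_one.2 (hD.eps I)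

/-- The eight powers of decay are spent as `3 + 3 + 2`: three move each coefficient to the point
`x`, and two sum over the positions within a generation. What is left is a sum over generations. -/
lemma enorm_sum_mul_le (hD : IsParaData B a φ ε) (F : Finset DyadicInterval)
    {c d e : DyadicInterval → ℂ} {u v r : ℕ → ℝ≥0∞} {x : UnitAddCircle}
    (hc : ∀ I ∈ F, ‖c I‖ₑ * ew I.gen x I.base ^ 3 ≤ u I.gen)
    (hd : ∀ I ∈ F, ‖d I‖ₑ * ew I.gen x I.base ^ 3 ≤ v I.gen)
    (he : ∀ I ∈ F, ‖e I‖ₑ ≤ r I.gen * ew I.gen x I.base ^ 8) :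
    ‖∑ I ∈ F, ε I * c I * d I * e I‖ₑ ≤ 64 * ∑' m, r m * (u m * v m) := by
  calc _ ≤ ∑ I ∈ F, r I.gen * (u I.gen * v I.gen) * ew I.gen x I.base ^ 2 := by
        refine (enorm_sum_le _ _).trans (Finset.sum_le_sum fun I hI => ?_)
        rw [enorm_mul, enorm_mul, enorm_mul]
        calc _ ≤ 1 * ‖c I‖ₑ * ‖d I‖ₑ * (r I.gen * ew I.gen x I.base ^ 8) := by
              gcongr
              · exact hD.enorm_eps_le I
              · exact he I hI
          _ = r I.gen * ((‖c I‖ₑ * ew I.gen x I.base ^ 3) *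
              (‖d I‖ₑ * ew I.gen x I.base ^ 3)) * ew I.gen x I.base ^ 2 := by ring
          _ ≤ _ := by
              gcongr
              · exact hc I hI
              · exact hd I hI
    _ ≤ ∑' I : DyadicInterval,
          r I.gen * (u I.gen * v I.gen) * ew I.gen x I.base ^ 2 := ENNReal.sum_le_tsum F
    _ ≤ ∑' m, 64 * (r m * (u m * v m)) := by
        refine tsum_dyadic_le (a := fun m j => r m * (u m * v m) * ew m x (pt m j) ^ 2)
          fun m => ?_
        rw [← Finset.mul_sum]
        calc _ ≤ r m * (u m * v m) * 64 := by gcongr; exact sum_ew_sq_le m x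
          _ = _ := by ring
    _ = _ := ENNReal.tsum_mul_left

lemma enorm_sum_term_le (hD : IsParaData B a φ ε) (F : Finset DyadicInterval)
    {c d : DyadicInterval → ℂ} {u v : ℕ → ℝ≥0∞} {x : UnitAddCircle}
    (hc : ∀ I ∈ F, ‖c I‖ₑ * ew I.gen x I.base ^ 3 ≤ u I.gen)
    (hd : ∀ I ∈ F, ‖d I‖ₑ * ew I.gen x I.base ^ 3 ≤ v I.gen) :
    ‖∑ I ∈ F, ε I * c I * d I * φ 2 I x‖ₑ ≤ 64 * ENNReal.ofReal B * ∑' m, u m * v m := by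
  refine (enorm_sum_mul_le hD F (r := fun _ => ENNReal.ofReal B) hc hd
    fun I _ => (hD.mol 2 I).enorm_le le_rfl x).trans ?_
  rw [ENNReal.tsum_mul_left, mul_assoc]

/-! ### Partial sums for bounded functions -/

lemma lintegral_enorm_molecule_le {k : ℕ} {c : UnitAddCircle} {ψ : UnitAddCircle → ℂ}
    (h : IsMolecule B k c ψ) : ∫⁻ x, ‖ψ x‖ₑ ≤ 16 * ENNReal.ofReal B * 2⁻¹ ^ k := by
  calc ∫⁻ x, ‖ψ x‖ₑ ≤ ∫⁻ x, ENNReal.ofReal B * ew k c x ^ 2 := lintegral_mono fun x => by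
        rw [ew_comm]; exact h.enorm_le (by norm_num) x
    _ = ENNReal.ofReal B * ∫⁻ x, ew k c x ^ 2 := lintegral_const_mul' _ _ (by finiteness)
    _ ≤ ENNReal.ofReal B * (16 * 2⁻¹ ^ k) := by gcongr; exact lintegral_ew_sq_le k c
    _ = _ := by ring

lemma lintegral_sq_le_of_bound {f : UnitAddCircle → ℂ} {A D : ℝ≥0∞} (hA : A ≠ ⊤)
    (hfA : ∀ x, ‖f x‖ₑ ≤ A) (hfD : ∫⁻ x, ‖f x‖ₑ ≤ D) : ∫⁻ x, ‖f x‖ₑ ^ 2 ≤ A * D := by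
  calc ∫⁻ x, ‖f x‖ₑ ^ 2 ≤ ∫⁻ x, A * ‖f x‖ₑ := lintegral_mono fun x => by
        rw [sq]; gcongr; exact hfA x
    _ = A * ∫⁻ x, ‖f x‖ₑ := lintegral_const_mul' _ _ hA
    _ ≤ A * D := by gcongr

lemma tsum_coef_sq_le {ψ : DyadicInterval → UnitAddCircle → ℂ} (hψ : IsMolecules B ψ)
    (h0 : ∀ I, ∫ x, ψ I x = 0) {f : UnitAddCircle → ℂ} (hf : Measurable f) (hfi : Integrable f)
    {A D : ℝ≥0∞} (hA : A ≠ ⊤) (hfA : ∀ x, ‖f x‖ₑ ≤ A) (hfD : ∫⁻ x, ‖f x‖ₑ ≤ D) :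
    ∑' I, ‖coef I (ψ I) f‖ₑ ^ 2 * 2⁻¹ ^ I.gen ≤ 12288 * ENNReal.ofReal B ^ 2 * (A * D) := by
  rw [ENNReal.tsum_eq_iSup_sum]
  refine iSup_le fun F => (sum_coef_sq_le hψ h0 F hf hfi).trans ?_
  gcongr
  exact lintegral_sq_le_of_bound hA hfA hfD

lemma enorm_coef_le_of_bound {I : DyadicInterval} {ψ : UnitAddCircle → ℂ}
    (h : IsMolecule B I.gen I.base ψ) {f : UnitAddCircle → ℂ} {A : ℝ≥0∞}
    (hfA : ∀ x, ‖f x‖ₑ ≤ A) : ‖coef I ψ f‖ₑ ≤ 16 * ENNReal.ofReal B * A := by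
  calc _ ≤ ENNReal.ofReal B * avg I.gen (fun y => ‖f y‖ₑ) I.base := enorm_coef_le h
    _ ≤ ENNReal.ofReal B * (16 * A) := by gcongr; exact avg_le_of_le _ hfA _
    _ = _ := by ring

/-- The constant in the bounds for bounded functions. -/
noncomputable def boundedConst (B : ℝ) : ℝ≥0∞ :=
  393216 * ENNReal.ofReal B ^ 3 + 12288 ^ 2 * 256 * ENNReal.ofReal B ^ 6

lemma boundedConst_ne_top (B : ℝ) : boundedConst B ≠ ⊤ := by rw [boundedConst]; finiteness

/-- The third family has mean zero here, so almost orthogonality applies to the output functions. -/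
lemma lintegral_psum_sq_le (hD : IsParaData B a φ ε) (ha : a ≠ 2) (F : Finset DyadicInterval)
    (f g : UnitAddCircle → ℂ) :
    ∫⁻ x, ‖psum ε φ F f g x‖ₑ ^ 2 ≤ 12288 * ENNReal.ofReal B ^ 2 *
      ∑ I ∈ F, (‖coef I (φ 0 I) f‖ₑ * ‖coef I (φ 1 I) g‖ₑ) ^ 2 * 2⁻¹ ^ I.gen := by
  refine (lintegral_sum_sq_le (hD.mol 2) (hD.mean 2 ha.symm) F
    fun I => ε I * coef I (φ 0 I) f * coef I (φ 1 I) g).trans ?_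
  gcongr with I _
  rw [enorm_mul, enorm_mul, mul_assoc]
  exact mul_le_of_le_one_left zero_le (hD.enorm_eps_le I)

/-- The bounds for bounded functions: the partial sums are dominated in `L¹` or in `L²` by the
sums of a summable family. -/
lemma psum_bounded (hD : IsParaData B a φ ε) {f g : UnitAddCircle → ℂ} (hf : Measurable f)
    (hfi : Integrable f) (hg : Measurable g) (hgi : Integrable g) {A D : ℝ≥0∞} (hA : A ≠ ⊤)
    (hfA : ∀ x, ‖f x‖ₑ ≤ A) (hgA : ∀ x, ‖g x‖ₑ ≤ A) (hfD : ∫⁻ x, ‖f x‖ₑ ≤ D)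
    (hgD : ∫⁻ x, ‖g x‖ₑ ≤ D) :
    ∃ s : DyadicInterval → ℝ≥0∞,
      (∑' I, s I ≤ boundedConst B * (A * D) ∧
        ∀ F : Finset DyadicInterval, ∫⁻ x, ‖psum ε φ F f g x‖ₑ ≤ ∑ I ∈ F, s I) ∨
      (∑' I, s I ≤ boundedConst B * (A ^ 3 * D) ∧
        ∀ F : Finset DyadicInterval, ∫⁻ x, ‖psum ε φ F f g x‖ₑ ^ 2 ≤ ∑ I ∈ F, s I) := by
  set b := ENNReal.ofReal B with hb
  -- For `a = 2` the coefficients of both functions are square summable and their products are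
  -- summable, which gives `L¹`. Otherwise the third family is almost orthogonal, the coefficients
  -- of one function are square summable and those of the other bounded, which gives `L²`.
  obtain rfl | rfl | rfl : a = 2 ∨ a = 0 ∨ a = 1 := by
    fin_cases a <;> simp
  · have h0 := tsum_coef_sq_le (hD.mol 0) (hD.mean 0 (by decide)) hf hfi hA hfA hfD
    have h1 := tsum_coef_sq_le (hD.mol 1) (hD.mean 1 (by decide)) hg hgi hA hgA hgD
    refine ⟨fun I => 16 * b * (‖coef I (φ 0 I) f‖ₑ ^ 2 * 2⁻¹ ^ I.gen +
      ‖coef I (φ 1 I) g‖ₑ ^ 2 * 2⁻¹ ^ I.gen), Or.inl ⟨?_, fun F => ?_⟩⟩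
    · rw [ENNReal.tsum_mul_left, ENNReal.tsum_add]
      calc _ ≤ 16 * b * (12288 * b ^ 2 * (A * D) + 12288 * b ^ 2 * (A * D)) := by gcongr
        _ = 393216 * b ^ 3 * (A * D) := by ring
        _ ≤ _ := by gcongr; exact le_self_add
    · have hmul : ∀ p q : ℝ≥0∞, p * q ≤ p ^ 2 + q ^ 2 := fun p q => by
        rcases le_total p q with h | h
        · calc p * q ≤ q * q := by gcongr
            _ = q ^ 2 := by ring
            _ ≤ _ := le_add_self
        · calc p * q ≤ p * p := by gcongr
            _ = p ^ 2 := by ring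
            _ ≤ _ := le_self_add
      calc _ ≤ ∫⁻ x, ∑ I ∈ F, ‖coef I (φ 0 I) f‖ₑ * ‖coef I (φ 1 I) g‖ₑ * ‖φ 2 I x‖ₑ := by
            refine lintegral_mono fun x => (enorm_sum_le _ _).trans
              (Finset.sum_le_sum fun I _ => ?_)
            rw [enorm_mul, enorm_mul, enorm_mul]
            gcongr
            exact mul_le_of_le_one_left zero_le (hD.enorm_eps_le I)
        _ = ∑ I ∈ F, ‖coef I (φ 0 I) f‖ₑ * ‖coef I (φ 1 I) g‖ₑ * ∫⁻ x, ‖φ 2 I x‖ₑ := by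
            rw [lintegral_finsetSum _ fun I _ =>
              ((hD.mol 2 I).cont.measurable.enorm).const_mul _]
            exact Finset.sum_congr rfl fun I _ => lintegral_const_mul' _ _ (by finiteness)
        _ ≤ _ := by
            refine Finset.sum_le_sum fun I _ => ?_
            calc _ ≤ (‖coef I (φ 0 I) f‖ₑ ^ 2 + ‖coef I (φ 1 I) g‖ₑ ^ 2) *
                  (16 * b * 2⁻¹ ^ I.gen) :=
                  mul_le_mul' (hmul _ _) (lintegral_enorm_molecule_le (hD.mol 2 I))
              _ = _ := by ring
  · have h1 := tsum_coef_sq_le (hD.mol 1) (hD.mean 1 (by decide)) hg hgi hA hgA hgD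
    refine ⟨fun I => 12288 * b ^ 2 * ((16 * b * A) ^ 2 *
      (‖coef I (φ 1 I) g‖ₑ ^ 2 * 2⁻¹ ^ I.gen)), Or.inr ⟨?_, fun F => ?_⟩⟩
    · rw [ENNReal.tsum_mul_left, ENNReal.tsum_mul_left]
      calc _ ≤ 12288 * b ^ 2 * ((16 * b * A) ^ 2 * (12288 * b ^ 2 * (A * D))) := by gcongr
        _ = 12288 ^ 2 * 256 * b ^ 6 * (A ^ 3 * D) := by ring
        _ ≤ _ := by gcongr; exact le_add_self
    · refine (lintegral_psum_sq_le hD (by decide) F f g).trans ?_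
      rw [← Finset.mul_sum]
      refine mul_le_mul_right (Finset.sum_le_sum fun I _ => ?_) _
      rw [mul_pow, mul_assoc]
      exact mul_le_mul_left (pow_le_pow_left₀ zero_le
        (enorm_coef_le_of_bound (hD.mol 0 I) hfA) 2) _
  · have h0 := tsum_coef_sq_le (hD.mol 0) (hD.mean 0 (by decide)) hf hfi hA hfA hfD
    refine ⟨fun I => 12288 * b ^ 2 * ((16 * b * A) ^ 2 *
      (‖coef I (φ 0 I) f‖ₑ ^ 2 * 2⁻¹ ^ I.gen)), Or.inr ⟨?_, fun F => ?_⟩⟩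
    · rw [ENNReal.tsum_mul_left, ENNReal.tsum_mul_left]
      calc _ ≤ 12288 * b ^ 2 * ((16 * b * A) ^ 2 * (12288 * b ^ 2 * (A * D))) := by gcongr
        _ = 12288 ^ 2 * 256 * b ^ 6 * (A ^ 3 * D) := by ring
        _ ≤ _ := by gcongr; exact le_add_self
    · refine (lintegral_psum_sq_le hD (by decide) F f g).trans ?_
      rw [← Finset.mul_sum]
      refine mul_le_mul_right (Finset.sum_le_sum fun I _ => ?_) _
      rw [mul_pow, mul_comm (_ ^ 2) (‖coef I (φ 1 I) g‖ₑ ^ 2), mul_assoc]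
      exact mul_le_mul_left (pow_le_pow_left₀ zero_le
        (enorm_coef_le_of_bound (hD.mol 1 I) hgA) 2) _

/-- The threshold constant in the weak type bound. -/
noncomputable def weakConst (B : ℝ) : ℝ≥0∞ := 1 + 36864 * ENNReal.ofReal B ^ 3

lemma weakConst_ne_top (B : ℝ) : weakConst B ≠ ⊤ := by rw [weakConst]; finiteness

/-- The measure constant in the weak type bound. -/
noncomputable def weakConst' (B : ℝ) : ℝ≥0∞ := 392 + 24 * boundedConst B

lemma weakConst'_ne_top (B : ℝ) : weakConst' B ≠ ⊤ := by
  have := boundedConst_ne_top B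
  rw [weakConst']; finiteness

/-- Both functions have mass at most 1 and are decomposed at the height `t`, while the level is of
order `t²`. The exceptional sets have measure `O(1/t)`, and the part of the sum made of good
functions is handled by Chebyshev's inequality. -/
lemma mul_volume_psum_step_le (hD : IsParaData B a φ ε) (F : Finset DyadicInterval) {K : ℕ}
    {f g : UnitAddCircle → ℂ} (hfs : ∀ x y, cellIdx K x = cellIdx K y → f x = f y)
    (hgs : ∀ x y, cellIdx K x = cellIdx K y → g x = g y) (hfi : Integrable f)
    (hgi : Integrable g) (hf1 : ∫⁻ x, ‖f x‖ₑ ≤ 1) (hg1 : ∫⁻ x, ‖g x‖ₑ ≤ 1) {t : ℝ≥0∞}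
    (htt : t ≠ ⊤) :
    t * volume {x | weakConst B * t ^ 2 < ‖psum ε φ F f g x‖ₑ} ≤ weakConst' B := by
  by_cases ht : t < 1
  · calc _ ≤ t * 1 := by gcongr; exact prob_le_one
      _ ≤ 1 := by rw [mul_one]; exact ht.le
      _ ≤ 392 := by norm_num
      _ ≤ _ := le_self_add
  push Not at ht
  have ht0 : t ≠ 0 := (zero_lt_one.trans_le ht).ne'
  set b := ENNReal.ofReal B with hb
  obtain ⟨f₁, f₂, R, E, hf₁m, hf₁i, hf₂i, hfe, hf₁A, hf₁D, hRm, hR, hE, hfb⟩ :=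
    exists_calderon_zygmund hfs hfi hf1 ht
  obtain ⟨g₁, g₂, R', E', hg₁m, hg₁i, hg₂i, hge, hg₁A, hg₁D, hRm', hR', hE', hgb⟩ :=
    exists_calderon_zygmund hgs hgi hg1 ht
  set U : UnitAddCircle → ℝ≥0∞ := fun x => ∑' m, R m x with hU
  set V : UnitAddCircle → ℝ≥0∞ := fun x => ∑' m, R' m x with hV
  have hsplit : ∀ x, psum ε φ F f g x = psum ε φ F f₁ g₁ x + psum ε φ F f₁ g₂ x +
      (psum ε φ F f₂ g₁ x + psum ε φ F f₂ g₂ x) := fun x => by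
    rw [show f = fun x => f₁ x + f₂ x from funext hfe,
      show g = fun x => g₁ x + g₂ x from funext hge, psum_add_left hD F hf₁i hf₂i,
      psum_add_right hD F f₁ hg₁i hg₂i, psum_add_right hD F f₂ hg₁i hg₂i]
  have hgood : ∀ {i : Fin 3} {h : UnitAddCircle → ℂ}, (∀ x, ‖h x‖ₑ ≤ 2 * t) →
      ∀ x, ∀ I : DyadicInterval, ‖coef I (φ i I) h‖ₑ * ew I.gen x I.base ^ 3 ≤ 32 * b * t := by
    intro i h hh x I
    calc _ ≤ b * avg I.gen (fun y => ‖h y‖ₑ) x := enorm_coef_mul_le (hD.mol i I) h x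
      _ ≤ b * (16 * (2 * t)) := by gcongr; exact avg_le_of_le _ hh x
      _ = _ := by ring
  -- In the mixed terms the coefficients of the good part are uniformly `O(t)`, and those of the bad
  -- part are summable over the generations.
  have h12 : ∀ x ∉ E', ‖psum ε φ F f₁ g₂ x‖ₑ ≤ 16384 * b ^ 3 * t * V x := fun x hx => by
    refine (enorm_sum_term_le hD F (u := fun _ => 32 * b * t) (v := fun m => 8 * b * R' m x)
      (fun I _ => hgood hf₁A x I) (fun I _ => hgb B I _ (hD.mol 1 I) x hx)).trans ?_
    rw [ENNReal.tsum_mul_left, ENNReal.tsum_mul_left, hV]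
    exact le_of_eq (by ring)
  have h21 : ∀ x ∉ E, ‖psum ε φ F f₂ g₁ x‖ₑ ≤ 16384 * b ^ 3 * t * U x := fun x hx => by
    refine (enorm_sum_term_le hD F (v := fun _ => 32 * b * t) (u := fun m => 8 * b * R m x)
      (fun I _ => hfb B I _ (hD.mol 0 I) x hx) (fun I _ => hgood hg₁A x I)).trans ?_
    rw [ENNReal.tsum_mul_right, ENNReal.tsum_mul_left, hU]
    exact le_of_eq (by ring)
  have h22 : ∀ x ∉ E, x ∉ E' → ‖psum ε φ F f₂ g₂ x‖ₑ ≤ 4096 * b ^ 3 * U x * V x := by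
    intro x hx hx'
    refine (enorm_sum_term_le hD F (v := fun m => 8 * b * R' m x) (u := fun m => 8 * b * R m x)
      (fun I _ => hfb B I _ (hD.mol 0 I) x hx)
      (fun I _ => hgb B I _ (hD.mol 1 I) x hx')).trans ?_
    -- One of the two factors is bounded by its sum over all generations, so the sum of products is
    -- at most the product `U x * V x`.
    calc _ ≤ 64 * b * ∑' m, 64 * b ^ 2 * U x * R' m x := by
          refine mul_le_mul_right (ENNReal.tsum_le_tsum fun m => ?_) _
          calc _ = 64 * b ^ 2 * R m x * R' m x := by ring
            _ ≤ _ := mul_le_mul_left (mul_le_mul_right (ENNReal.le_tsum m) _) _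
      _ = 64 * b * (64 * b ^ 2 * U x * V x) := by rw [ENNReal.tsum_mul_left]
      _ = _ := by ring
  have hsub : {x | weakConst B * t ^ 2 < ‖psum ε φ F f g x‖ₑ} ⊆
      {x | t ^ 2 < ‖psum ε φ F f₁ g₁ x‖ₑ} ∪ (E ∪ (E' ∪ ({x | t ≤ U x} ∪ {x | t ≤ V x}))) := by
    intro x hx
    by_contra hcon
    simp only [Set.mem_union, not_or] at hcon
    obtain ⟨c1, c2, c3, c4, c5⟩ := hcon
    replace c1 : ‖psum ε φ F f₁ g₁ x‖ₑ ≤ t ^ 2 := not_lt.1 c1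
    replace c4 : U x ≤ t := (not_le.1 c4).le
    replace c5 : V x ≤ t := (not_le.1 c5).le
    refine absurd (show weakConst B * t ^ 2 < ‖psum ε φ F f g x‖ₑ from hx) (not_lt.2 ?_)
    rw [hsplit x]
    calc _ ≤ ‖psum ε φ F f₁ g₁ x‖ₑ + ‖psum ε φ F f₁ g₂ x‖ₑ +
          (‖psum ε φ F f₂ g₁ x‖ₑ + ‖psum ε φ F f₂ g₂ x‖ₑ) :=
          (enorm_add_le _ _).trans (add_le_add (enorm_add_le _ _) (enorm_add_le _ _))
      _ ≤ t ^ 2 + 16384 * b ^ 3 * t * t + (16384 * b ^ 3 * t * t + 4096 * b ^ 3 * t * t) := by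
          refine add_le_add (add_le_add c1 ((h12 x c3).trans ?_))
            (add_le_add ((h21 x c2).trans ?_) ((h22 x c2 c3).trans ?_)) <;> gcongr
      _ = _ := by rw [weakConst, ← hb]; ring
  have hUV : ∀ {W : UnitAddCircle → ℝ≥0∞}, Measurable W → ∫⁻ x, W x ≤ 192 →
      t * volume {x | t ≤ W x} ≤ 192 := fun hW h192 =>
    (mul_meas_ge_le_lintegral hW t).trans h192
  -- With the bound `2t` and mass 3, Chebyshev compares `t²` with a multiple of `t` in `L¹`, or `t⁴`
  -- with a multiple of `t³` in `L²`; both leave `1/t`.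
  have hgg : t * volume {x | t ^ 2 < ‖psum ε φ F f₁ g₁ x‖ₑ} ≤ 24 * boundedConst B := by
    have hm : Measurable fun x => ‖psum ε φ F f₁ g₁ x‖ₑ :=
      (continuous_psum hD F f₁ g₁).measurable.enorm
    obtain ⟨s, hs⟩ := psum_bounded hD hf₁m hf₁i hg₁m hg₁i (A := 2 * t) (D := 3) (by finiteness)
      hf₁A hg₁A hf₁D hg₁D
    rcases hs with ⟨hs1, hs2⟩ | ⟨hs1, hs2⟩
    · have h1 : t * (t * volume {x | t ^ 2 < ‖psum ε φ F f₁ g₁ x‖ₑ}) ≤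
          t * (24 * boundedConst B) := by
        calc _ = t ^ 2 * volume {x | t ^ 2 < ‖psum ε φ F f₁ g₁ x‖ₑ} := by ring
          _ ≤ t ^ 2 * volume {x | t ^ 2 ≤ ‖psum ε φ F f₁ g₁ x‖ₑ} := by
              gcongr with x; exact fun h => le_of_lt h
          _ ≤ ∫⁻ x, ‖psum ε φ F f₁ g₁ x‖ₑ := mul_meas_ge_le_lintegral hm _
          _ ≤ boundedConst B * (2 * t * 3) :=
              (hs2 F).trans ((ENNReal.sum_le_tsum F).trans hs1)
          _ = t * (6 * boundedConst B) := by ring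
          _ ≤ _ := by gcongr; norm_num
      exact (ENNReal.mul_le_mul_iff_right ht0 htt).1 h1
    · have h1 : t ^ 3 * (t * volume {x | t ^ 2 < ‖psum ε φ F f₁ g₁ x‖ₑ}) ≤
          t ^ 3 * (24 * boundedConst B) := by
        calc _ = t ^ 4 * volume {x | t ^ 2 < ‖psum ε φ F f₁ g₁ x‖ₑ} := by ring
          _ ≤ t ^ 4 * volume {x | t ^ 4 ≤ ‖psum ε φ F f₁ g₁ x‖ₑ ^ 2} := by
              gcongr with x
              intro h
              calc t ^ 4 = (t ^ 2) ^ 2 := by ring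
                _ ≤ _ := by gcongr
          _ ≤ ∫⁻ x, ‖psum ε φ F f₁ g₁ x‖ₑ ^ 2 := mul_meas_ge_le_lintegral (hm.pow_const 2) _
          _ ≤ boundedConst B * ((2 * t) ^ 3 * 3) :=
              (hs2 F).trans ((ENNReal.sum_le_tsum F).trans hs1)
          _ = t ^ 3 * (24 * boundedConst B) := by ring
      exact (ENNReal.mul_le_mul_iff_right (by positivity) (by finiteness)).1 h1
  calc _ ≤ t * (volume {x | t ^ 2 < ‖psum ε φ F f₁ g₁ x‖ₑ} + (volume E + (volume E' +
        (volume {x | t ≤ U x} + volume {x | t ≤ V x})))) := by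
        gcongr
        refine (measure_mono hsub).trans ((measure_union_le _ _).trans ?_)
        gcongr
        refine (measure_union_le _ _).trans ?_
        gcongr
        refine (measure_union_le _ _).trans ?_
        gcongr
        exact measure_union_le _ _
    _ = t * volume {x | t ^ 2 < ‖psum ε φ F f₁ g₁ x‖ₑ} + (t * volume E + (t * volume E' +
        (t * volume {x | t ≤ U x} + t * volume {x | t ≤ V x}))) := by ring
    _ ≤ 24 * boundedConst B + (4 + (4 + (192 + 192))) := by
        refine add_le_add hgg (add_le_add hE (add_le_add hE' (add_le_add ?_ ?_)))
        · exact hUV (Measurable.tsum hRm) hR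
        · exact hUV (Measurable.tsum hRm') hR'
    _ = _ := by rw [weakConst']; ring

end

section

variable {B : ℝ} {a : Fin 3} {φ : Fin 3 → DyadicInterval → UnitAddCircle → ℂ}
  {ε : DyadicInterval → ℂ}

/-! ### The weak type bound -/

/-- Fatou for distribution functions: where the limit exceeds `l`, so do all late terms, since the
inequality is strict. The resulting sets increase, so their measures converge. -/
lemma mul_volume_lt_le_of_tendsto {u : ℕ → UnitAddCircle → ℝ≥0∞} {v : UnitAddCircle → ℝ≥0∞}
    (huv : ∀ᵐ x, Tendsto (fun n => u n x) atTop (nhds (v x))) {t l M : ℝ≥0∞}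
    (hu : ∀ n, t * volume {x | l < u n x} ≤ M) : t * volume {x | l < v x} ≤ M := by
  have h1 : volume {x | l < v x} ≤ volume (⋃ N : ℕ, ⋂ n ≥ N, {x | l < u n x}) := by
    refine measure_mono_ae ?_
    filter_upwards [huv] with x hx hlx
    have hev := hx.eventually (lt_mem_nhds (show l < v x from hlx))
    obtain ⟨N, hN⟩ := eventually_atTop.1 hev
    exact Set.mem_iUnion.2 ⟨N, Set.mem_iInter₂.2 hN⟩
  have hmono : Monotone fun N : ℕ => ⋂ n ≥ N, {x | l < u n x} := fun N N' hN =>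
    Set.biInter_subset_biInter_left fun n (hn : n ≥ N') => hN.trans hn
  calc _ ≤ t * volume (⋃ N : ℕ, ⋂ n ≥ N, {x | l < u n x}) := by gcongr
    _ = ⨆ N : ℕ, t * volume (⋂ n ≥ N, {x | l < u n x}) := by
        rw [hmono.measure_iUnion, ENNReal.mul_iSup]
    _ ≤ M := iSup_le fun N => le_trans (by
        gcongr; exact Set.iInter₂_subset N le_rfl) (hu N)

/-! ### Passage from dyadic step functions to integrable functions -/

lemma isSaturated_univ (k : ℕ) : IsSaturated k Set.univ := fun _ _ _ _ => Set.mem_univ _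

lemma cellMean_add_badPart (k : ℕ) (f : UnitAddCircle → ℂ) (x : UnitAddCircle) :
    f x = cellMean k f x + badPart k Set.univ f x := by
  rw [badPart, Set.indicator_univ]; ring

lemma integrable_cellMean {f : UnitAddCircle → ℂ} (hf : Measurable f) (hfi : Integrable f)
    (k : ℕ) : Integrable (cellMean k f) := by
  have : cellMean k f = fun x => f x - badPart k Set.univ f x := by
    ext x
    rw [cellMean_add_badPart k f x]; ring
  rw [this]
  exact hfi.sub (integrable_badPart (isSaturated_univ k) hf hfi)

lemma lintegral_enorm_cellMean_le (k : ℕ) (f : UnitAddCircle → ℂ) :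
    ∫⁻ x, ‖cellMean k f x‖ₑ ≤ ∫⁻ x, ‖f x‖ₑ := by
  have h := setLIntegral_cellAvg_le (isSaturated_univ k) fun x => ‖f x‖ₑ
  rw [setLIntegral_univ, setLIntegral_univ] at h
  exact (lintegral_mono fun x => enorm_cellMean_le k f x).trans h

lemma avg_le_lintegral (k : ℕ) (h : UnitAddCircle → ℝ≥0∞) (x : UnitAddCircle) :
    avg k h x ≤ 2 ^ k * ∫⁻ y, h y := by
  rw [avg, ← lintegral_const_mul' _ _ (by finiteness)]
  refine lintegral_mono fun y => ?_
  rw [mul_comm]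
  gcongr
  rw [ker]
  exact mul_le_of_le_one_right' (pow_le_one₀ zero_le (ew_le_one k x y))

/-- The difference between `f` and its cell means integrates to zero on every cell of generation
`k`, so the cancellation estimate gives a rate `2^{-k}`. Partial sums have finitely many terms, so
convergence of single coefficients is all that is required. -/
lemma tendsto_coef_cellMean {I : DyadicInterval} {ψ : UnitAddCircle → ℂ}
    (h : IsMolecule B I.gen I.base ψ) {f : UnitAddCircle → ℂ} (hf : Measurable f)
    (hfi : Integrable f) :
    Tendsto (fun k => coef I ψ (cellMean k f)) atTop (nhds (coef I ψ f)) := by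
  rw [tendsto_iff_edist_tendsto_0]
  set D : ℝ≥0∞ := 8 * ENNReal.ofReal B * (2 ^ I.gen * (2 * ∫⁻ x, ‖f x‖ₑ)) with hD
  have hDt : D ≠ ⊤ := by
    have : ∫⁻ x, ‖f x‖ₑ ≠ ⊤ := hfi.2.ne
    rw [hD]; finiteness
  have hle : ∀ᶠ k in atTop, edist (coef I ψ (cellMean k f)) (coef I ψ f)
      ≤ D * 2 ^ I.gen * 2⁻¹ ^ k := by
    filter_upwards [eventually_ge_atTop I.gen] with k hk
    have hb := integrable_badPart (isSaturated_univ k) hf hfi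
    have e : coef I ψ f = coef I ψ (cellMean k f) + coef I ψ (badPart k Set.univ f) := by
      rw [← coef_add h I (integrable_cellMean hf hfi k) hb]
      congr 1
      exact funext fun x => cellMean_add_badPart k f x
    rw [edist_comm, edist_eq_enorm_sub, e, add_sub_cancel_left]
    calc _ ≤ 8 * ENNReal.ofReal B * geo I.gen k *
          avg I.gen (fun y => ‖badPart k Set.univ f y‖ₑ) I.base :=
          enorm_coef_le_of_cancel h hk hb fun j hj =>
            integral_cell_badPart (isSaturated_univ k) hfi hj
      _ ≤ 8 * ENNReal.ofReal B * geo I.gen k * (2 ^ I.gen * (2 * ∫⁻ x, ‖f x‖ₑ)) := by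
          gcongr
          refine (avg_le_lintegral _ _ _).trans ?_
          gcongr
          refine (lintegral_enorm_badPart_le (isSaturated_univ k) hf).trans ?_
          rw [setLIntegral_univ]
      _ = D * geo I.gen k := by rw [hD]; ring
      _ = D * (2 ^ I.gen * 2⁻¹ ^ I.gen) * 2⁻¹ ^ (k - I.gen) := by
          rw [geo_of_le hk, two_pow_mul_inv_pow, mul_one]
      _ = D * 2 ^ I.gen * (2⁻¹ ^ I.gen * 2⁻¹ ^ (k - I.gen)) := by ring
      _ = _ := by rw [← pow_add, Nat.add_sub_cancel' hk]
  have hlim : Tendsto (fun k : ℕ => D * 2 ^ I.gen * (2⁻¹ : ℝ≥0∞) ^ k) atTop (nhds 0) := by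
    have := ENNReal.Tendsto.const_mul (a := D * 2 ^ I.gen)
      (ENNReal.tendsto_pow_atTop_nhds_zero_of_lt_one (r := 2⁻¹) (by simp))
      (Or.inr (by finiteness))
    rwa [mul_zero] at this
  exact tendsto_of_tendsto_of_tendsto_of_le_of_le' tendsto_const_nhds hlim
    (Eventually.of_forall fun _ => zero_le) hle

lemma mul_volume_psum_le_of_le_one (hD : IsParaData B a φ ε) (F : Finset DyadicInterval)
    {f g : UnitAddCircle → ℂ} (hf : Measurable f) (hg : Measurable g) (hfi : Integrable f)
    (hgi : Integrable g) (hf1 : ∫⁻ x, ‖f x‖ₑ ≤ 1) (hg1 : ∫⁻ x, ‖g x‖ₑ ≤ 1) {t : ℝ≥0∞}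
    (htt : t ≠ ⊤) :
    t * volume {x | weakConst B * t ^ 2 < ‖psum ε φ F f g x‖ₑ} ≤ weakConst' B := by
  refine mul_volume_lt_le_of_tendsto
    (u := fun k x => ‖psum ε φ F (cellMean k f) (cellMean k g) x‖ₑ) (ae_of_all _ fun x => ?_)
    fun k => mul_volume_psum_step_le hD F (fun _ _ h => cellMean_congr f h)
      (fun _ _ h => cellMean_congr g h) (integrable_cellMean hf hfi k)
      (integrable_cellMean hg hgi k) ((lintegral_enorm_cellMean_le k f).trans hf1)
      ((lintegral_enorm_cellMean_le k g).trans hg1) htt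
  refine (continuous_enorm.tendsto _).comp (tendsto_finsetSum F fun I _ => ?_)
  exact ((tendsto_const_nhds.mul (tendsto_coef_cellMean (hD.mol 0 I) hf hfi)).mul
    (tendsto_coef_cellMean (hD.mol 1 I) hg hgi)).mul tendsto_const_nhds

lemma coef_zero_of_lintegral {f : UnitAddCircle → ℂ} (hf : Measurable f)
    (h0 : ∫⁻ x, ‖f x‖ₑ = 0) (I : DyadicInterval) (ψ : UnitAddCircle → ℂ) : coef I ψ f = 0 := by
  have h1 : f =ᵐ[volume] fun _ => 0 := by
    rw [lintegral_eq_zero_iff hf.enorm] at h0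
    filter_upwards [h0] with x hx
    simpa using hx
  rw [coef_congr_ae I ψ h1]
  simp [coef, pairing]

/-- The weak type `(1, 1, 1/2)` bound of the paraproduct. -/
lemma mul_volume_psum_le (hD : IsParaData B a φ ε) (F : Finset DyadicInterval)
    {f g : UnitAddCircle → ℂ} (hf : Measurable f) (hg : Measurable g) {α β : ℝ≥0∞}
    (hα : α ≠ ⊤) (hβ : β ≠ ⊤) (hf1 : ∫⁻ x, ‖f x‖ₑ ≤ α) (hg1 : ∫⁻ x, ‖g x‖ₑ ≤ β) {t : ℝ≥0∞}
    (htt : t ≠ ⊤) :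
    t * volume {x | weakConst B * (α * β) * t ^ 2 < ‖psum ε φ F f g x‖ₑ} ≤ weakConst' B := by
  by_cases h0 : α = 0 ∨ β = 0
  · have hz : ∀ x, psum ε φ F f g x = 0 := fun x => Finset.sum_eq_zero fun I _ => by
      rcases h0 with rfl | rfl
      · rw [coef_zero_of_lintegral hf (le_antisymm hf1 zero_le)]; ring
      · rw [coef_zero_of_lintegral hg (le_antisymm hg1 zero_le)]; ring
    simp [hz]
  push Not at h0
  have hfi : Integrable f := ⟨hf.aestronglyMeasurable, hf1.trans_lt hα.lt_top⟩
  have hgi : Integrable g := ⟨hg.aestronglyMeasurable, hg1.trans_lt hβ.lt_top⟩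
  have hα' := ENNReal.toReal_pos h0.1 hα
  have hβ' := ENNReal.toReal_pos h0.2 hβ
  have scale : ∀ {h : UnitAddCircle → ℂ} {γ : ℝ≥0∞}, γ ≠ 0 → γ ≠ ⊤ → Measurable h →
      ∫⁻ x, ‖h x‖ₑ ≤ γ → ∫⁻ x, ‖((γ.toReal⁻¹ : ℝ) : ℂ) * h x‖ₑ ≤ 1 := by
    intro h γ hγ0 hγ hh hle
    have e : ‖((γ.toReal⁻¹ : ℝ) : ℂ)‖ₑ = γ⁻¹ := by
      rw [← ofReal_norm, Complex.norm_real, Real.norm_of_nonneg (by positivity),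
        ENNReal.ofReal_inv_of_pos (ENNReal.toReal_pos hγ0 hγ), ENNReal.ofReal_toReal hγ]
    simp only [enorm_mul, e]
    rw [lintegral_const_mul _ hh.enorm]
    calc _ ≤ γ⁻¹ * γ := by gcongr
      _ = 1 := ENNReal.inv_mul_cancel hγ0 hγ
  have key := mul_volume_psum_le_of_le_one hD F
    (hf.const_mul ((α.toReal⁻¹ : ℝ) : ℂ)) (hg.const_mul ((β.toReal⁻¹ : ℝ) : ℂ))
    (hfi.const_mul _) (hgi.const_mul _) (scale h0.1 hα hf hf1) (scale h0.2 hβ hg hg1) htt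
  have hab : α * β ≠ 0 := mul_ne_zero h0.1 h0.2
  have habt : α * β ≠ ⊤ := by finiteness
  convert key using 3
  ext x
  rw [Set.mem_ofPred_eq, Set.mem_ofPred_eq, psum_smul, enorm_mul,
    ← ofReal_norm (((α.toReal⁻¹ * β.toReal⁻¹ : ℝ)) : ℂ),
    Complex.norm_real, Real.norm_of_nonneg (by positivity), ← mul_inv, ← ENNReal.toReal_mul,
    ENNReal.ofReal_inv_of_pos (by rw [ENNReal.toReal_mul]; positivity),
    ENNReal.ofReal_toReal (by finiteness)]
  rw [← ENNReal.div_eq_inv_mul, ENNReal.lt_div_iff_mul_lt (Or.inl hab) (Or.inl habt)]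
  rw [show weakConst B * (α * β) * t ^ 2 = weakConst B * t ^ 2 * (α * β) by ring]

/-! ### The local estimate -/

/-- The value at the left endpoint of the cell of `x` of the part of the partial sum with intervals
at least as long as the cell. -/
noncomputable def localMean (ε : DyadicInterval → ℂ)
    (φ : Fin 3 → DyadicInterval → UnitAddCircle → ℂ) (F : Finset DyadicInterval)
    (f g : UnitAddCircle → ℂ) (k : ℕ) (x : UnitAddCircle) : ℂ :=
  psum ε φ (F.filter fun I => I.gen ≤ k) f g (pt k (cellIdx k x))

lemma localMean_zero (F : Finset DyadicInterval) (f g : UnitAddCircle → ℂ) (x : UnitAddCircle) :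
    localMean ε φ F f g 0 x = 0 := by
  have : F.filter (fun I => I.gen ≤ 0) = ∅ := by
    ext I; simp [DyadicInterval.gen]
  rw [localMean, this, psum, Finset.sum_empty]

lemma localMean_congr (F : Finset DyadicInterval) (f g : UnitAddCircle → ℂ) {k : ℕ}
    {x y : UnitAddCircle} (h : cellIdx k x = cellIdx k y) :
    localMean ε φ F f g k x = localMean ε φ F f g k y := by rw [localMean, localMean, h]

lemma inv_two_pow_anti {k m : ℕ} (h : k ≤ m) : (2 ^ m : ℝ)⁻¹ ≤ (2 ^ k : ℝ)⁻¹ :=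
  inv_anti₀ (by positivity) (pow_le_pow_right₀ (by norm_num) h)

/-- The part of the sum with long intervals varies little on a cell. -/
lemma enorm_psum_long_sub_le (hD : IsParaData B a φ ε) (F : Finset DyadicInterval)
    (f g : UnitAddCircle → ℂ) {k : ℕ} {x y : UnitAddCircle} (hxy : cellIdx k y = cellIdx k x) :
    ‖psum ε φ (F.filter fun I => I.gen ≤ k) f g y - localMean ε φ F f g k x‖ₑ ≤
      3145728 * ENNReal.ofReal B ^ 3 *
        (maxFn (fun z => ‖f z‖ₑ) x * maxFn (fun z => ‖g z‖ₑ) x) := by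
  set b := ENNReal.ofReal B with hb
  set p := pt k (cellIdx k x) with hp
  set Mf := maxFn (fun z => ‖f z‖ₑ) x
  set Mg := maxFn (fun z => ‖g z‖ₑ) x
  have hpx : dist p x ≤ (2 ^ k : ℝ)⁻¹ := dist_pt_le rfl
  have hpy : dist p y ≤ (2 ^ k : ℝ)⁻¹ := dist_pt_le hxy
  have e : psum ε φ (F.filter fun I => I.gen ≤ k) f g y - localMean ε φ F f g k x =
      ∑ I ∈ F.filter fun I => I.gen ≤ k,
        ε I * coef I (φ 0 I) f * coef I (φ 1 I) g * (φ 2 I y - φ 2 I p) := by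
    rw [localMean, psum, psum, ← Finset.sum_sub_distrib]
    exact Finset.sum_congr rfl fun I _ => by ring
  have hco : ∀ (i : Fin 3) (h : UnitAddCircle → ℂ), ∀ I ∈ F.filter fun I => I.gen ≤ k,
      ‖coef I (φ i I) h‖ₑ * ew I.gen p I.base ^ 3 ≤ 8 * b * maxFn (fun z => ‖h z‖ₑ) x := by
    intro i h I hI
    have hIk := (Finset.mem_filter.1 hI).2
    calc _ ≤ b * avg I.gen (fun z => ‖h z‖ₑ) p := enorm_coef_mul_le (hD.mol i I) h p
      _ ≤ b * (8 * avg I.gen (fun z => ‖h z‖ₑ) x) := by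
          gcongr; exact avg_le_avg_of_dist_le (hpx.trans (inv_two_pow_anti hIk)) _
      _ ≤ b * (8 * maxFn (fun z => ‖h z‖ₑ) x) := by gcongr; exact avg_le_maxFn _ _ _
      _ = _ := by ring
  have he : ∀ I ∈ F.filter fun I => I.gen ≤ k, ‖φ 2 I y - φ 2 I p‖ₑ ≤
      256 * b * geo k I.gen * ew I.gen p I.base ^ 8 := by
    intro I hI
    have hIk : I.gen ≤ k := (Finset.mem_filter.1 hI).2
    -- Taking `N = 8` keeps the full decay demanded by `enorm_sum_mul_le`, together with the factor
    -- `2^{-(k - I.gen)}` that makes the long intervals summable.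
    have h1 := (hD.mol 2 I).lip 8 le_rfl y p
    have hB := (hD.mol 2 I).nonneg
    have hd : 2 ^ I.gen * dist y p ≤ (2⁻¹ : ℝ) ^ (k - I.gen) := by
      obtain ⟨i, rfl⟩ := Nat.exists_eq_add_of_le hIk
      rw [dist_comm]
      calc _ ≤ 2 ^ I.gen * (2 ^ (I.gen + i) : ℝ)⁻¹ := by gcongr
        _ = _ := by rw [Nat.add_sub_cancel_left, pow_add, inv_pow]; field_simp
    have hi : (2⁻¹ : ℝ) ^ (k - I.gen) ≤ 1 := pow_le_one₀ (by norm_num) (by norm_num)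
    have hw := w_nonneg I.gen p I.base
    have h2 : ‖φ 2 I y - φ 2 I p‖ ≤
        256 * B * (2⁻¹ : ℝ) ^ (k - I.gen) * w I.gen p I.base ^ 8 := by
      calc _ ≤ _ := h1
        _ ≤ B * (2⁻¹ : ℝ) ^ (k - I.gen) * (1 + 1) ^ 8 * w I.gen p I.base ^ 8 := by
            gcongr; exact hd.trans hi
        _ = _ := by ring
    rw [geo_comm, geo_of_le hIk, hb, ← ofReal_norm, ew, ← ofReal_two_inv_pow,
      ← ENNReal.ofReal_ofNat, ← ENNReal.ofReal_pow (w_nonneg _ _ _),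
      ← ENNReal.ofReal_mul (by positivity), ← ENNReal.ofReal_mul (by positivity),
      ← ENNReal.ofReal_mul (by positivity)]
    exact ENNReal.ofReal_le_ofReal h2
  rw [e]
  refine (enorm_sum_mul_le hD _ (u := fun _ => 8 * b * Mf) (v := fun _ => 8 * b * Mg)
    (r := fun m => 256 * b * geo k m) (hco 0 f) (hco 1 g) he).trans ?_
  rw [ENNReal.tsum_mul_right, ENNReal.tsum_mul_left]
  calc _ ≤ 64 * (256 * b * 3 * (8 * b * Mf * (8 * b * Mg))) := by
        gcongr; exact tsum_geo_le k
    _ = _ := by ring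

lemma enorm_indicator_le (N : Set UnitAddCircle) (f : UnitAddCircle → ℂ) (x : UnitAddCircle) :
    ‖N.indicator f x‖ₑ ≤ ‖f x‖ₑ := by
  rw [enorm_indicator_eq_indicator_enorm]
  exact Set.indicator_le_self _ _ _

/-- The part of the sum with short intervals is small on a cell if one of the functions vanishes
near the cell. -/
lemma enorm_psum_short_le (hD : IsParaData B a φ ε) (F : Finset DyadicInterval)
    {f f' g g' : UnitAddCircle → ℂ} {k : ℕ} {x y : UnitAddCircle}
    (hxy : cellIdx k y = cellIdx k x) (hf : ∀ z, ‖f' z‖ₑ ≤ ‖f z‖ₑ) (hg : ∀ z, ‖g' z‖ₑ ≤ ‖g z‖ₑ)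
    (hfar : (∀ z, f' z ≠ 0 → (2 ^ k : ℝ)⁻¹ ≤ dist y z) ∨
      ∀ z, g' z ≠ 0 → (2 ^ k : ℝ)⁻¹ ≤ dist y z) :
    ‖psum ε φ (F.filter fun I => ¬ I.gen ≤ k) f' g' y‖ₑ ≤ 98304 * ENNReal.ofReal B ^ 3 *
        (maxFn (fun z => ‖f z‖ₑ) x * maxFn (fun z => ‖g z‖ₑ) x) := by
  set b := ENNReal.ofReal B with hb
  have hyx : dist y x ≤ (2 ^ k : ℝ)⁻¹ := dist_le_of_cellIdx_eq hxy
  have hav : ∀ {h h' : UnitAddCircle → ℂ}, (∀ z, ‖h' z‖ₑ ≤ ‖h z‖ₑ) →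
      avg k (fun z => ‖h' z‖ₑ) y ≤ 8 * maxFn (fun z => ‖h z‖ₑ) x := fun hh =>
    (avg_mono k hh y).trans ((avg_le_avg_of_dist_le hyx _).trans
      (by gcongr; exact avg_le_maxFn _ _ _))
  have near : ∀ (i : Fin 3) {h h' : UnitAddCircle → ℂ}, (∀ z, ‖h' z‖ₑ ≤ ‖h z‖ₑ) →
      ∀ I ∈ F.filter fun I => ¬ I.gen ≤ k, ‖coef I (φ i I) h'‖ₑ * ew I.gen y I.base ^ 3 ≤
        8 * b * 2 ^ (I.gen - k) * maxFn (fun z => ‖h z‖ₑ) x := by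
    intro i h h' hh I hI
    have hIk : k ≤ I.gen := (not_le.1 (Finset.mem_filter.1 hI).2).le
    calc _ ≤ b * avg I.gen (fun z => ‖h' z‖ₑ) y := enorm_coef_mul_le (hD.mol i I) h' y
      _ ≤ b * (2 ^ (I.gen - k) * (8 * maxFn (fun z => ‖h z‖ₑ) x)) := by
          gcongr
          exact (avg_le_coarse hIk _ y).trans (by gcongr; exact hav hh)
      _ = _ := by ring
  have far : ∀ (i : Fin 3) {h h' : UnitAddCircle → ℂ}, (∀ z, ‖h' z‖ₑ ≤ ‖h z‖ₑ) →
      (∀ z, h' z ≠ 0 → (2 ^ k : ℝ)⁻¹ ≤ dist y z) →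
      ∀ I ∈ F.filter fun I => ¬ I.gen ≤ k, ‖coef I (φ i I) h'‖ₑ * ew I.gen y I.base ^ 3 ≤
        64 * b * (2⁻¹ ^ (I.gen - k) * geo k I.gen) * maxFn (fun z => ‖h z‖ₑ) x := by
    intro i h h' hh hfar I hI
    have hIk : k ≤ I.gen := (not_le.1 (Finset.mem_filter.1 hI).2).le
    calc _ ≤ b * avg I.gen (fun z => ‖h' z‖ₑ) y := enorm_coef_mul_le (hD.mol i I) h' y
      _ ≤ b * (8 * 2⁻¹ ^ (2 * (I.gen - k)) * (8 * maxFn (fun z => ‖h z‖ₑ) x)) := by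
          gcongr
          exact (avg_le_of_far hIk fun z hz => hfar z (by simpa using hz)).trans
            (by gcongr; exact hav hh)
      _ = _ := by rw [geo_of_le hIk]; ring
  -- One function gains `2^{-2(m-k)}` by being far away, the other loses at most `2^{m-k}` by being
  -- measured at scale `2^{-k}`; the remaining factor sums to at most 3.
  have hsum : ∀ Mf Mg : ℝ≥0∞, 64 * b * ∑' m, 64 * b * (2⁻¹ ^ (m - k) * geo k m) * Mf *
      (8 * b * 2 ^ (m - k) * Mg) ≤ 98304 * b ^ 3 * (Mf * Mg) := by
    intro Mf Mg
    calc _ = 64 * b * ∑' m, 512 * b ^ 2 * (Mf * Mg) * geo k m := by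
          congr 2; ext m
          calc _ = 512 * b ^ 2 * (Mf * Mg) * geo k m * (2 ^ (m - k) * 2⁻¹ ^ (m - k)) := by ring
            _ = _ := by rw [two_pow_mul_inv_pow, mul_one]
      _ ≤ 64 * b * (512 * b ^ 2 * (Mf * Mg) * 3) := by
          rw [ENNReal.tsum_mul_left]; gcongr; exact tsum_geo_le k
      _ = _ := by ring
  rcases hfar with hfar | hfar
  · exact (enorm_sum_term_le hD _
      (u := fun m => 64 * b * (2⁻¹ ^ (m - k) * geo k m) * maxFn (fun z => ‖f z‖ₑ) x)
      (v := fun m => 8 * b * 2 ^ (m - k) * maxFn (fun z => ‖g z‖ₑ) x)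
      (far 0 hf hfar) (near 1 hg)).trans (hsum _ _)
  · refine (enorm_sum_term_le hD _
      (v := fun m => 64 * b * (2⁻¹ ^ (m - k) * geo k m) * maxFn (fun z => ‖g z‖ₑ) x)
      (u := fun m => 8 * b * 2 ^ (m - k) * maxFn (fun z => ‖f z‖ₑ) x)
      (near 0 hf) (far 1 hg hfar)).trans ?_
    rw [mul_comm (maxFn (fun z => ‖f z‖ₑ) x)]
    refine le_trans (le_of_eq ?_) (hsum _ _)
    congr 2; ext m; ring

/-- The constant in the local estimate. -/
noncomputable def localConst (B : ℝ) (s : ℝ≥0∞) : ℝ≥0∞ :=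
  3342336 * ENNReal.ofReal B ^ 3 + 4096 * weakConst B * s ^ 2

lemma localConst_ne_top (B : ℝ) {s : ℝ≥0∞} (hs : s ≠ ⊤) : localConst B s ≠ ⊤ := by
  have := weakConst_ne_top B
  rw [localConst]; finiteness

/-- On each dyadic cell the partial sum is close to a constant, up to the product of the maximal
functions, outside a set of small relative measure. -/
lemma mul_volume_local_le (hD : IsParaData B a φ ε) (F : Finset DyadicInterval)
    {f g : UnitAddCircle → ℂ} (hf : Measurable f) (hg : Measurable g) (hfi : Integrable f)
    (hgi : Integrable g) {s : ℝ≥0∞} (hs : s ≠ ⊤) (k : ℕ) (x : UnitAddCircle) :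
    s * 2 ^ k * volume {y | cellIdx k y = cellIdx k x ∧
      localConst B s * (maxFn (fun z => ‖f z‖ₑ) x * maxFn (fun z => ‖g z‖ₑ) x) <
        ‖psum ε φ F f g y - localMean ε φ F f g k x‖ₑ} ≤ weakConst' B := by
  classical
  set b := ENNReal.ofReal B with hb
  set Mf := maxFn (fun z => ‖f z‖ₑ) x with hMf
  set Mg := maxFn (fun z => ‖g z‖ₑ) x with hMg
  set p := pt k (cellIdx k x) with hp
  have hpx : dist p x ≤ (2 ^ k : ℝ)⁻¹ := dist_pt_le rfl
  -- The radius is twice the length of the cell, so points outside `N` are at distance at least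
  -- `2^{-k}` from every point of the cell.
  set N := Metric.closedBall p (2 * (2 ^ k : ℝ)⁻¹) with hN
  have hNm : MeasurableSet N := measurableSet_closedBall
  set Fs := F.filter fun I => ¬ I.gen ≤ k with hFs
  have hloc : ∀ {h : UnitAddCircle → ℂ}, Measurable h →
      ∫⁻ z, ‖N.indicator h z‖ₑ ≤ 64 * 2⁻¹ ^ k * avg k (fun z => ‖h z‖ₑ) x := by
    intro h hh
    rw [avg, ← lintegral_const_mul' _ _ (by finiteness)]
    refine lintegral_mono fun z => ?_
    by_cases hz : z ∈ N
    · rw [Set.indicator_of_mem hz]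
      have hzx : dist x z ≤ 3 * (2 ^ k : ℝ)⁻¹ := by
        have h1 := dist_triangle_left x z p
        have h2 : dist z p ≤ 2 * (2 ^ k : ℝ)⁻¹ := hz
        rw [dist_comm z p] at h2
        linarith
      have hw : (1 / 4 : ℝ) ≤ w k x z := by
        have h2 : (0 : ℝ) < 2 ^ k := by positivity
        rw [w, one_div]
        refine inv_anti₀ (w_den_pos _ _ _) ?_
        have : 2 ^ k * dist x z ≤ 2 ^ k * (3 * (2 ^ k : ℝ)⁻¹) := by gcongr
        have e : 2 ^ k * (3 * (2 ^ k : ℝ)⁻¹) = 3 := by field_simp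
        linarith
      have hew : 1 ≤ 4 * ew k x z := by
        rw [ew, ← ENNReal.ofReal_ofNat, ← ENNReal.ofReal_mul (by norm_num)]
        exact ENNReal.one_le_ofReal.2 (by linarith)
      calc ‖h z‖ₑ = 1 ^ 3 * 1 * ‖h z‖ₑ := by ring
        _ ≤ (4 * ew k x z) ^ 3 * (2 ^ k * 2⁻¹ ^ k) * ‖h z‖ₑ := by
            rw [two_pow_mul_inv_pow]; gcongr
        _ = _ := by rw [ker]; ring
    · rw [Set.indicator_of_notMem hz, enorm_zero]; exact zero_le
  have hfint : ∀ {h : UnitAddCircle → ℂ}, Integrable h → avg k (fun z => ‖h z‖ₑ) x ≠ ⊤ := by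
    intro h hh
    have : ∫⁻ y, ‖h y‖ₑ ≠ ⊤ := hh.2.ne
    exact ((avg_le_lintegral k _ x).trans_lt (by finiteness)).ne
  have hfin := hfint hfi
  have hgin := hfint hgi
  -- The masses on `N` are at most `64 · 2^{-k}` times the averages at `x`. For `t = s 2^k` the
  -- level becomes `64² s²` times the product of the averages: the powers of `2^k` cancel.
  have key := mul_volume_psum_le hD Fs (hf.indicator hNm) (hg.indicator hNm) (by finiteness)
    (by finiteness) (hloc hf) (hloc hg) (t := s * 2 ^ k) (by finiteness)
  refine le_trans ?_ key
  gcongr with y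
  rintro ⟨hy, hlt⟩
  by_contra hcon
  refine absurd hlt (not_lt.2 ?_)
  have hyp : dist p y ≤ (2 ^ k : ℝ)⁻¹ := dist_pt_le hy
  have hfar : ∀ {h : UnitAddCircle → ℂ} z, Nᶜ.indicator h z ≠ 0 →
      (2 ^ k : ℝ)⁻¹ ≤ dist y z := by
    intro h z hz
    have hzN : z ∈ Nᶜ := Set.mem_of_indicator_ne_zero hz
    have h1 : 2 * (2 ^ k : ℝ)⁻¹ < dist z p := by
      by_contra hc
      exact hzN (Metric.mem_closedBall.2 (not_lt.1 hc))
    have h2 := dist_triangle z y p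
    rw [dist_comm z y, dist_comm y p] at h2
    linarith
  have hsp : ∀ h : UnitAddCircle → ℂ, h = fun z => N.indicator h z + Nᶜ.indicator h z :=
    fun h => funext fun z => (Set.indicator_self_add_compl_apply N h z).symm
  have hfi1 := hfi.indicator hNm
  have hfi2 := hfi.indicator hNm.compl
  have hgi1 := hgi.indicator hNm
  have hgi2 := hgi.indicator hNm.compl
  -- The last two pieces each have one function supported away from the cell, which is all the
  -- short-interval estimate needs; the other function need not be localized.
  have e1 : psum ε φ Fs f g y = psum ε φ Fs (N.indicator f) (N.indicator g) y +
      psum ε φ Fs (N.indicator f) (Nᶜ.indicator g) y + psum ε φ Fs (Nᶜ.indicator f) g y := by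
    have h1 : psum ε φ Fs f g y = psum ε φ Fs (N.indicator f) g y +
        psum ε φ Fs (Nᶜ.indicator f) g y := by
      rw [← psum_add_left hD Fs hfi1 hfi2, ← hsp f]
    have h2 : psum ε φ Fs (N.indicator f) g y = psum ε φ Fs (N.indicator f) (N.indicator g) y +
        psum ε φ Fs (N.indicator f) (Nᶜ.indicator g) y := by
      rw [← psum_add_right hD Fs _ hgi1 hgi2, ← hsp g]
    rw [h1, h2]
  have e2 : psum ε φ F f g y - localMean ε φ F f g k x =
      (psum ε φ (F.filter fun I => I.gen ≤ k) f g y - localMean ε φ F f g k x) +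
        psum ε φ Fs f g y := by
    have : psum ε φ F f g y = psum ε φ (F.filter fun I => I.gen ≤ k) f g y +
        psum ε φ Fs f g y := (Finset.sum_filter_add_sum_filter_not F _ _).symm
    rw [this]; ring
  have hmain : ‖psum ε φ Fs (N.indicator f) (N.indicator g) y‖ₑ ≤
      4096 * weakConst B * s ^ 2 * (Mf * Mg) := by
    refine (not_lt.1 hcon).trans ?_
    calc _ = 4096 * weakConst B * s ^ 2 * (avg k (fun z => ‖f z‖ₑ) x *
          avg k (fun z => ‖g z‖ₑ) x) * (2 ^ k * 2⁻¹ ^ k) ^ 2 := by ring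
      _ ≤ 4096 * weakConst B * s ^ 2 * (Mf * Mg) * 1 ^ 2 := by
          rw [two_pow_mul_inv_pow]
          gcongr
          · exact avg_le_maxFn _ _ _
          · exact avg_le_maxFn _ _ _
      _ = _ := by ring
  rw [e2, e1]
  calc _ ≤ 3145728 * b ^ 3 * (Mf * Mg) + (4096 * weakConst B * s ^ 2 * (Mf * Mg) +
        98304 * b ^ 3 * (Mf * Mg) + 98304 * b ^ 3 * (Mf * Mg)) := by
        refine (enorm_add_le _ _).trans (add_le_add (enorm_psum_long_sub_le hD F f g hy)
          ((enorm_add_le _ _).trans (add_le_add ((enorm_add_le _ _).trans (add_le_add hmain ?_))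
            ?_)))
        · exact enorm_psum_short_le hD F hy (enorm_indicator_le N f) (enorm_indicator_le Nᶜ g)
            (Or.inr hfar)
        · exact enorm_psum_short_le hD F hy (enorm_indicator_le Nᶜ f) (fun _ => le_rfl)
            (Or.inl hfar)
    _ = _ := by rw [localConst, ← hb]; ring

end

/-! ### Discrete layer cake -/

/-- A discrete version of `u ^ p`, as a sum over the levels `3 ^ j` below `u`. -/
noncomputable def layer (p : ℝ) (u : ℝ≥0∞) : ℝ≥0∞ :=
  ∑' j : ℤ, if (3 : ℝ≥0∞) ^ j < u then ((3 : ℝ≥0∞) ^ j) ^ p else 0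

lemma three_zpow_ne_top (j : ℤ) : (3 : ℝ≥0∞) ^ j ≠ ⊤ := ENNReal.zpow_ne_top (by simp) (by simp) j

lemma three_zpow_ne_zero (j : ℤ) : (3 : ℝ≥0∞) ^ j ≠ 0 :=
  (ENNReal.zpow_pos (by simp) (by simp) j).ne'

lemma three_zpow_succ (j : ℤ) : (3 : ℝ≥0∞) ^ (j + 1) = 3 * 3 ^ j := by
  rw [ENNReal.zpow_add (by simp) (by simp), zpow_one, mul_comm]

/-- The largest level below `u` is at least `u / 3`. The base 3 is the ratio of the two levels in
the good-`λ` inequality, which thus becomes a shift of the index by one. -/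
lemma rpow_le_layer {p : ℝ} (hp : 0 < p) (u : ℝ≥0∞) : u ^ p ≤ 3 ^ p * layer p u := by
  rcases eq_or_ne u 0 with rfl | h0
  · rw [ENNReal.zero_rpow_of_pos hp]; exact zero_le
  rcases eq_or_ne u ⊤ with rfl | ht
  · have h1 : layer p ⊤ = ⊤ := by
      refine top_unique ?_
      calc (⊤ : ℝ≥0∞) = ∑' _ : ℕ, 1 := (ENNReal.tsum_const_eq_top_of_ne_zero one_ne_zero).symm
        _ ≤ ∑' n : ℕ, if (3 : ℝ≥0∞) ^ (n : ℤ) < ⊤ then ((3 : ℝ≥0∞) ^ (n : ℤ)) ^ p else 0 := by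
            refine ENNReal.tsum_le_tsum fun n => ?_
            rw [if_pos (three_zpow_ne_top n).lt_top, zpow_natCast]
            exact ENNReal.one_le_rpow (one_le_pow₀ (by norm_num)) hp
        _ ≤ layer p ⊤ := ENNReal.tsum_comp_le_tsum_of_injective Nat.cast_injective
            (fun j : ℤ => if (3 : ℝ≥0∞) ^ j < ⊤ then ((3 : ℝ≥0∞) ^ j) ^ p else 0)
    rw [h1, ENNReal.mul_top (by positivity)]
    exact le_top
  obtain ⟨n, hn1, hn2⟩ := ENNReal.exists_mem_Ioc_zpow h0 ht (y := 3) (by norm_num) (by simp)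
  calc u ^ p ≤ (3 ^ (n + 1)) ^ p := by gcongr
    _ = 3 ^ p * (3 ^ n) ^ p := by rw [three_zpow_succ, ENNReal.mul_rpow_of_nonneg _ _ hp.le]
    _ = 3 ^ p * (if (3 : ℝ≥0∞) ^ n < u then ((3 : ℝ≥0∞) ^ n) ^ p else 0) := by rw [if_pos hn1]
    _ ≤ _ := by
        gcongr
        exact ENNReal.le_tsum (f := fun j : ℤ => if (3 : ℝ≥0∞) ^ j < u then
          ((3 : ℝ≥0∞) ^ j) ^ p else 0) n

/-- The constant in `layer_le`. -/
noncomputable def layerConst (p : ℝ) : ℝ≥0∞ := (1 - (3 ^ p)⁻¹)⁻¹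

lemma layerConst_ne_top {p : ℝ} (hp : 0 < p) : layerConst p ≠ ⊤ := by
  rw [layerConst, ENNReal.inv_ne_top]
  refine (tsub_pos_of_lt ?_).ne'
  exact ENNReal.inv_lt_one.2 (ENNReal.one_lt_rpow (by norm_num) hp)

/-- The levels below `u` form a geometric series dominated by the largest of them, with ratio
`3^{-p}`. -/
lemma layer_le {p : ℝ} (hp : 0 < p) (u : ℝ≥0∞) : layer p u ≤ layerConst p * u ^ p := by
  rcases eq_or_ne u 0 with rfl | h0
  · simp [layer]
  rcases eq_or_ne u ⊤ with rfl | ht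
  · rw [ENNReal.top_rpow_of_pos hp, ENNReal.mul_top]
    · exact le_top
    · rw [layerConst]
      exact ENNReal.inv_ne_zero.2 (ne_top_of_le_ne_top ENNReal.one_ne_top tsub_le_self)
  obtain ⟨n, hn1, hn2⟩ := ENNReal.exists_mem_Ioc_zpow h0 ht (y := 3) (by norm_num) (by simp)
  have hinj : Function.Injective fun i : ℕ => n - (i : ℤ) := fun i j h => by simpa using h
  have e : layer p u = ∑' i : ℕ, if (3 : ℝ≥0∞) ^ (n - (i : ℤ)) < u then
      ((3 : ℝ≥0∞) ^ (n - (i : ℤ))) ^ p else 0 := by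
    refine (hinj.tsum_eq ?_).symm
    intro j hj
    have hj' : (3 : ℝ≥0∞) ^ j < u := by
      by_contra hc
      exact hj (if_neg hc)
    have hjn : j < n + 1 := by
      by_contra hc
      exact absurd (hj'.trans_le hn2)
        (not_lt.2 (ENNReal.zpow_le_of_le (by norm_num) (not_lt.1 hc)))
    exact ⟨(n - j).toNat, by simp; omega⟩
  rw [e]
  calc _ ≤ ∑' i : ℕ, (3 ^ n) ^ p * ((3 ^ p : ℝ≥0∞)⁻¹) ^ i := by
        refine ENNReal.tsum_le_tsum fun i => ?_
        refine (by split_ifs <;> simp : _ ≤ ((3 : ℝ≥0∞) ^ (n - (i : ℤ))) ^ p).trans (le_of_eq ?_)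
        rw [sub_eq_add_neg, ENNReal.zpow_add (by simp) (by simp),
          ENNReal.mul_rpow_of_nonneg _ _ hp.le]
        congr 1
        rw [ENNReal.zpow_neg, zpow_natCast, ENNReal.inv_rpow, ← ENNReal.inv_pow,
          ← ENNReal.rpow_natCast, ← ENNReal.rpow_natCast, ← ENNReal.rpow_mul, ← ENNReal.rpow_mul,
          mul_comm]
    _ = (3 ^ n) ^ p * layerConst p := by
        rw [ENNReal.tsum_mul_left, ENNReal.tsum_geometric, layerConst]
    _ ≤ u ^ p * layerConst p := by gcongr
    _ = _ := mul_comm _ _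

lemma lintegral_layer {p : ℝ} {u : UnitAddCircle → ℝ≥0∞} (hu : Measurable u) :
    ∫⁻ x, layer p (u x) = ∑' j : ℤ, ((3 : ℝ≥0∞) ^ j) ^ p * volume {x | 3 ^ j < u x} := by
  have hm : ∀ j : ℤ, MeasurableSet {x | (3 : ℝ≥0∞) ^ j < u x} := fun j =>
    measurableSet_lt measurable_const hu
  simp only [layer]
  rw [lintegral_tsum fun j =>
    (Measurable.ite (hm j) measurable_const measurable_const).aemeasurable]
  congr 1; ext j
  rw [← lintegral_indicator_const (hm j)]
  exact lintegral_congr fun x => by simp only [Set.indicator_apply, Set.mem_ofPred_eq]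

/-! ### The strong type bound of the maximal function -/

/-- Cutting `h` at the height `c` leaves a bounded remainder, whose averages are at most `16c`. The
weak type bound is then applied to the large part only. -/
lemma maxFn_le_add {h : UnitAddCircle → ℝ≥0∞} (hh : Measurable h) (c : ℝ≥0∞) (x : UnitAddCircle) :
    maxFn h x ≤ maxFn (fun y => if c < h y then h y else 0) x + 16 * c := by
  refine iSup_le fun k => ?_
  have hm : Measurable fun y => if c < h y then h y else 0 :=
    Measurable.ite (measurableSet_lt measurable_const hh) hh measurable_const
  calc avg k h x ≤ avg k (fun y => (if c < h y then h y else 0) + min (h y) c) x := by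
        refine avg_mono k (fun y => ?_) x
        split_ifs with hc
        · exact le_self_add
        · rw [min_eq_left (not_lt.1 hc)]; exact le_add_self
    _ = avg k (fun y => if c < h y then h y else 0) x + avg k (fun y => min (h y) c) x :=
        avg_add k hm _ x
    _ ≤ _ := add_le_add (avg_le_maxFn _ _ _) (avg_le_of_le k (fun y => min_le_right _ _) x)

/-- The constant in the strong type bound of the maximal function. -/
noncomputable def maxConst (p : ℝ) : ℝ≥0∞ := 512 ^ p * 3 ^ p * 4 * layerConst (p - 1)

lemma maxConst_ne_top {p : ℝ} (hp : 1 < p) : maxConst p ≠ ⊤ := by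
  have := layerConst_ne_top (p := p - 1) (by linarith)
  have : 0 ≤ p := by linarith
  rw [maxConst]; finiteness

/-- Interpolation by levels: at the level `t` the weak type bound is used for `h` cut below `t`,
with 512 exceeding `256 + 16`. Summing over `t = 3^j` puts the factor `layer (p - 1) (h x)` next to
`h x`, and this is where `p > 1` is needed. -/
lemma lintegral_maxFn_rpow_le {p : ℝ} (hp : 1 < p) {h : UnitAddCircle → ℝ≥0∞}
    (hh : Measurable h) : ∫⁻ x, maxFn h x ^ p ≤ maxConst p * ∫⁻ x, h x ^ p := by
  have hp0 : 0 < p := by linarith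
  have hp1 : 0 < p - 1 := by linarith
  have hM := measurable_maxFn hh
  have hvol : ∀ j : ℤ, ((3 : ℝ≥0∞) ^ j) ^ p * volume {x | 3 ^ j < maxFn h x / 512} ≤
      4 * ∫⁻ x, h x * (if (3 : ℝ≥0∞) ^ j < h x then ((3 : ℝ≥0∞) ^ j) ^ (p - 1) else 0) := by
    intro j
    set t : ℝ≥0∞ := 3 ^ j with ht
    have htt : t ≠ ⊤ := three_zpow_ne_top j
    have ht0 : t ≠ 0 := three_zpow_ne_zero j
    set hj : UnitAddCircle → ℝ≥0∞ := fun y => if t < h y then h y else 0 with hhj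
    have hm : Measurable hj :=
      Measurable.ite (measurableSet_lt measurable_const hh) hh measurable_const
    have hsub : {x | t < maxFn h x / 512} ⊆ {x | 256 * t < maxFn hj x} := by
      intro x hx
      have h1 : t * 512 < maxFn h x :=
        (ENNReal.lt_div_iff_mul_lt (Or.inl (by simp)) (Or.inl (by simp))).1 hx
      by_contra hc
      have h2 : maxFn h x ≤ 256 * t + 16 * t :=
        (maxFn_le_add hh t x).trans (add_le_add_left (not_lt.1 hc) _)
      refine absurd (h1.trans_le h2) (not_lt.2 ?_)
      rw [← add_mul, mul_comm]
      gcongr; norm_num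
    have e : t ^ p = t ^ (p - 1) * t := by
      rw [ENNReal.rpow_sub _ _ ht0 htt, ENNReal.rpow_one, ENNReal.div_mul_cancel ht0 htt]
    calc t ^ p * volume {x | t < maxFn h x / 512} ≤ t ^ p * volume {x | 256 * t < maxFn hj x} := by
          gcongr
      _ = t ^ (p - 1) * (t * volume {x | 256 * t < maxFn hj x}) := by rw [e, mul_assoc]
      _ ≤ t ^ (p - 1) * (4 * ∫⁻ x, hj x) := by exact mul_le_mul_right (mul_volume_maxFn_le hj htt) _
      _ = 4 * ∫⁻ x, t ^ (p - 1) * hj x := by rw [lintegral_const_mul _ hm]; ring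
      _ = _ := by
          congr 2; ext x
          simp only [hhj]
          split_ifs <;> ring
  have hmeas : ∀ j : ℤ, Measurable fun x => h x * (if (3 : ℝ≥0∞) ^ j < h x then
      ((3 : ℝ≥0∞) ^ j) ^ (p - 1) else 0) := fun j =>
    hh.mul (Measurable.ite (measurableSet_lt measurable_const hh) measurable_const
      measurable_const)
  calc ∫⁻ x, maxFn h x ^ p = 512 ^ p * ∫⁻ x, (maxFn h x / 512) ^ p := by
        rw [← lintegral_const_mul _ ((hM.div_const _).pow_const _)]
        congr 1; ext x
        rw [← ENNReal.mul_rpow_of_nonneg _ _ hp0.le, ENNReal.mul_div_cancel (by simp) (by simp)]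
    _ ≤ 512 ^ p * ∫⁻ x, 3 ^ p * layer p (maxFn h x / 512) := by
        gcongr with x; exact rpow_le_layer hp0 _
    _ = 512 ^ p * 3 ^ p * ∑' j : ℤ, ((3 : ℝ≥0∞) ^ j) ^ p *
          volume {x | 3 ^ j < maxFn h x / 512} := by
        rw [lintegral_const_mul' _ _ (by finiteness), lintegral_layer (hM.div_const _), mul_assoc]
    _ ≤ 512 ^ p * 3 ^ p * ∑' j : ℤ, 4 * ∫⁻ x, h x * (if (3 : ℝ≥0∞) ^ j < h x then
          ((3 : ℝ≥0∞) ^ j) ^ (p - 1) else 0) :=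
        mul_le_mul_right (ENNReal.tsum_le_tsum hvol) _
    _ = 512 ^ p * 3 ^ p * 4 * ∫⁻ x, h x * layer (p - 1) (h x) := by
        rw [ENNReal.tsum_mul_left, ← lintegral_tsum fun j => (hmeas j).aemeasurable]
        simp only [ENNReal.tsum_mul_left, layer]
        ring
    _ ≤ 512 ^ p * 3 ^ p * 4 * ∫⁻ x, layerConst (p - 1) * h x ^ p := by
        refine mul_le_mul_right (lintegral_mono fun x => ?_) _
        calc _ ≤ h x * (layerConst (p - 1) * h x ^ (p - 1)) := by gcongr; exact layer_le hp1 _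
          _ = layerConst (p - 1) * (h x ^ (1 : ℝ) * h x ^ (p - 1)) := by rw [ENNReal.rpow_one]; ring
          _ = _ := by
              rw [← ENNReal.rpow_add_of_nonneg _ _ zero_le_one hp1.le, add_sub_cancel]
    _ = _ := by
        rw [lintegral_const_mul' _ _ (layerConst_ne_top hp1), maxConst]; ring

section

/-! ### The good-`λ` inequality -/

/-- On each dyadic cell, `T` is within `H` of the constant `m`, outside a subset of relative measure
at most `η`. -/
structure IsLocallyApprox (η : ℝ≥0∞) (T : UnitAddCircle → ℂ) (m : ℕ → UnitAddCircle → ℂ)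
    (H : UnitAddCircle → ℝ≥0∞) : Prop where
  cont : Continuous T
  zero : ∀ x, m 0 x = 0
  congr : ∀ k x y, cellIdx k x = cellIdx k y → m k x = m k y
  meas : Measurable H
  le : ∀ k x, 2 ^ k * volume {y | cellIdx k y = cellIdx k x ∧ H x < ‖T y - m k x‖ₑ} ≤ η

/-- The maximal function of the local constants up to generation `K`. -/
noncomputable def supMean (m : ℕ → UnitAddCircle → ℂ) (K : ℕ) (x : UnitAddCircle) : ℝ≥0∞ :=
  ⨆ k ≤ K, ‖m k x‖ₑ

lemma lt_supMean_iff {m : ℕ → UnitAddCircle → ℂ} {K : ℕ} {x : UnitAddCircle} {t : ℝ≥0∞} :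
    t < supMean m K x ↔ ∃ k ≤ K, t < ‖m k x‖ₑ := by
  simp only [supMean, lt_iSup_iff, exists_prop]

lemma enorm_le_supMean (m : ℕ → UnitAddCircle → ℂ) {k K : ℕ} (hk : k ≤ K) (x : UnitAddCircle) :
    ‖m k x‖ₑ ≤ supMean m K x :=
  le_iSup₂ (f := fun k (_ : k ≤ K) => ‖m k x‖ₑ) k hk

lemma supMean_mono (m : ℕ → UnitAddCircle → ℂ) (x : UnitAddCircle) :
    Monotone fun K => supMean m K x := fun _ _ h =>
  biSup_mono fun _ hk => hk.trans h

/-- The union of the cells of generation `k` which are maximal among those where `m` exceeds `t`. -/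
def stopMean (m : ℕ → UnitAddCircle → ℂ) (t : ℝ≥0∞) (k : ℕ) : Set UnitAddCircle :=
  {x | t < ‖m k x‖ₑ ∧ ∀ i < k, ‖m i x‖ₑ ≤ t}

lemma disjoint_stopMean (m : ℕ → UnitAddCircle → ℂ) (t : ℝ≥0∞) {k l : ℕ} (hkl : k ≠ l) :
    Disjoint (stopMean m t k) (stopMean m t l) := by
  rw [Set.disjoint_left]
  rintro x ⟨h1, h2⟩ ⟨h3, h4⟩
  rcases lt_or_gt_of_ne hkl with h | h
  · exact absurd h1 (not_lt.2 (h4 k h))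
  · exact absurd h3 (not_lt.2 (h2 l h))

lemma exists_mem_stopMean {m : ℕ → UnitAddCircle → ℂ} {t : ℝ≥0∞} {x : UnitAddCircle} {k : ℕ}
    (h : t < ‖m k x‖ₑ) : ∃ i ≤ k, x ∈ stopMean m t i := by
  classical
  have hex : ∃ i, t < ‖m i x‖ₑ := ⟨k, h⟩
  exact ⟨Nat.find hex, Nat.find_min' hex h, Nat.find_spec hex,
    fun i hi => not_lt.1 (Nat.find_min hex hi)⟩

/-- The constant in `lintegral_rpow_le`. -/
noncomputable def strongConst (p : ℝ) : ℝ≥0∞ :=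
  2 ^ p * (3 ^ p * (2 * (3 ^ p * layerConst p)) + 1)

lemma add_rpow_le {p : ℝ} (hp : 0 < p) (a b : ℝ≥0∞) :
    (a + b) ^ p ≤ 2 ^ p * (a ^ p + b ^ p) := by
  calc (a + b) ^ p ≤ (2 * max a b) ^ p := by
        rw [two_mul]
        gcongr
        · exact le_max_left _ _
        · exact le_max_right _ _
    _ = 2 ^ p * max a b ^ p := ENNReal.mul_rpow_of_nonneg _ _ hp.le
    _ ≤ _ := by
        gcongr
        rcases max_choice a b with hm | hm <;> rw [hm]
        · exact le_self_add
        · exact le_add_self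

/-- The constant in `rpow_mul_volume_le`. -/
noncomputable def weakTypeConst (p : ℝ) : ℝ≥0∞ := 2 ^ p * (2 * 3 ^ p + 1)

namespace IsLocallyApprox

variable {η : ℝ≥0∞} {T : UnitAddCircle → ℂ} {m : ℕ → UnitAddCircle → ℂ}
  {H : UnitAddCircle → ℝ≥0∞}

lemma isSaturated_lt (h : IsLocallyApprox η T m H) (t : ℝ≥0∞) (k : ℕ) :
    IsSaturated k {x | t < ‖m k x‖ₑ} := by
  intro x y hxy hx
  rw [Set.mem_ofPred_eq] at hx ⊢
  rwa [← h.congr k x y hxy]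

lemma isSaturated_stopMean (h : IsLocallyApprox η T m H) (t : ℝ≥0∞) (k : ℕ) :
    IsSaturated k (stopMean m t k) := by
  rintro x y hxy ⟨h1, h2⟩
  refine ⟨h.isSaturated_lt t k hxy h1, fun i hi => ?_⟩
  rw [← h.congr i x y (cellIdx_eq_of_le hi.le hxy)]
  exact h2 i hi

lemma measurable_supMean (h : IsLocallyApprox η T m H) (K : ℕ) : Measurable (supMean m K) := by
  refine measurable_of_Ioi fun t => ?_
  have : supMean m K ⁻¹' Set.Ioi t = ⋃ k ∈ Set.Iic K, {x | t < ‖m k x‖ₑ} := by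
    ext x
    simp [lt_supMean_iff]
  rw [this]
  exact (Set.finite_Iic K).measurableSet_biUnion fun k _ => (h.isSaturated_lt t k).measurableSet

/-- Up to generation `K` there are finitely many cells. The bound is qualitative and serves only to
make the quantities absorbed later finite. -/
lemma exists_supMean_le (h : IsLocallyApprox η T m H) (K : ℕ) :
    ∃ c : ℝ≥0∞, c ≠ ⊤ ∧ ∀ x, supMean m K x ≤ c := by
  refine ⟨∑ k ∈ Finset.range (K + 1), ∑ j ∈ Finset.range (2 ^ k), ‖m k (pt k j)‖ₑ, ?_,
    fun x => iSup₂_le fun k hk => ?_⟩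
  · exact (ENNReal.sum_lt_top.2 fun k _ => ENNReal.sum_lt_top.2 fun j _ => enorm_lt_top).ne
  · have hj := cellIdx_lt k x
    have e : m k x = m k (pt k (cellIdx k x)) := h.congr _ _ _ (pt_mem_cell hj).symm
    calc ‖m k x‖ₑ = ‖m k (pt k (cellIdx k x))‖ₑ := by rw [← e]
      _ ≤ ∑ j ∈ Finset.range (2 ^ k), ‖m k (pt k j)‖ₑ :=
          Finset.single_le_sum (f := fun j => ‖m k (pt k j)‖ₑ) (fun _ _ => zero_le)
            (Finset.mem_range.2 hj)
      _ ≤ _ := Finset.single_le_sum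
          (f := fun k => ∑ j ∈ Finset.range (2 ^ k), ‖m k (pt k j)‖ₑ) (fun _ _ => zero_le)
            (Finset.mem_range.2 (Nat.lt_succ_of_le hk))

/-- The parent of a maximal cell has constant at most `t`. Let `U` be the part of the parent where
`T` is farther than `t` from that constant; its proportion is at most `η`. If a smaller cell has
constant above `3t` while `H ≤ t`, then off `U` the function `T` cannot be within `t` of that
constant, so `U` fills more than half of the smaller cell. The dyadic weak type bound costs a factor
2, the passage to the parent another. -/
lemma volume_inter_cell_le (h : IsLocallyApprox η T m H) (hη : η < 2⁻¹) (K : ℕ) (t : ℝ≥0∞)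
    {κ : ℕ} {x₀ : UnitAddCircle} (hx₀ : x₀ ∈ stopMean m t κ) :
    volume ({x | H x ≤ t ∧ 3 * t < supMean m K x} ∩ cell κ (cellIdx κ x₀)) ≤
      4 * η * 2⁻¹ ^ κ := by
  set S := {x | H x ≤ t ∧ 3 * t < supMean m K x} ∩ cell κ (cellIdx κ x₀) with hS
  rcases S.eq_empty_or_nonempty with he | ⟨x₁, hx₁⟩
  · rw [he, measure_empty]; exact zero_le
  -- The constant of generation 0 is zero, so a stopped cell has a parent.
  obtain ⟨i, rfl⟩ : ∃ i, κ = i + 1 := by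
    refine Nat.exists_eq_succ_of_ne_zero ?_
    rintro rfl
    have := hx₀.1
    rw [h.zero, enorm_zero] at this
    exact not_lt_zero this
  have hsat := h.isSaturated_stopMean t (i + 1)
  have h_first : ∀ x ∈ S, x ∈ stopMean m t (i + 1) := fun x hx => hsat hx.2.symm hx₀
  -- The base point is taken in `S` because the approximation property at `x₁` involves `H x₁`,
  -- which must be at most `t`.
  set U := {y | cellIdx i y = cellIdx i x₁ ∧ t < ‖T y - m i x₁‖ₑ} with hU
  have hUm : MeasurableSet U :=
    (measurableSet_cell i _).inter (measurableSet_lt measurable_const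
      (h.cont.sub continuous_const).enorm.measurable)
  have hUvol : 2 ^ i * volume U ≤ η := by
    refine le_trans ?_ (h.le i x₁)
    gcongr
    exact fun y hy => ⟨hy.1, hx₁.1.1.trans_lt hy.2⟩
  have hsub : S ⊆ {x | ∃ k ≤ K, 2⁻¹ < cellAvg k (U.indicator 1) x} := by
    intro x hx
    obtain ⟨k, hk, hlt⟩ := lt_supMean_iff.1 hx.1.2
    refine ⟨k, hk, ?_⟩
    have h3 : t ≤ 3 * t := le_mul_of_one_le_left' (by norm_num)
    have hik : i + 1 ≤ k := by
      by_contra hc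
      exact absurd (h3.trans_lt hlt) (not_lt.2 ((h_first x hx).2 k (not_le.1 hc)))
    have hxx : cellIdx i x = cellIdx i x₁ :=
      cellIdx_eq_of_le (Nat.le_succ i) (hx.2.trans hx₁.2.symm)
    set E := {y | cellIdx k y = cellIdx k x ∧ H x < ‖T y - m k x‖ₑ}
    have hcov : cell k (cellIdx k x) ⊆ (U ∩ cell k (cellIdx k x)) ∪ E := by
      intro y hy
      by_cases hyU : y ∈ U
      · exact Or.inl ⟨hyU, hy⟩
      refine Or.inr ⟨hy, ?_⟩
      by_contra hc
      have hyi : cellIdx i y = cellIdx i x₁ :=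
        (cellIdx_eq_of_le (by omega) (show cellIdx k y = cellIdx k x from hy)).trans hxx
      have h1 : ‖T y - m i x₁‖ₑ ≤ t := by
        by_contra h1
        exact hyU ⟨hyi, not_le.1 h1⟩
      have h2 : ‖m i x₁‖ₑ ≤ t := (h_first x₁ hx₁).2 i (Nat.lt_succ_self i)
      have h4 : ‖T y - m k x‖ₑ ≤ t := (not_lt.1 hc).trans hx.1.1
      refine absurd hlt (not_lt.2 ?_)
      calc ‖m k x‖ₑ = ‖(T y - m i x₁) + m i x₁ - (T y - m k x)‖ₑ := by congr 1; ring
        _ ≤ ‖T y - m i x₁‖ₑ + ‖m i x₁‖ₑ + ‖T y - m k x‖ₑ :=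
            enorm_sub_le.trans (add_le_add_left (enorm_add_le _ _) _)
        _ ≤ t + t + t := add_le_add (add_le_add h1 h2) h4
        _ = 3 * t := by ring
    -- The small cell is covered by `U` and the exceptional set of its own approximation; the latter
    -- has proportion at most `η < 1/2`.
    have hone : 1 ≤ cellAvg k (U.indicator 1) x + η := by
      calc (1 : ℝ≥0∞) = 2 ^ k * volume (cell k (cellIdx k x)) := by
            rw [volume_cell_cellIdx, two_pow_mul_inv_pow]
        _ ≤ 2 ^ k * (volume (U ∩ cell k (cellIdx k x)) + volume E) := by
            gcongr
            exact (measure_mono hcov).trans (measure_union_le _ _)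
        _ = cellAvg k (U.indicator 1) x + 2 ^ k * volume E := by
            rw [mul_add, cellAvg, lintegral_indicator_one hUm, Measure.restrict_apply hUm]
        _ ≤ _ := by gcongr; exact h.le k x
    by_contra hc
    refine absurd hone (not_le.2 ?_)
    calc _ ≤ 2⁻¹ + η := add_le_add_left (not_lt.1 hc) _
      _ < 2⁻¹ + 2⁻¹ := ENNReal.add_lt_add_left (by simp) hη
      _ = 1 := ENNReal.inv_two_add_inv_two
  have hmain : 2⁻¹ * volume S ≤ volume U := by
    refine le_trans ?_ ((mul_volume_cellAvg_le (U.indicator 1) 2⁻¹ K).trans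
      (lintegral_indicator_one hUm).le)
    gcongr
  calc volume S = 2 * (2⁻¹ * volume S) := by
        rw [← mul_assoc, ENNReal.mul_inv_cancel (by simp) (by simp), one_mul]
    _ ≤ 2 * volume U := by gcongr
    _ = 4 * (2 ^ i * volume U) * (2⁻¹ ^ i * 2⁻¹) := by
        have h1 := two_pow_mul_inv_pow i
        have h2 : (2 : ℝ≥0∞) * 2⁻¹ = 1 := ENNReal.mul_inv_cancel (by simp) (by simp)
        calc _ = 2 * volume U * (2 ^ i * 2⁻¹ ^ i) * (2 * 2⁻¹) := by rw [h1, h2]; ring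
          _ = _ := by ring
    _ ≤ _ := by rw [← pow_succ]; gcongr

/-- The good-`λ` inequality. -/
lemma volume_lt_supMean_le (h : IsLocallyApprox η T m H) (hη : η < 2⁻¹) (K : ℕ) (t : ℝ≥0∞) :
    volume {x | 3 * t < supMean m K x} ≤
      4 * η * volume {x | t < supMean m K x} + volume {x | t < H x} := by
  set G := {x | H x ≤ t ∧ 3 * t < supMean m K x} with hG
  have hGm : MeasurableSet G := (measurableSet_le h.meas measurable_const).inter
    (measurableSet_lt measurable_const (h.measurable_supMean K))
  have hκ : ∀ κ, volume (G ∩ stopMean m t κ) ≤ 4 * η * volume (stopMean m t κ) := by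
    intro κ
    have hs := h.isSaturated_stopMean t κ
    have h1 := hs.setLIntegral_le (g := G.indicator 1) (h := fun _ => 4 * η) fun j hj hjs => by
      have hp : pt κ j ∈ cell κ j := pt_mem_cell hj
      have := h.volume_inter_cell_le hη K t (hjs hp)
      rw [lintegral_indicator_one hGm, Measure.restrict_apply hGm, lintegral_const,
        Measure.restrict_apply_univ, volume_cell hj]
      rwa [show cellIdx κ (pt κ j) = j from hp] at this
    rwa [lintegral_indicator_one hGm, Measure.restrict_apply hGm, lintegral_const,
        Measure.restrict_apply_univ] at h1
  have hcov : G ⊆ ⋃ κ ∈ Finset.range (K + 1), G ∩ stopMean m t κ := by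
    intro x hx
    obtain ⟨k, hk, hlt⟩ := lt_supMean_iff.1 hx.2
    obtain ⟨i, hi, hxi⟩ := exists_mem_stopMean
      ((le_mul_of_one_le_left' (by norm_num : (1 : ℝ≥0∞) ≤ 3)).trans_lt hlt)
    simp only [Set.mem_iUnion, Finset.mem_range]
    exact ⟨i, by omega, hx, hxi⟩
  have hGle : volume G ≤ 4 * η * volume {x | t < supMean m K x} := by
    calc volume G ≤ ∑ κ ∈ Finset.range (K + 1), volume (G ∩ stopMean m t κ) :=
          (measure_mono hcov).trans (measure_biUnion_finset_le _ _)
      _ ≤ ∑ κ ∈ Finset.range (K + 1), 4 * η * volume (stopMean m t κ) :=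
          Finset.sum_le_sum fun κ _ => hκ κ
      _ = 4 * η * volume (⋃ κ ∈ Finset.range (K + 1), stopMean m t κ) := by
          rw [← Finset.mul_sum, measure_biUnion_finset
            (fun _ _ _ _ hne => disjoint_stopMean m t hne)
            fun κ _ => (h.isSaturated_stopMean t κ).measurableSet]
      _ ≤ _ := by
          gcongr
          refine Set.iUnion₂_subset fun κ hκ x hx => ?_
          exact lt_supMean_iff.2 ⟨κ, Nat.lt_succ_iff.1 (Finset.mem_range.1 hκ), hx.1⟩
  calc _ ≤ volume (G ∪ {x | t < H x}) := by
        refine measure_mono fun x hx => ?_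
        rcases le_or_gt (H x) t with hH | hH
        · exact Or.inl ⟨hH, hx⟩
        · exact Or.inr hH
    _ ≤ _ := (measure_union_le _ _).trans (add_le_add_left hGle _)

/-- The exceptional set never fills a cell, so every cell around `x` contains a point where `T` is
within `H x` of the local constant. These points tend to `x` and `T` is continuous. -/
lemma enorm_le (h : IsLocallyApprox η T m H) (hη : η < 2⁻¹) (x : UnitAddCircle) :
    ‖T x‖ₑ ≤ (⨆ K, supMean m K x) + H x := by
  have hex : ∀ k, ∃ y, cellIdx k y = cellIdx k x ∧ ‖T y - m k x‖ₑ ≤ H x := by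
    intro k
    by_contra! hc
    have h1 : cell k (cellIdx k x) ⊆
        {y | cellIdx k y = cellIdx k x ∧ H x < ‖T y - m k x‖ₑ} := fun y hy => ⟨hy, hc y hy⟩
    have h2 : (1 : ℝ≥0∞) ≤ η := by
      refine le_trans ?_ (h.le k x)
      calc (1 : ℝ≥0∞) = 2 ^ k * volume (cell k (cellIdx k x)) := by
            rw [volume_cell_cellIdx, two_pow_mul_inv_pow]
        _ ≤ _ := by gcongr
    exact absurd (h2.trans_lt hη) (not_lt.2 (by simp))
  choose y hy1 hy2 using hex
  have hlim : Tendsto y atTop (nhds x) := by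
    rw [tendsto_iff_dist_tendsto_zero]
    refine squeeze_zero (fun _ => dist_nonneg) (fun k => dist_le_of_cellIdx_eq (hy1 k)) ?_
    simpa only [inv_pow] using tendsto_pow_atTop_nhds_zero_of_lt_one (r := (2⁻¹ : ℝ))
      (by norm_num) (by norm_num)
  refine le_of_tendsto (((h.cont.tendsto x).comp hlim).enorm) (Eventually.of_forall fun k => ?_)
  calc ‖T (y k)‖ₑ = ‖m k x + (T (y k) - m k x)‖ₑ := by congr 1; ring
    _ ≤ ‖m k x‖ₑ + ‖T (y k) - m k x‖ₑ := enorm_add_le _ _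
    _ ≤ _ := add_le_add (le_iSup_of_le k (enorm_le_supMean m le_rfl x)) (hy2 k)

lemma le_two_mul_of_le_half_add {a b : ℝ≥0∞} (ha : a ≠ ⊤) (h : a ≤ 2⁻¹ * a + b) : a ≤ 2 * b := by
  have h1 : 2⁻¹ * a + 2⁻¹ * a = a := by
    rw [← add_mul, ENNReal.inv_two_add_inv_two, one_mul]
  have h2 : 2⁻¹ * a ≠ ⊤ := by finiteness
  have h3 : 2⁻¹ * a ≤ b := by
    rw [← ENNReal.add_le_add_iff_left h2]
    rwa [h1]
  calc a = 2⁻¹ * a + 2⁻¹ * a := h1.symm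
    _ ≤ b + b := add_le_add h3 h3
    _ = 2 * b := (two_mul b).symm

/-- The good-`λ` inequality is summed over `t = 3^j`. Shifting the index costs `3^p`, and `η` is so
small that the term in `supMean` is absorbed on the left. -/
lemma lintegral_supMean_rpow_le (h : IsLocallyApprox η T m H) (hη : η < 2⁻¹) {p : ℝ} (hp : 0 < p)
    (hηp : 3 ^ p * (4 * η) ≤ 2⁻¹) (K : ℕ) :
    ∫⁻ x, supMean m K x ^ p ≤ 3 ^ p * (2 * (3 ^ p * layerConst p)) * ∫⁻ x, H x ^ p := by
  have hN := h.measurable_supMean K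
  obtain ⟨c, hc, hNc⟩ := h.exists_supMean_le K
  have hL := layerConst_ne_top hp
  set D := ∫⁻ x, layer p (supMean m K x) with hD
  set D' := ∫⁻ x, layer p (H x) with hD'
  -- Absorption requires finiteness beforehand; it holds for fixed `K`, with no bound uniform in
  -- `K`.
  have hDt : D ≠ ⊤ := by
    refine ne_top_of_le_ne_top (b := layerConst p * c ^ p) (by finiteness) ?_
    calc D ≤ ∫⁻ _ : UnitAddCircle, layerConst p * c ^ p := by
          refine lintegral_mono fun x => (layer_le hp _).trans ?_
          gcongr
          exact hNc x
      _ = _ := by simp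
  have hD'le : D' ≤ layerConst p * ∫⁻ x, H x ^ p := by
    rw [← lintegral_const_mul' _ _ hL]
    exact lintegral_mono fun x => layer_le hp _
  have key : D ≤ 2⁻¹ * D + 3 ^ p * D' := by
    have e : D = ∑' j : ℤ, ((3 : ℝ≥0∞) ^ (j + 1)) ^ p *
        volume {x | 3 ^ (j + 1) < supMean m K x} := by
      rw [hD, lintegral_layer hN]
      exact ((Equiv.addRight (1 : ℤ)).tsum_eq (fun j : ℤ => ((3 : ℝ≥0∞) ^ j) ^ p *
        volume {x | 3 ^ j < supMean m K x})).symm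
    calc D = _ := e
      _ ≤ ∑' j : ℤ, (3 ^ p * (4 * η) * (((3 : ℝ≥0∞) ^ j) ^ p *
            volume {x | 3 ^ j < supMean m K x}) +
            3 ^ p * (((3 : ℝ≥0∞) ^ j) ^ p * volume {x | 3 ^ j < H x})) := by
          refine ENNReal.tsum_le_tsum fun j => ?_
          rw [three_zpow_succ, ENNReal.mul_rpow_of_nonneg _ _ hp.le]
          calc _ ≤ 3 ^ p * ((3 : ℝ≥0∞) ^ j) ^ p * (4 * η * volume {x | 3 ^ j < supMean m K x} +
                volume {x | 3 ^ j < H x}) :=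
                mul_le_mul_right (h.volume_lt_supMean_le hη K _) _
            _ = _ := by ring
      _ = 3 ^ p * (4 * η) * D + 3 ^ p * D' := by
          rw [ENNReal.tsum_add, ENNReal.tsum_mul_left, ENNReal.tsum_mul_left, hD, hD',
            lintegral_layer hN, lintegral_layer h.meas]
      _ ≤ _ := by gcongr
  calc ∫⁻ x, supMean m K x ^ p ≤ ∫⁻ x, 3 ^ p * layer p (supMean m K x) :=
        lintegral_mono fun x => rpow_le_layer hp _
    _ = 3 ^ p * D := lintegral_const_mul' _ _ (by finiteness)
    _ ≤ 3 ^ p * (2 * (3 ^ p * (layerConst p * ∫⁻ x, H x ^ p))) := by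
        gcongr
        refine (le_two_mul_of_le_half_add hDt key).trans ?_
        gcongr
    _ = _ := by ring

lemma lintegral_rpow_le (h : IsLocallyApprox η T m H) (hη : η < 2⁻¹) {p : ℝ} (hp : 0 < p)
    (hηp : 3 ^ p * (4 * η) ≤ 2⁻¹) :
    ∫⁻ x, ‖T x‖ₑ ^ p ≤ strongConst p * ∫⁻ x, H x ^ p := by
  have hsup : ∫⁻ x, (⨆ K, supMean m K x) ^ p ≤
      3 ^ p * (2 * (3 ^ p * layerConst p)) * ∫⁻ x, H x ^ p := by
    have e : ∀ x, (⨆ K, supMean m K x) ^ p = ⨆ K, supMean m K x ^ p := fun x =>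
      (ENNReal.orderIsoRpow p hp).map_iSup _
    simp only [e]
    rw [lintegral_iSup (fun K => (h.measurable_supMean K).pow_const p) fun K K' hK x =>
      ENNReal.rpow_le_rpow (supMean_mono m x hK) hp.le]
    exact iSup_le fun K => h.lintegral_supMean_rpow_le hη hp hηp K
  calc _ ≤ ∫⁻ x, 2 ^ p * ((⨆ K, supMean m K x) ^ p + H x ^ p) := by
        refine lintegral_mono fun x => ?_
        exact (ENNReal.rpow_le_rpow (h.enorm_le hη x) hp.le).trans (add_rpow_le hp _ _)
    _ = 2 ^ p * ((∫⁻ x, (⨆ K, supMean m K x) ^ p) + ∫⁻ x, H x ^ p) := by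
        rw [lintegral_const_mul' _ _ (by finiteness), lintegral_add_right _ (h.meas.pow_const p)]
    _ ≤ 2 ^ p * (3 ^ p * (2 * (3 ^ p * layerConst p)) * (∫⁻ x, H x ^ p) + ∫⁻ x, H x ^ p) := by
        gcongr
    _ = _ := by rw [strongConst]; ring

/-- The same absorption with a supremum over levels in place of a sum; the truncation at `K` again
ensures finiteness. -/
lemma rpow_mul_volume_supMean_le (h : IsLocallyApprox η T m H) (hη : η < 2⁻¹) {p : ℝ} (hp : 0 < p)
    (hηp : 3 ^ p * (4 * η) ≤ 2⁻¹) {W : ℝ≥0∞} (hW : ∀ t : ℝ≥0∞, t ^ p * volume {x | t < H x} ≤ W)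
    (K : ℕ) (t : ℝ≥0∞) : t ^ p * volume {x | t < supMean m K x} ≤ 2 * (3 ^ p * W) := by
  obtain ⟨c, hc, hNc⟩ := h.exists_supMean_le K
  set V := ⨆ t : ℝ≥0∞, t ^ p * volume {x | t < supMean m K x} with hV
  have hVt : V ≠ ⊤ := by
    refine ne_top_of_le_ne_top (b := c ^ p) (by finiteness) (iSup_le fun t => ?_)
    rcases le_or_gt t c with htc | htc
    · exact (mul_le_of_le_one_right' prob_le_one).trans (ENNReal.rpow_le_rpow htc hp.le)
    · have : {x | t < supMean m K x} = ∅ := by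
        ext x
        simpa using (hNc x).trans htc.le
      rw [this, measure_empty, mul_zero]
      exact zero_le
  have key : V ≤ 2⁻¹ * V + 3 ^ p * W := by
    refine iSup_le fun t => ?_
    obtain ⟨r, rfl⟩ : ∃ r, t = 3 * r := ⟨t / 3, (ENNReal.mul_div_cancel (by simp) (by simp)).symm⟩
    rw [ENNReal.mul_rpow_of_nonneg _ _ hp.le]
    calc _ ≤ 3 ^ p * r ^ p * (4 * η * volume {x | r < supMean m K x} + volume {x | r < H x}) :=
          mul_le_mul_right (h.volume_lt_supMean_le hη K r) _
      _ = 3 ^ p * (4 * η) * (r ^ p * volume {x | r < supMean m K x}) +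
          3 ^ p * (r ^ p * volume {x | r < H x}) := by ring
      _ ≤ _ := by
          gcongr
          · exact le_iSup (fun t : ℝ≥0∞ => t ^ p * volume {x | t < supMean m K x}) r
          · exact hW r
  exact (le_iSup (fun t : ℝ≥0∞ => t ^ p * volume {x | t < supMean m K x}) t).trans
    (le_two_mul_of_le_half_add hVt key)

lemma rpow_mul_volume_le (h : IsLocallyApprox η T m H) (hη : η < 2⁻¹) {p : ℝ} (hp : 0 < p)
    (hηp : 3 ^ p * (4 * η) ≤ 2⁻¹) {W : ℝ≥0∞} (hW : ∀ t : ℝ≥0∞, t ^ p * volume {x | t < H x} ≤ W)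
    (t : ℝ≥0∞) : t ^ p * volume {x | t < ‖T x‖ₑ} ≤ weakTypeConst p * W := by
  obtain ⟨r, rfl⟩ : ∃ r, t = 2 * r := ⟨t / 2, (ENNReal.mul_div_cancel (by simp) (by simp)).symm⟩
  have hsup : r ^ p * volume {x | r < ⨆ K, supMean m K x} ≤ 2 * (3 ^ p * W) := by
    have e : {x | r < ⨆ K, supMean m K x} = ⋃ K, {x | r < supMean m K x} := by
      ext x
      simp [lt_iSup_iff]
    have hmono : Monotone fun K => {x | r < supMean m K x} := fun K K' hK x hx =>
      lt_of_lt_of_le (show r < supMean m K x from hx) (supMean_mono m x hK)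
    rw [e, hmono.measure_iUnion, ENNReal.mul_iSup]
    exact iSup_le fun K => h.rpow_mul_volume_supMean_le hη hp hηp hW K r
  have hsub : {x | 2 * r < ‖T x‖ₑ} ⊆ {x | r < ⨆ K, supMean m K x} ∪ {x | r < H x} := by
    intro x hx
    by_contra hc
    rw [Set.mem_union, not_or] at hc
    refine absurd (show 2 * r < ‖T x‖ₑ from hx) (not_lt.2 ?_)
    rw [two_mul]
    exact (h.enorm_le hη x).trans (add_le_add (not_lt.1 hc.1) (not_lt.1 hc.2))
  rw [ENNReal.mul_rpow_of_nonneg _ _ hp.le]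
  calc _ ≤ 2 ^ p * r ^ p * (volume {x | r < ⨆ K, supMean m K x} + volume {x | r < H x}) := by
        gcongr
        exact (measure_mono hsub).trans (measure_union_le _ _)
    _ = 2 ^ p * (r ^ p * volume {x | r < ⨆ K, supMean m K x} +
          r ^ p * volume {x | r < H x}) := by ring
    _ ≤ 2 ^ p * (2 * (3 ^ p * W) + W) := by gcongr; exact hW r
    _ = _ := by rw [weakTypeConst]; ring

end IsLocallyApprox

end

section

variable {B : ℝ} {a : Fin 3} {φ : Fin 3 → DyadicInterval → UnitAddCircle → ℂ}
  {ε : DyadicInterval → ℂ}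

/-! ### Domination of the partial sums by the product of the maximal functions -/

lemma isLocallyApprox_psum (hD : IsParaData B a φ ε) (F : Finset DyadicInterval)
    {f g : UnitAddCircle → ℂ} (hf : Measurable f) (hg : Measurable g) (hfi : Integrable f)
    (hgi : Integrable g) {s : ℝ≥0∞} (hs0 : s ≠ 0) (hs : s ≠ ⊤) :
    IsLocallyApprox (weakConst' B / s) (psum ε φ F f g) (localMean ε φ F f g) fun x =>
      localConst B s * (maxFn (fun z => ‖f z‖ₑ) x * maxFn (fun z => ‖g z‖ₑ) x) where
  cont := continuous_psum hD F f g
  zero := localMean_zero F f g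
  congr _ _ _ h := localMean_congr F f g h
  meas := ((measurable_maxFn hf.enorm).mul (measurable_maxFn hg.enorm)).const_mul _
  le k x := by
    rw [ENNReal.le_div_iff_mul_le (Or.inl hs0) (Or.inl hs), mul_comm, ← mul_assoc]
    exact mul_volume_local_le hD F hf hg hfi hgi hs k x

/-- The parameter at which the local estimate is used. -/
noncomputable def goodParam (B p : ℝ) : ℝ≥0∞ := 8 * 3 ^ p * (weakConst' B + 1)

lemma goodParam_ne_top (B p : ℝ) : goodParam B p ≠ ⊤ := by
  have h3' : (3 : ℝ≥0∞) ^ p ≠ ⊤ := ENNReal.rpow_ne_top_of_ne_zero (by simp) (by simp)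
  have := weakConst'_ne_top B
  rw [goodParam]; finiteness

lemma goodParam_ne_zero (B p : ℝ) : goodParam B p ≠ 0 := by
  have h3 : (3 : ℝ≥0∞) ^ p ≠ 0 := (ENNReal.rpow_pos (by simp) (by simp)).ne'
  rw [goodParam]
  exact mul_ne_zero (mul_ne_zero (by simp) h3) (by simp)

/-- Any proportion up to `(8 · 3^p)⁻¹` satisfies both smallness conditions of the good-`λ` argument.
-/
lemma weakConst'_div_le (B p : ℝ) :
    weakConst' B / goodParam B p ≤ (8 * 3 ^ p)⁻¹ := by
  have h3 : (3 : ℝ≥0∞) ^ p ≠ 0 := (ENNReal.rpow_pos (by simp) (by simp)).ne'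
  have h3' : (3 : ℝ≥0∞) ^ p ≠ ⊤ := ENNReal.rpow_ne_top_of_ne_zero (by simp) (by simp)
  have h8 : (8 : ℝ≥0∞) * 3 ^ p ≠ 0 := mul_ne_zero (by simp) h3
  have h8' : (8 : ℝ≥0∞) * 3 ^ p ≠ ⊤ := by finiteness
  refine ENNReal.div_le_of_le_mul ?_
  rw [goodParam, ← mul_assoc, ENNReal.inv_mul_cancel h8 h8', one_mul]
  exact le_self_add

lemma three_rpow_mul_le (B p : ℝ) :
    3 ^ p * (4 * (weakConst' B / goodParam B p)) ≤ 2⁻¹ := by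
  have h3 : (3 : ℝ≥0∞) ^ p ≠ 0 := (ENNReal.rpow_pos (by simp) (by simp)).ne'
  have h3' : (3 : ℝ≥0∞) ^ p ≠ ⊤ := ENNReal.rpow_ne_top_of_ne_zero (by simp) (by simp)
  have h8 : (8 : ℝ≥0∞)⁻¹ = 4⁻¹ * 2⁻¹ := by
    rw [← ENNReal.mul_inv (by simp) (by simp)]; norm_num
  calc _ ≤ (3 : ℝ≥0∞) ^ p * (4 * (8 * 3 ^ p)⁻¹) := by gcongr; exact weakConst'_div_le B p
    _ = (3 : ℝ≥0∞) ^ p * (3 ^ p)⁻¹ * (4 * 8⁻¹) := by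
        rw [ENNReal.mul_inv (by simp) (by simp)]; ring
    _ = (4 : ℝ≥0∞) * 4⁻¹ * 2⁻¹ := by rw [ENNReal.mul_inv_cancel h3 h3', one_mul, h8, mul_assoc]
    _ = 2⁻¹ := by rw [ENNReal.mul_inv_cancel (by simp) (by simp), one_mul]

lemma weakConst'_div_lt (B : ℝ) {p : ℝ} (hp : 0 < p) :
    weakConst' B / goodParam B p < 2⁻¹ := by
  refine (weakConst'_div_le B p).trans_lt (ENNReal.inv_lt_inv.2 ?_)
  calc (2 : ℝ≥0∞) < 8 * 1 := by norm_num
    _ ≤ 8 * 3 ^ p := by gcongr; exact ENNReal.one_le_rpow (by norm_num) hp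

/-- The constant in the domination by the maximal functions, in the strong norm. -/
noncomputable def dominationConst (B p : ℝ) : ℝ≥0∞ :=
  strongConst p * localConst B (goodParam B p) ^ p

lemma dominationConst_ne_top (B : ℝ) {p : ℝ} (hp : 0 < p) : dominationConst B p ≠ ⊤ := by
  have h1 := localConst_ne_top B (goodParam_ne_top B p)
  have h2 := layerConst_ne_top hp
  rw [dominationConst, strongConst]; finiteness

lemma lintegral_psum_rpow_le (hD : IsParaData B a φ ε) (F : Finset DyadicInterval)
    {f g : UnitAddCircle → ℂ} (hf : Measurable f) (hg : Measurable g) (hfi : Integrable f)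
    (hgi : Integrable g) {p : ℝ} (hp : 0 < p) :
    ∫⁻ x, ‖psum ε φ F f g x‖ₑ ^ p ≤ dominationConst B p *
      ∫⁻ x, (maxFn (fun z => ‖f z‖ₑ) x * maxFn (fun z => ‖g z‖ₑ) x) ^ p := by
  have hs := goodParam_ne_top B p
  have h1 := localConst_ne_top B hs
  refine ((isLocallyApprox_psum hD F hf hg hfi hgi (goodParam_ne_zero B p) hs).lintegral_rpow_le
    (weakConst'_div_lt B hp) hp (three_rpow_mul_le B p)).trans (le_of_eq ?_)
  rw [dominationConst, mul_assoc,
    ← lintegral_const_mul' _ _ (ENNReal.rpow_ne_top_of_nonneg hp.le h1)]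
  simp only [ENNReal.mul_rpow_of_nonneg _ _ hp.le]

/-- The constant in the domination by the maximal functions, in the weak norm. -/
noncomputable def weakDominationConst (B p : ℝ) : ℝ≥0∞ :=
  weakTypeConst p * localConst B (goodParam B p) ^ p

lemma weakDominationConst_ne_top (B : ℝ) {p : ℝ} (hp : 0 < p) : weakDominationConst B p ≠ ⊤ := by
  have h1 := localConst_ne_top B (goodParam_ne_top B p)
  rw [weakDominationConst, weakTypeConst]; finiteness

lemma rpow_mul_volume_psum_le (hD : IsParaData B a φ ε) (F : Finset DyadicInterval)
    {f g : UnitAddCircle → ℂ} (hf : Measurable f) (hg : Measurable g) (hfi : Integrable f)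
    (hgi : Integrable g) {p : ℝ} (hp : 0 < p) {W : ℝ≥0∞}
    (hW : ∀ t : ℝ≥0∞, t ^ p * volume {x | t < maxFn (fun z => ‖f z‖ₑ) x *
      maxFn (fun z => ‖g z‖ₑ) x} ≤ W) (t : ℝ≥0∞) :
    t ^ p * volume {x | t < ‖psum ε φ F f g x‖ₑ} ≤ weakDominationConst B p * W := by
  have hs := goodParam_ne_top B p
  set A := localConst B (goodParam B p) with hA
  have h1 : A ≠ ⊤ := localConst_ne_top B hs
  rw [weakDominationConst, mul_assoc, ← hA]
  refine (isLocallyApprox_psum hD F hf hg hfi hgi (goodParam_ne_zero B p) hs).rpow_mul_volume_le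
    (weakConst'_div_lt B hp) hp (three_rpow_mul_le B p) (fun t => ?_) t
  rw [← hA]
  rcases eq_or_ne A 0 with h0 | h0
  · simp [h0]
  calc _ = A ^ p * ((t / A) ^ p * volume {x | t / A < maxFn (fun z => ‖f z‖ₑ) x *
        maxFn (fun z => ‖g z‖ₑ) x}) := by
        rw [← mul_assoc, ← ENNReal.mul_rpow_of_nonneg _ _ hp.le, ENNReal.mul_div_cancel h0 h1]
        congr 2
        ext x
        rw [Set.mem_ofPred_eq, Set.mem_ofPred_eq,
          ENNReal.div_lt_iff (Or.inl h0) (Or.inl h1), mul_comm A]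
    _ ≤ _ := by gcongr; exact hW _

/-! ### Hölder's inequality for the maximal functions -/

lemma lintegral_mul_rpow_le {p p₁ p₂ : ℝ} (hp₁ : 0 < p₁) (hp₂ : 0 < p₂)
    (hp : 1 / p = 1 / p₁ + 1 / p₂) {u v : UnitAddCircle → ℝ≥0∞} (hu : Measurable u)
    (hv : Measurable v) : ∫⁻ x, (u x * v x) ^ p ≤
      (∫⁻ x, u x ^ p₁) ^ (p / p₁) * (∫⁻ x, v x ^ p₂) ^ (p / p₂) := by
  have hpi : 0 < 1 / p := by rw [hp]; positivity
  have hp0 : 0 < p := one_div_pos.1 hpi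
  have hsum : p / p₁ + p / p₂ = 1 := by
    have : p / p₁ + p / p₂ = p * (1 / p₁ + 1 / p₂) := by ring
    rw [this, ← hp]; field_simp
  have hconj : (p₁ / p).HolderConjugate (p₂ / p) := by
    rw [Real.holderConjugate_iff]
    refine ⟨?_, by rw [inv_div, inv_div]; exact hsum⟩
    rw [one_lt_div hp0]
    have h2 : 0 < p / p₂ := by positivity
    exact (div_lt_one hp₁).1 (by linarith)
  have key := ENNReal.lintegral_mul_le_Lp_mul_Lq volume hconj
    (hu.pow_const p).aemeasurable (hv.pow_const p).aemeasurable
  simp only [Pi.mul_apply, ← ENNReal.rpow_mul, one_div, inv_div, mul_div_cancel₀ _ hp0.ne'] at key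
  simp only [ENNReal.mul_rpow_of_nonneg _ _ hp0.le]
  exact key

/-- Hölder's inequality in weak Lebesgue spaces. -/
lemma rpow_mul_volume_mul_le {p p₁ p₂ : ℝ} (hp₁ : 0 < p₁) (hp₂ : 0 < p₂)
    (hp : 1 / p = 1 / p₁ + 1 / p₂) {u v : UnitAddCircle → ℝ≥0∞} {c d : ℝ≥0∞} (hc : c ≠ ⊤)
    (hd : d ≠ ⊤) (hu : ∀ t : ℝ≥0∞, t ^ p₁ * volume {x | t < u x} ≤ c ^ p₁)
    (hv : ∀ t : ℝ≥0∞, t ^ p₂ * volume {x | t < v x} ≤ d ^ p₂) (t : ℝ≥0∞) :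
    t ^ p * volume {x | t < u x * v x} ≤ 2 * (c * d) ^ p := by
  have hpi : 0 < 1 / p := by rw [hp]; positivity
  have hp0 : 0 < p := one_div_pos.1 hpi
  -- A vanishing constant cannot be divided out. In that case the function is zero almost
  -- everywhere, as each set where it exceeds `1/n` is null.
  have null : ∀ {q : ℝ} {w : UnitAddCircle → ℝ≥0∞}, 0 < q →
      (∀ t : ℝ≥0∞, t ^ q * volume {x | t < w x} ≤ 0 ^ q) → volume {x | 0 < w x} = 0 := by
    intro q w hq hw
    have hsub : {x | 0 < w x} ⊆ ⋃ n : ℕ, {x | (n : ℝ≥0∞)⁻¹ < w x} := fun x hx => by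
      obtain ⟨n, hn⟩ := ENNReal.exists_inv_nat_lt (ne_of_gt (show 0 < w x from hx))
      exact Set.mem_iUnion.2 ⟨n, hn⟩
    refine measure_mono_null hsub (measure_iUnion_null fun n => ?_)
    have h1 := hw (n : ℝ≥0∞)⁻¹
    rw [ENNReal.zero_rpow_of_pos hq, nonpos_iff_eq_zero, mul_eq_zero] at h1
    refine h1.resolve_left fun h2 => ?_
    rw [ENNReal.rpow_eq_zero_iff_of_pos hq] at h2
    simp at h2
  rcases eq_or_ne c 0 with rfl | hc0
  · have h1 : volume {x | t < u x * v x} = 0 := by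
      refine measure_mono_null (fun x hx => ?_) (null hp₁ hu)
      have : t < u x * v x := hx
      rw [Set.mem_ofPred_eq, pos_iff_ne_zero]
      exact fun h0 => by simp [h0] at this
    rw [h1, mul_zero]; exact zero_le
  rcases eq_or_ne d 0 with rfl | hd0
  · have h1 : volume {x | t < u x * v x} = 0 := by
      refine measure_mono_null (fun x hx => ?_) (null hp₂ hv)
      have : t < u x * v x := hx
      rw [Set.mem_ofPred_eq, pos_iff_ne_zero]
      exact fun h0 => by simp [h0] at this
    rw [h1, mul_zero]; exact zero_le
  have hcd0 : c * d ≠ 0 := mul_ne_zero hc0 hd0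
  have hcd : c * d ≠ ⊤ := by finiteness
  obtain ⟨r, rfl⟩ : ∃ r, t = c * d * r := ⟨t / (c * d), (ENNReal.mul_div_cancel hcd0 hcd).symm⟩
  rcases eq_or_ne r ⊤ with rfl | hr
  · simp [ENNReal.mul_top hcd0]
  -- With the level written `c d r`, the thresholds are `c r^{p/p₁}` and `d r^{p/p₂}`: their product
  -- is the level because the exponents sum to 1, and each exceptional set has measure at most
  -- `r^{-p}`.
  have hone : ∀ {q : ℝ} {w : UnitAddCircle → ℝ≥0∞} {e : ℝ≥0∞}, 0 < q → e ≠ 0 → e ≠ ⊤ →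
      (∀ t : ℝ≥0∞, t ^ q * volume {x | t < w x} ≤ e ^ q) →
      r ^ p * volume {x | e * r ^ (p / q) < w x} ≤ 1 := by
    intro q w e hq he0 he hw
    have h1 := hw (e * r ^ (p / q))
    rw [ENNReal.mul_rpow_of_nonneg _ _ hq.le, ← ENNReal.rpow_mul, div_mul_cancel₀ _ hq.ne',
      mul_assoc] at h1
    have h2 : e ^ q ≠ 0 := (ENNReal.rpow_pos (pos_iff_ne_zero.2 he0) he).ne'
    have h3 : e ^ q ≠ ⊤ := by finiteness
    rwa [← ENNReal.mul_le_mul_iff_right h2 h3, mul_one]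
  have hsub : {x | c * d * r < u x * v x} ⊆
      {x | c * r ^ (p / p₁) < u x} ∪ {x | d * r ^ (p / p₂) < v x} := by
    intro x hx
    by_contra hcon
    rw [Set.mem_union, not_or] at hcon
    refine absurd (show c * d * r < u x * v x from hx) (not_lt.2 ?_)
    have hsum : p / p₁ + p / p₂ = 1 := by
      have : p / p₁ + p / p₂ = p * (1 / p₁ + 1 / p₂) := by ring
      rw [this, ← hp]; field_simp
    calc u x * v x ≤ (c * r ^ (p / p₁)) * (d * r ^ (p / p₂)) :=
          mul_le_mul' (not_lt.1 hcon.1) (not_lt.1 hcon.2)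
      _ = c * d * (r ^ (p / p₁) * r ^ (p / p₂)) := by ring
      _ = c * d * r := by
          rw [← ENNReal.rpow_add_of_nonneg _ _ (by positivity) (by positivity), hsum,
            ENNReal.rpow_one]
  rw [ENNReal.mul_rpow_of_nonneg _ _ hp0.le]
  calc _ ≤ (c * d) ^ p * r ^ p * (volume {x | c * r ^ (p / p₁) < u x} +
        volume {x | d * r ^ (p / p₂) < v x}) := by
        gcongr
        exact (measure_mono hsub).trans (measure_union_le _ _)
    _ = (c * d) ^ p * (r ^ p * volume {x | c * r ^ (p / p₁) < u x} +
        r ^ p * volume {x | d * r ^ (p / p₂) < v x}) := by ring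
    _ ≤ (c * d) ^ p * (1 + 1) := by
        gcongr
        · exact hone hp₁ hc0 hc hu
        · exact hone hp₂ hd0 hd hv
    _ = _ := by ring

/-- The constant in the weak type bound of the maximal function. -/
noncomputable def weakMaxConst (p : ℝ) : ℝ≥0∞ := if p = 1 then 1024 else maxConst p

lemma weakMaxConst_ne_top {p : ℝ} (hp : 1 ≤ p) : weakMaxConst p ≠ ⊤ := by
  rw [weakMaxConst]
  split_ifs with h
  · simp
  · exact maxConst_ne_top (lt_of_le_of_ne hp (Ne.symm h))

/-- At `p = 1` this is the weak type bound with the factor 256 rescaled away; for `p > 1` it is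
Chebyshev applied to the strong bound. -/
lemma rpow_mul_volume_maxFn_le {p : ℝ} (hp : 1 ≤ p) {h : UnitAddCircle → ℝ≥0∞}
    (hh : Measurable h) (t : ℝ≥0∞) :
    t ^ p * volume {x | t < maxFn h x} ≤ weakMaxConst p * ∫⁻ x, h x ^ p := by
  rcases eq_or_lt_of_le hp with rfl | hp1
  · rcases eq_or_ne t ⊤ with rfl | ht
    · simp
    obtain ⟨r, rfl⟩ : ∃ r, t = 256 * r :=
      ⟨t / 256, (ENNReal.mul_div_cancel (by simp) (by simp)).symm⟩
    have hr : r ≠ ⊤ := fun hr => ht (by rw [hr, ENNReal.mul_top (by simp)])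
    simp only [ENNReal.rpow_one, weakMaxConst, if_true]
    calc _ = 256 * (r * volume {x | 256 * r < maxFn h x}) := by ring
      _ ≤ 256 * (4 * ∫⁻ x, h x) := mul_le_mul_right (mul_volume_maxFn_le h hr) _
      _ = _ := by rw [← mul_assoc]; norm_num
  · have hp0 : 0 < p := by linarith
    rw [weakMaxConst, if_neg hp1.ne']
    refine le_trans ?_ (lintegral_maxFn_rpow_le hp1 hh)
    refine le_trans ?_ (mul_meas_ge_le_lintegral ((measurable_maxFn hh).pow_const p) (t ^ p))
    gcongr with x
    exact fun hx => ENNReal.rpow_le_rpow (le_of_lt hx) hp0.le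

/-! ### Strong and weak bounds of the partial sums in Lebesgue norms -/

lemma rpow_lintegral_eq_eLpNorm {p : ℝ} (hp : 0 < p) (f : UnitAddCircle → ℂ) :
    (∫⁻ x, ‖f x‖ₑ ^ p) ^ (1 / p) = eLpNorm f (ENNReal.ofReal p) volume := by
  rw [eLpNorm_eq_lintegral_rpow_enorm_toReal (by simpa using hp) ENNReal.ofReal_ne_top,
    ENNReal.toReal_ofReal hp.le]

/-- The constant in the strong type bound of the paraproduct. -/
noncomputable def paraConst (B p p₁ p₂ : ℝ) : ℝ≥0∞ :=
  dominationConst B p ^ (1 / p) * (maxConst p₁ ^ (1 / p₁) * maxConst p₂ ^ (1 / p₂))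

lemma paraConst_ne_top (B : ℝ) {p p₁ p₂ : ℝ} (hp : 0 < p) (hp₁ : 1 < p₁) (hp₂ : 1 < p₂) :
    paraConst B p p₁ p₂ ≠ ⊤ := by
  have h1 := dominationConst_ne_top B hp
  have h2 := maxConst_ne_top hp₁
  have h3 := maxConst_ne_top hp₂
  have : 0 < 1 / p₁ := by positivity
  have : 0 < 1 / p₂ := by positivity
  have : 0 < 1 / p := by positivity
  rw [paraConst]; finiteness

lemma eLpNorm_psum_le (hD : IsParaData B a φ ε) (F : Finset DyadicInterval)
    {f g : UnitAddCircle → ℂ} (hf : Measurable f) (hg : Measurable g) (hfi : Integrable f)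
    (hgi : Integrable g) {p p₁ p₂ : ℝ} (hp₁ : 1 < p₁) (hp₂ : 1 < p₂)
    (hp : 1 / p = 1 / p₁ + 1 / p₂) :
    eLpNorm (psum ε φ F f g) (ENNReal.ofReal p) volume ≤ paraConst B p p₁ p₂ *
      (eLpNorm f (ENNReal.ofReal p₁) volume * eLpNorm g (ENNReal.ofReal p₂) volume) := by
  have h1 : 0 < p₁ := by linarith
  have h2 : 0 < p₂ := by linarith
  have hpi : 0 < 1 / p := by rw [hp]; positivity
  have hp0 : 0 < p := one_div_pos.1 hpi
  rw [← rpow_lintegral_eq_eLpNorm hp0, ← rpow_lintegral_eq_eLpNorm h1,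
    ← rpow_lintegral_eq_eLpNorm h2]
  have e1 : p / p₁ * (1 / p) = 1 / p₁ := by field_simp
  have e2 : p / p₂ * (1 / p) = 1 / p₂ := by field_simp
  calc _ ≤ (dominationConst B p * ((maxConst p₁ * ∫⁻ x, ‖f x‖ₑ ^ p₁) ^ (p / p₁) *
        (maxConst p₂ * ∫⁻ x, ‖g x‖ₑ ^ p₂) ^ (p / p₂))) ^ (1 / p) := by
        gcongr
        refine (lintegral_psum_rpow_le hD F hf hg hfi hgi hp0).trans ?_
        gcongr
        refine (lintegral_mul_rpow_le h1 h2 hp (measurable_maxFn hf.enorm)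
          (measurable_maxFn hg.enorm)).trans ?_
        gcongr
        · exact lintegral_maxFn_rpow_le hp₁ hf.enorm
        · exact lintegral_maxFn_rpow_le hp₂ hg.enorm
    _ = _ := by
        rw [ENNReal.mul_rpow_of_nonneg _ _ hpi.le, ENNReal.mul_rpow_of_nonneg _ _ hpi.le,
          ← ENNReal.rpow_mul, ← ENNReal.rpow_mul, e1, e2,
          ENNReal.mul_rpow_of_nonneg _ _ (by positivity),
          ENNReal.mul_rpow_of_nonneg _ _ (by positivity), paraConst]
        ring

/-- The constant in the weak type bound of the paraproduct. -/
noncomputable def weakParaConst (B p p₁ p₂ : ℝ) : ℝ≥0∞ :=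
  (weakDominationConst B p * 2) ^ (1 / p) *
    (weakMaxConst p₁ ^ (1 / p₁) * weakMaxConst p₂ ^ (1 / p₂))

lemma weakParaConst_ne_top (B : ℝ) {p p₁ p₂ : ℝ} (hp : 0 < p) (hp₁ : 1 ≤ p₁) (hp₂ : 1 ≤ p₂) :
    weakParaConst B p p₁ p₂ ≠ ⊤ := by
  have h1 := weakDominationConst_ne_top B hp
  have h2 := weakMaxConst_ne_top hp₁
  have h3 := weakMaxConst_ne_top hp₂
  have : 0 < 1 / p₁ := by positivity
  have : 0 < 1 / p₂ := by positivity
  have : 0 < 1 / p := by positivity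
  rw [weakParaConst]; finiteness

lemma rpow_mul_volume_psum_le_eLpNorm (hD : IsParaData B a φ ε) (F : Finset DyadicInterval)
    {f g : UnitAddCircle → ℂ} (hf : Measurable f) (hg : Measurable g) {p p₁ p₂ : ℝ}
    (hfi : MemLp f (ENNReal.ofReal p₁)) (hgi : MemLp g (ENNReal.ofReal p₂)) (hp₁ : 1 ≤ p₁)
    (hp₂ : 1 ≤ p₂) (hp : 1 / p = 1 / p₁ + 1 / p₂) (t : ℝ≥0∞) :
    t ^ p * volume {x | t < ‖psum ε φ F f g x‖ₑ} ≤ (weakParaConst B p p₁ p₂ *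
      (eLpNorm f (ENNReal.ofReal p₁) volume * eLpNorm g (ENNReal.ofReal p₂) volume)) ^ p := by
  have h1 : 0 < p₁ := by linarith
  have h2 : 0 < p₂ := by linarith
  have hpi : 0 < 1 / p := by rw [hp]; positivity
  have hp0 : 0 < p := one_div_pos.1 hpi
  have i1 : 0 < 1 / p₁ := by positivity
  have i2 : 0 < 1 / p₂ := by positivity
  have hmax : ∀ {q : ℝ} {h : UnitAddCircle → ℂ}, 1 ≤ q → Measurable h → ∀ t : ℝ≥0∞,
      t ^ q * volume {x | t < maxFn (fun z => ‖h z‖ₑ) x} ≤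
        (weakMaxConst q ^ (1 / q) * eLpNorm h (ENNReal.ofReal q) volume) ^ q := by
    intro q h hq hh t
    have hq0 : 0 < q := by linarith
    rw [← rpow_lintegral_eq_eLpNorm hq0, ← ENNReal.mul_rpow_of_nonneg _ _ (by positivity),
      ← ENNReal.rpow_mul, one_div_mul_cancel hq0.ne', ENNReal.rpow_one]
    exact rpow_mul_volume_maxFn_le hq hh.enorm t
  have hW := rpow_mul_volume_mul_le h1 h2 hp
    (c := weakMaxConst p₁ ^ (1 / p₁) * eLpNorm f (ENNReal.ofReal p₁) volume)
    (d := weakMaxConst p₂ ^ (1 / p₂) * eLpNorm g (ENNReal.ofReal p₂) volume)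
    (ENNReal.mul_ne_top (ENNReal.rpow_ne_top_of_nonneg i1.le (weakMaxConst_ne_top hp₁)) hfi.2.ne)
    (ENNReal.mul_ne_top (ENNReal.rpow_ne_top_of_nonneg i2.le (weakMaxConst_ne_top hp₂)) hgi.2.ne)
    (hmax hp₁ hf) (hmax hp₂ hg)
  refine (rpow_mul_volume_psum_le hD F hf hg (hfi.integrable (by simpa using hp₁))
    (hgi.integrable (by simpa using hp₂)) hp0 hW t).trans (le_of_eq ?_)
  have e : weakDominationConst B p * 2 = ((weakDominationConst B p * 2) ^ (1 / p)) ^ p := by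
    rw [← ENNReal.rpow_mul, one_div_mul_cancel hp0.ne', ENNReal.rpow_one]
  rw [← mul_assoc, e, ← ENNReal.mul_rpow_of_nonneg _ _ hp0.le, weakParaConst]
  congr 1
  ring

end

section

variable {B : ℝ} {a : Fin 3} {φ : Fin 3 → DyadicInterval → UnitAddCircle → ℂ}
  {ε : DyadicInterval → ℂ}

/-! ### Convergence of the series -/

/-- The partial sums of the paraproduct over finite sets far out are small in measure. -/
def HasSmallTails (ε : DyadicInterval → ℂ) (φ : Fin 3 → DyadicInterval → UnitAddCircle → ℂ)
    (f g : UnitAddCircle → ℂ) : Prop :=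
  ∀ δ : ℝ≥0∞, δ ≠ 0 → ∃ F₀ : Finset DyadicInterval, ∀ F : Finset DyadicInterval, Disjoint F F₀ →
    volume {x | δ < ‖psum ε φ F f g x‖ₑ} ≤ δ

lemma exists_finset_sum_le {s : DyadicInterval → ℝ≥0∞} (hs : ∑' I, s I ≠ ⊤) {δ : ℝ≥0∞}
    (hδ : δ ≠ 0) : ∃ F₀ : Finset DyadicInterval, ∀ F : Finset DyadicInterval, Disjoint F F₀ →
      ∑ I ∈ F, s I ≤ δ := by
  obtain ⟨F₀, hF₀⟩ := ((tendsto_order.1 (ENNReal.tendsto_tsum_compl_atTop_zero hs)).2 δ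
    (pos_iff_ne_zero.2 hδ)).exists
  refine ⟨F₀, fun F hF => le_trans ?_ hF₀.le⟩
  have hF' : ∀ I ∈ F, I ∉ F₀ := fun I hI => Finset.disjoint_left.1 hF hI
  calc ∑ I ∈ F, s I = ∑ I ∈ F.subtype (· ∉ F₀), s I := (Finset.sum_subtype_of_mem s hF').symm
    _ ≤ _ := ENNReal.sum_le_tsum _

/-- The dominating family of `psum_bounded` does not depend on the finite set, so its tails control
all far-out partial sums through Chebyshev's inequality. -/
lemma hasSmallTails_of_bound (hD : IsParaData B a φ ε) {f g : UnitAddCircle → ℂ}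
    (hf : Measurable f) (hfi : Integrable f) (hg : Measurable g) (hgi : Integrable g) {A : ℝ≥0∞}
    (hA : A ≠ ⊤) (hfA : ∀ x, ‖f x‖ₑ ≤ A) (hgA : ∀ x, ‖g x‖ₑ ≤ A) : HasSmallTails ε φ f g := by
  intro δ hδ
  rcases eq_or_ne δ ⊤ with rfl | hδt
  · exact ⟨∅, fun _ _ => le_top⟩
  have hle : ∀ {h : UnitAddCircle → ℂ}, (∀ x, ‖h x‖ₑ ≤ A) → ∫⁻ x, ‖h x‖ₑ ≤ A := fun hh =>
    (lintegral_mono hh).trans (by simp)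
  have hb := boundedConst_ne_top B
  have hmeas : ∀ F, Measurable fun x => ‖psum ε φ F f g x‖ₑ := fun F =>
    (continuous_psum hD F f g).enorm.measurable
  obtain ⟨s, ⟨hs, hF⟩ | ⟨hs, hF⟩⟩ := psum_bounded hD hf hfi hg hgi hA hfA hgA (hle hfA) (hle hgA)
  · obtain ⟨F₀, hF₀⟩ := exists_finset_sum_le (ne_top_of_le_ne_top (by finiteness) hs)
      (δ := δ * δ) (mul_ne_zero hδ hδ)
    refine ⟨F₀, fun F hd => ?_⟩
    rw [← ENNReal.mul_le_mul_iff_right hδ hδt]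
    refine le_trans ?_ ((hF F).trans (hF₀ F hd))
    refine le_trans ?_ (mul_meas_ge_le_lintegral (hmeas F) δ)
    gcongr with x
    exact le_of_lt
  · obtain ⟨F₀, hF₀⟩ := exists_finset_sum_le (ne_top_of_le_ne_top (by finiteness) hs)
      (δ := δ ^ 2 * δ) (mul_ne_zero (pow_ne_zero 2 hδ) hδ)
    refine ⟨F₀, fun F hd => ?_⟩
    rw [← ENNReal.mul_le_mul_iff_right (pow_ne_zero 2 hδ) (ENNReal.pow_ne_top hδt)]
    refine le_trans ?_ ((hF F).trans (hF₀ F hd))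
    refine le_trans ?_ (mul_meas_ge_le_lintegral ((hmeas F).pow_const 2) (δ ^ 2))
    gcongr with x
    exact fun hx => pow_le_pow_left₀ zero_le (le_of_lt hx) 2

/-- The part of `f` where it is at most `N`. -/
noncomputable def trunc (N : ℕ) (f : UnitAddCircle → ℂ) (x : UnitAddCircle) : ℂ :=
  {x | ‖f x‖ₑ ≤ N}.indicator f x

lemma measurableSet_enorm_le {f : UnitAddCircle → ℂ} (hf : Measurable f) (N : ℕ) :
    MeasurableSet {x | ‖f x‖ₑ ≤ N} := measurableSet_le hf.enorm measurable_const

lemma measurable_trunc {f : UnitAddCircle → ℂ} (hf : Measurable f) (N : ℕ) :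
    Measurable (trunc N f) := hf.indicator (measurableSet_enorm_le hf N)

lemma enorm_trunc_le (N : ℕ) (f : UnitAddCircle → ℂ) (x : UnitAddCircle) : ‖trunc N f x‖ₑ ≤ N := by
  by_cases hx : x ∈ {x | ‖f x‖ₑ ≤ N}
  · rw [trunc, Set.indicator_of_mem hx]; exact hx
  · rw [trunc, Set.indicator_of_notMem hx, enorm_zero]; exact zero_le

lemma tendsto_lintegral_sub_trunc {f : UnitAddCircle → ℂ} (hf : Measurable f)
    (hfi : Integrable f) :
    Tendsto (fun N : ℕ => ∫⁻ x, ‖f x - trunc N f x‖ₑ) atTop (nhds 0) := by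
  have h := tendsto_lintegral_of_dominated_convergence (μ := volume)
    (F := fun (N : ℕ) x => ‖f x - trunc N f x‖ₑ) (f := fun _ => 0) (fun x => ‖f x‖ₑ)
    (fun N => (hf.sub (measurable_trunc hf N)).enorm) (fun N => ae_of_all _ fun x => ?_)
    hfi.2.ne (ae_of_all _ fun x => ?_)
  · simpa using h
  · beta_reduce
    rw [trunc]
    by_cases hx : x ∈ {x | ‖f x‖ₑ ≤ N}
    · rw [Set.indicator_of_mem hx]; simp
    · rw [Set.indicator_of_notMem hx]; simp
  · obtain ⟨n, hn⟩ := ENNReal.exists_nat_gt (enorm_ne_top (x := f x))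
    refine tendsto_const_nhds.congr' ?_
    filter_upwards [eventually_ge_atTop n] with N hN
    have hx : x ∈ {x | ‖f x‖ₑ ≤ N} := hn.le.trans (by exact_mod_cast hN)
    rw [trunc, Set.indicator_of_mem hx]; simp

/-- Both functions are truncated at a common height. The truncated pair has small tails, and the two
error terms are small in measure for every finite set, by the endpoint bound. -/
lemma hasSmallTails (hD : IsParaData B a φ ε) {f g : UnitAddCircle → ℂ}
    (hf : Measurable f) (hfi : Integrable f) (hg : Measurable g) (hgi : Integrable g) :
    HasSmallTails ε φ f g := by
  intro δ hδ
  rcases eq_or_ne δ ⊤ with rfl | hδt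
  · exact ⟨∅, fun _ _ => le_top⟩
  have hW := weakConst'_ne_top B
  have hW' := weakConst_ne_top B
  set r := δ / 3 with hr
  have hr0 : r ≠ 0 := by simp [hr, ENNReal.div_eq_zero_iff, hδ]
  have hrt : r ≠ ⊤ := ENNReal.div_ne_top hδt (by simp)
  have h3 : r + r + r = δ := by
    rw [hr, ENNReal.add_thirds]
  -- The order of choice matters: `t` is fixed first, making the measure at most `r`, and then the
  -- truncation height, making the level at most `r`.
  set t := (weakConst' B + 1) / r with ht
  have ht0 : t ≠ 0 := by
    rw [ht, Ne, ENNReal.div_eq_zero_iff, not_or]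
    exact ⟨by simp, hrt⟩
  have htt : t ≠ ⊤ := ENNReal.div_ne_top (by finiteness) hr0
  have hWt : weakConst' B / t ≤ r := by
    refine ENNReal.div_le_of_le_mul ?_
    rw [ht, ENNReal.mul_div_cancel hr0 hrt]
    exact le_self_add
  set α := ∫⁻ x, ‖f x‖ₑ with hα
  set β := ∫⁻ x, ‖g x‖ₑ with hβ
  have hαt : α ≠ ⊤ := hfi.2.ne
  have hβt : β ≠ ⊤ := hgi.2.ne
  have hlim : ∀ {h : UnitAddCircle → ℂ}, Measurable h → Integrable h →
      ∀ᶠ N : ℕ in atTop, weakConst B * (α + β) * t ^ 2 * ∫⁻ x, ‖h x - trunc N h x‖ₑ < r := by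
    intro h hh hhi
    have := ENNReal.Tendsto.const_mul (a := weakConst B * (α + β) * t ^ 2)
      (tendsto_lintegral_sub_trunc hh hhi) (Or.inr (by finiteness))
    rw [mul_zero] at this
    exact this.eventually (gt_mem_nhds (pos_iff_ne_zero.2 hr0))
  obtain ⟨N, hN1, hN2⟩ := ((hlim hf hfi).and (hlim hg hgi)).exists
  have hf1 := measurable_trunc hf N
  have hg1 := measurable_trunc hg N
  have hint : ∀ {h : UnitAddCircle → ℂ}, Measurable h → Integrable h → Integrable (trunc N h) :=
    fun hh hhi => hhi.indicator (measurableSet_enorm_le hh N)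
  have hfi1 := hint hf hfi
  have hgi1 := hint hg hgi
  obtain ⟨F₀, hF₀⟩ := hasSmallTails_of_bound hD hf1 hfi1 hg1 hgi1 (ENNReal.natCast_ne_top N)
    (enorm_trunc_le N f) (enorm_trunc_le N g) r hr0
  refine ⟨F₀, fun F hF => ?_⟩
  have weak : ∀ {u v : UnitAddCircle → ℂ} {c d : ℝ≥0∞}, Measurable u → Measurable v → c ≠ ⊤ →
      d ≠ ⊤ → ∫⁻ x, ‖u x‖ₑ ≤ c → ∫⁻ x, ‖v x‖ₑ ≤ d → weakConst B * (c * d) * t ^ 2 ≤ r →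
      volume {x | r < ‖psum ε φ F u v x‖ₑ} ≤ r := by
    intro u v c d hu hv hc hd huc hvd hle
    refine le_trans ?_ hWt
    rw [ENNReal.le_div_iff_mul_le (Or.inl ht0) (Or.inl htt), mul_comm]
    refine le_trans ?_ (mul_volume_psum_le hD F hu hv hc hd huc hvd htt)
    gcongr
  have hdf : ∀ {h : UnitAddCircle → ℂ}, Integrable h → Measurable h →
      ∫⁻ x, ‖h x - trunc N h x‖ₑ ≠ ⊤ := fun hhi hh => (hhi.sub (hint hh hhi)).2.ne
  have hle1 : ∫⁻ x, ‖trunc N f x‖ₑ ≤ α := lintegral_mono fun x => enorm_indicator_le _ f x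
  have w1 : volume {x | r < ‖psum ε φ F (fun x => f x - trunc N f x) g x‖ₑ} ≤ r := by
    refine weak (hf.sub hf1) hg (hdf hfi hf) hβt le_rfl le_rfl (le_trans ?_ hN1.le)
    calc _ = weakConst B * β * t ^ 2 * ∫⁻ x, ‖f x - trunc N f x‖ₑ := by ring
      _ ≤ _ := by gcongr; exact le_add_self
  have w2 : volume {x | r < ‖psum ε φ F (trunc N f) (fun x => g x - trunc N g x) x‖ₑ} ≤ r := by
    refine weak hf1 (hg.sub hg1) hαt (hdf hgi hg) hle1 le_rfl (le_trans ?_ hN2.le)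
    calc _ = weakConst B * α * t ^ 2 * ∫⁻ x, ‖g x - trunc N g x‖ₑ := by ring
      _ ≤ _ := by gcongr; exact le_self_add
  have e : ∀ x, psum ε φ F f g x = psum ε φ F (trunc N f) (trunc N g) x +
      psum ε φ F (fun x => f x - trunc N f x) g x +
        psum ε φ F (trunc N f) (fun x => g x - trunc N g x) x := by
    intro x
    have e1 := psum_add_left hD F hfi1 (hfi.sub hfi1) g x
    have e2 := psum_add_right hD F (trunc N f) hgi1 (hgi.sub hgi1) x
    simp only [Pi.sub_apply, add_sub_cancel] at e1 e2
    change psum ε φ F f g x = _ at e1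
    change psum ε φ F (trunc N f) g x = _ at e2
    rw [e1, e2]
    simp only [Pi.sub_def]
    ring
  calc volume {x | δ < ‖psum ε φ F f g x‖ₑ}
      ≤ volume (({x | r < ‖psum ε φ F (trunc N f) (trunc N g) x‖ₑ} ∪
          {x | r < ‖psum ε φ F (fun x => f x - trunc N f x) g x‖ₑ}) ∪
          {x | r < ‖psum ε φ F (trunc N f) (fun x => g x - trunc N g x) x‖ₑ}) := by
        refine measure_mono fun x hx => ?_
        by_contra hc
        simp only [Set.mem_union, Set.mem_ofPred_eq, not_or, not_lt] at hc
        refine absurd (show δ < ‖psum ε φ F f g x‖ₑ from hx) (not_lt.2 ?_)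
        rw [e, ← h3]
        exact (enorm_add_le _ _).trans (add_le_add ((enorm_add_le _ _).trans
          (add_le_add hc.1.1 hc.1.2)) hc.2)
    _ ≤ r + r + r := (measure_union_le _ _).trans (add_le_add ((measure_union_le _ _).trans
          (add_le_add (hF₀ F hF) w1)) w2)
    _ = δ := h3

lemma psum_eq_add_sdiff {F G : Finset DyadicInterval} (h : G ⊆ F) (f g : UnitAddCircle → ℂ)
    (x : UnitAddCircle) : psum ε φ F f g x = psum ε φ G f g x + psum ε φ (F \ G) f g x := by
  rw [psum, psum, psum, add_comm, Finset.sum_sdiff h]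

/-- An increasing sequence of finite sets with tails below `2^{-n}` yields a limit almost
everywhere. The tail condition covers every finite set disjoint from the chosen one, so convergence
extends from the sequence to the whole directed set. -/
lemma exists_tendstoInMeasure (hD : IsParaData B a φ ε) {f g : UnitAddCircle → ℂ}
    (hT : HasSmallTails ε φ f g) :
    ∃ h, TendstoInMeasure volume (fun F => psum ε φ F f g) atTop h := by
  classical
  have hpow : ∀ n : ℕ, (2⁻¹ : ℝ≥0∞) ^ n ≠ 0 := fun n => pow_ne_zero n (by simp)
  choose G hG using fun n : ℕ => hT (2⁻¹ ^ n) (hpow n)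
  set F : ℕ → Finset DyadicInterval := fun n => (Finset.range (n + 1)).biUnion G with hF
  have hFm : ∀ n, F n ⊆ F (n + 1) := fun n =>
    Finset.biUnion_subset_biUnion_of_subset_left _ (Finset.range_mono (Nat.le_succ _))
  have hGF : ∀ n, G n ⊆ F n := fun n =>
    Finset.subset_biUnion_of_mem G (Finset.mem_range.2 (Nat.lt_succ_self n))
  have hdis : ∀ n (E : Finset DyadicInterval), Disjoint (E \ F n) (G n) := fun n E =>
    Finset.disjoint_of_subset_right (hGF n) Finset.sdiff_disjoint
  have hcauchy : ∀ᵐ x, ∃ l, Tendsto (fun n => psum ε φ (F n) f g x) atTop (nhds l) := by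
    -- Borel–Cantelli: the exceptional measures are summable, so almost everywhere the increments
    -- are eventually at most `2^{-n}`.
    have hbc : ∀ᵐ x, ∀ᶠ n in atTop,
        ¬ (2⁻¹ : ℝ≥0∞) ^ n < ‖psum ε φ (F (n + 1) \ F n) f g x‖ₑ := by
      refine ae_eventually_notMem (s := fun n => {x | (2⁻¹ : ℝ≥0∞) ^ n <
        ‖psum ε φ (F (n + 1) \ F n) f g x‖ₑ}) (ne_top_of_le_ne_top ?_
          (ENNReal.tsum_le_tsum fun n => hG n _ (hdis n _)))
      rw [ENNReal.tsum_geometric]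
      simp
    filter_upwards [hbc] with x hx
    obtain ⟨N, hN⟩ := eventually_atTop.1 hx
    have hc : CauchySeq fun n => psum ε φ (F (n + N)) f g x := by
      refine cauchySeq_of_edist_le_geometric_two 1 ENNReal.one_ne_top fun n => ?_
      rw [show n + 1 + N = n + N + 1 by ring, edist_comm, edist_eq_enorm_sub,
        psum_eq_add_sdiff (hFm (n + N)), add_sub_cancel_left]
      refine (not_lt.1 (hN (n + N) (by omega))).trans ?_
      rw [one_div, ENNReal.inv_pow, pow_add]
      exact mul_le_of_le_one_right' (pow_le_one₀ zero_le (by simp))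
    obtain ⟨l, hl⟩ := cauchySeq_tendsto_of_complete hc
    exact ⟨l, (tendsto_add_atTop_iff_nat N).1 hl⟩
  set h : UnitAddCircle → ℂ := fun x => limUnder atTop fun n => psum ε φ (F n) f g x with hh
  have hlim : TendstoInMeasure volume (fun n => psum ε φ (F n) f g) atTop h := by
    refine tendstoInMeasure_of_tendsto_ae
      (fun n => (continuous_psum hD (F n) f g).aestronglyMeasurable) ?_
    filter_upwards [hcauchy] with x hx
    exact tendsto_nhds_limUnder hx
  refine ⟨h, fun η hη => ?_⟩
  rw [ENNReal.tendsto_nhds_zero]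
  intro δ hδ
  have hη2 : 0 < η / 2 := ENNReal.half_pos hη.ne'
  have hδ2 : 0 < δ / 2 := ENNReal.half_pos hδ.ne'
  have hp := ENNReal.tendsto_pow_atTop_nhds_zero_of_lt_one (r := 2⁻¹) (by simp)
  obtain ⟨n, hn1, hn2, hn3⟩ := (((hlim (η / 2) hη2).eventually (ge_mem_nhds hδ2)).and
    ((hp.eventually (ge_mem_nhds hη2)).and (hp.eventually (ge_mem_nhds hδ2)))).exists
  filter_upwards [eventually_ge_atTop (F n)] with E hE
  calc volume {x | η ≤ edist (psum ε φ E f g x) (h x)}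
      ≤ volume ({x | η / 2 ≤ edist (psum ε φ (F n) f g x) (h x)} ∪
          {x | 2⁻¹ ^ n < ‖psum ε φ (E \ F n) f g x‖ₑ}) := by
        refine measure_mono fun x hx => ?_
        by_contra hc
        simp only [Set.mem_union, Set.mem_ofPred_eq, not_or, not_lt, not_le] at hc
        refine absurd (show η ≤ edist (psum ε φ E f g x) (h x) from hx) (not_le.2 ?_)
        calc _ ≤ edist (psum ε φ E f g x) (psum ε φ (F n) f g x) +
              edist (psum ε φ (F n) f g x) (h x) := edist_triangle _ _ _
          _ < η / 2 + η / 2 := by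
              refine ENNReal.add_lt_add_of_le_of_lt (edist_ne_top _ _) ?_ hc.1
              rw [edist_eq_enorm_sub, psum_eq_add_sdiff hE, add_sub_cancel_left]
              exact hc.2.trans hn2
          _ = η := ENNReal.add_halves η
    _ ≤ δ / 2 + δ / 2 := (measure_union_le _ _).trans
        (add_le_add hn1 ((hG n _ (hdis n E)).trans hn3))
    _ = δ := ENNReal.add_halves δ

end

section

/-! ### Bounds for the sum of the series -/

lemma isParaData_of_isAdaptedFamily {Cm : ℕ → ℝ} {a : Fin 3}
    {φ : Fin 3 → DyadicInterval → UnitAddCircle → ℂ} {ε : DyadicInterval → ℂ}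
    (hφ : ∀ i, IsAdaptedFamily Cm (φ i)) (h0 : ∀ i, i ≠ a → ∀ I, ∫ x, φ i I x = 0)
    (hε : ∀ I, ‖ε I‖ ≤ 1) : IsParaData (2 ^ 8 * Cm 8) a φ ε :=
  ⟨fun i I => (hφ i I).isMolecule, h0, hε⟩

variable {B : ℝ} {a : Fin 3} {φ : Fin 3 → DyadicInterval → UnitAddCircle → ℂ}
  {ε : DyadicInterval → ℂ}

lemma isParaproduct_iff {f g h : UnitAddCircle → ℂ} : IsParaproduct ε φ f g h ↔
    TendstoInMeasure volume (fun F => psum ε φ F f g) atTop h := by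
  rw [IsParaproduct, funext fun F => sum_paraproductTerm_eq ε φ F f g]

lemma isParaproduct_congr_ae {f f' g g' h : UnitAddCircle → ℂ} (hf : f =ᵐ[volume] f')
    (hg : g =ᵐ[volume] g') : IsParaproduct ε φ f g h ↔ IsParaproduct ε φ f' g' h := by
  rw [isParaproduct_iff, isParaproduct_iff]
  simp only [fun F => psum_congr_ae (ε := ε) (φ := φ) F hf hg]

lemma exists_isParaproduct (hD : IsParaData B a φ ε) {f g : UnitAddCircle → ℂ}
    (hf : Integrable f) (hg : Integrable g) : ∃ h, IsParaproduct ε φ f g h := by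
  have hf' := hf.congr hf.1.ae_eq_mk
  have hg' := hg.congr hg.1.ae_eq_mk
  obtain ⟨h, hh⟩ := exists_tendstoInMeasure hD (hasSmallTails hD
    hf.1.stronglyMeasurable_mk.measurable hf' hg.1.stronglyMeasurable_mk.measurable hg')
  exact ⟨h, (isParaproduct_congr_ae hf.1.ae_eq_mk hg.1.ae_eq_mk).2 (isParaproduct_iff.2 hh)⟩

lemma IsParaproduct.aestronglyMeasurable (hD : IsParaData B a φ ε) {f g h : UnitAddCircle → ℂ}
    (hh : IsParaproduct ε φ f g h) : AEStronglyMeasurable h volume :=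
  (isParaproduct_iff.1 hh).aestronglyMeasurable fun F =>
    (continuous_psum hD F f g).aestronglyMeasurable

/-- The norm is lower semicontinuous under convergence in measure. Measurable representatives are
used, since the bounds for partial sums assume measurability. -/
lemma IsParaproduct.eLpNorm_le (hD : IsParaData B a φ ε) {f g h : UnitAddCircle → ℂ}
    (hh : IsParaproduct ε φ f g h) {p p₁ p₂ : ℝ} (hp₁ : 1 < p₁) (hp₂ : 1 < p₂)
    (hp : 1 / p = 1 / p₁ + 1 / p₂) (hf : MemLp f (ENNReal.ofReal p₁))
    (hg : MemLp g (ENNReal.ofReal p₂)) :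
    eLpNorm h (ENNReal.ofReal p) volume ≤ paraConst B p p₁ p₂ *
      (eLpNorm f (ENNReal.ofReal p₁) volume * eLpNorm g (ENNReal.ofReal p₂) volume) := by
  have hfi : Integrable f := hf.integrable (by simpa using hp₁.le)
  have hgi : Integrable g := hg.integrable (by simpa using hp₂.le)
  have ef := hf.1.ae_eq_mk
  have eg := hg.1.ae_eq_mk
  rw [isParaproduct_congr_ae ef eg, isParaproduct_iff] at hh
  rw [eLpNorm_congr_ae ef, eLpNorm_congr_ae eg]
  refine eLpNorm_le_of_tendstoInMeasure (Eventually.of_forall fun F => ?_) hh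
    fun F => (continuous_psum hD F _ _).aestronglyMeasurable
  exact eLpNorm_psum_le hD F hf.1.stronglyMeasurable_mk.measurable
    hg.1.stronglyMeasurable_mk.measurable (hfi.congr ef) (hgi.congr eg) hp₁ hp₂ hp

lemma IsParaproduct.weakLpNorm_le (hD : IsParaData B a φ ε) {f g h : UnitAddCircle → ℂ}
    (hh : IsParaproduct ε φ f g h) {p p₁ p₂ : ℝ} (hp₁ : 1 ≤ p₁) (hp₂ : 1 ≤ p₂)
    (hp : 1 / p = 1 / p₁ + 1 / p₂) (hf : MemLp f (ENNReal.ofReal p₁))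
    (hg : MemLp g (ENNReal.ofReal p₂)) :
    weakLpNorm h p ≤ weakParaConst B p p₁ p₂ *
      (eLpNorm f (ENNReal.ofReal p₁) volume * eLpNorm g (ENNReal.ofReal p₂) volume) := by
  have hpi : 0 < 1 / p := by
    rw [hp]
    have : 0 < p₁ := by linarith
    have : 0 < p₂ := by linarith
    positivity
  have hp0 : 0 < p := one_div_pos.1 hpi
  have ef := hf.1.ae_eq_mk
  have eg := hg.1.ae_eq_mk
  rw [isParaproduct_congr_ae ef eg, isParaproduct_iff] at hh
  rw [eLpNorm_congr_ae ef, eLpNorm_congr_ae eg]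
  set K := weakParaConst B p p₁ p₂ * (eLpNorm (hf.1.mk f) (ENNReal.ofReal p₁) volume *
    eLpNorm (hg.1.mk g) (ENNReal.ofReal p₂) volume) with hK
  -- A sequence of finite sets along which the sums converge almost everywhere suffices to pass the
  -- distribution bounds to the limit.
  obtain ⟨F, -, hF⟩ := hh.exists_seq_tendsto_ae'
  refine iSup₂_le fun t _ => ?_
  have key : (t : ℝ≥0∞) ^ p * volume {x | (t : ℝ≥0∞) < ‖h x‖ₑ} ≤ K ^ p := by
    refine mul_volume_lt_le_of_tendsto
      (u := fun n x => ‖psum ε φ (F n) (hf.1.mk f) (hg.1.mk g) x‖ₑ) ?_ fun n =>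
        rpow_mul_volume_psum_le_eLpNorm hD (F n) hf.1.stronglyMeasurable_mk.measurable
          hg.1.stronglyMeasurable_mk.measurable (hf.ae_eq ef) (hg.ae_eq eg) hp₁ hp₂ hp t
    filter_upwards [hF] with x hx
    exact hx.enorm
  have eset : {x | (t : ℝ) < ‖h x‖} = {x | (t : ℝ≥0∞) < ‖h x‖ₑ} := by
    ext x
    rw [Set.mem_ofPred_eq, Set.mem_ofPred_eq, enorm_eq_nnnorm, ENNReal.coe_lt_coe,
      ← NNReal.coe_lt_coe, coe_nnnorm]
  rw [eset]
  calc _ = ((t : ℝ≥0∞) ^ p * volume {x | (t : ℝ≥0∞) < ‖h x‖ₑ}) ^ (1 / p) := by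
        rw [ENNReal.mul_rpow_of_nonneg _ _ hpi.le, ← ENNReal.rpow_mul, mul_one_div_cancel hp0.ne',
          ENNReal.rpow_one]
    _ ≤ (K ^ p) ^ (1 / p) := ENNReal.rpow_le_rpow key hpi.le
    _ = K := by rw [← ENNReal.rpow_mul, mul_one_div_cancel hp0.ne', ENNReal.rpow_one]

end

end TorusParaproduct

/-! ### Conclusion: the strong and the weak type statements -/

theorem mainTheorem5 (p₁ p₂ p : ℝ) (hp : 1 / p = 1 / p₁ + 1 / p₂) (Cm : ℕ → ℝ) :
    (1 < p₁ → 1 < p₂ →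
      ∃ C : ℝ≥0, ∀ (a : Fin 3)
        (φ : Fin 3 → TorusParaproduct.DyadicInterval → UnitAddCircle → ℂ)
        (ε : TorusParaproduct.DyadicInterval → ℂ),
        (∀ i, TorusParaproduct.IsAdaptedFamily Cm (φ i)) →
        (∀ i, i ≠ a → ∀ I, ∫ x : UnitAddCircle, φ i I x = 0) →
        (∀ I, ‖ε I‖ ≤ 1) →
        ∀ f g : UnitAddCircle → ℂ,
          MemLp f (ENNReal.ofReal p₁) volume → MemLp g (ENNReal.ofReal p₂) volume →
          (∃ h, TorusParaproduct.IsParaproduct ε φ f g h) ∧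
          ∀ h, TorusParaproduct.IsParaproduct ε φ f g h →
            MemLp h (ENNReal.ofReal p) volume ∧
            eLpNorm h (ENNReal.ofReal p) volume ≤
              C * eLpNorm f (ENNReal.ofReal p₁) volume *
                eLpNorm g (ENNReal.ofReal p₂) volume) ∧
    (1 ≤ p₁ → 1 ≤ p₂ → (p₁ = 1 ∨ p₂ = 1) →
      ∃ C : ℝ≥0, ∀ (a : Fin 3)
        (φ : Fin 3 → TorusParaproduct.DyadicInterval → UnitAddCircle → ℂ)
        (ε : TorusParaproduct.DyadicInterval → ℂ),
        (∀ i, TorusParaproduct.IsAdaptedFamily Cm (φ i)) →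
        (∀ i, i ≠ a → ∀ I, ∫ x : UnitAddCircle, φ i I x = 0) →
        (∀ I, ‖ε I‖ ≤ 1) →
        ∀ f g : UnitAddCircle → ℂ,
          MemLp f (ENNReal.ofReal p₁) volume → MemLp g (ENNReal.ofReal p₂) volume →
          (∃ h, TorusParaproduct.IsParaproduct ε φ f g h) ∧
          ∀ h, TorusParaproduct.IsParaproduct ε φ f g h →
            AEStronglyMeasurable h volume ∧
            TorusParaproduct.weakLpNorm h p ≤
              C * eLpNorm f (ENNReal.ofReal p₁) volume *
                eLpNorm g (ENNReal.ofReal p₂) volume) := by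
  have hpos : 1 ≤ p₁ → 1 ≤ p₂ → 0 < p := fun h1 h2 => by
    have : 0 < p₁ := by linarith
    have : 0 < p₂ := by linarith
    exact one_div_pos.1 (by rw [hp]; positivity)
  refine ⟨fun h1 h2 => ?_, fun h1 h2 _ => ?_⟩
  · have hC := TorusParaproduct.paraConst_ne_top (2 ^ 8 * Cm 8) (hpos h1.le h2.le) h1 h2
    -- The constant is fixed before `a`, `φ` and `ε`; of the adaptedness constants it involves only
    -- `Cm 8`.
    refine ⟨(TorusParaproduct.paraConst (2 ^ 8 * Cm 8) p p₁ p₂).toNNReal, ?_⟩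
    intro a φ ε hφ h0 hε f g hf hg
    have hD := TorusParaproduct.isParaData_of_isAdaptedFamily hφ h0 hε
    refine ⟨TorusParaproduct.exists_isParaproduct hD (hf.integrable (by simpa using h1.le))
      (hg.integrable (by simpa using h2.le)), fun h hh => ?_⟩
    have hle := hh.eLpNorm_le hD h1 h2 hp hf hg
    rw [ENNReal.coe_toNNReal hC, mul_assoc]
    exact ⟨⟨hh.aestronglyMeasurable hD, hle.trans_lt (ENNReal.mul_lt_top hC.lt_top
      (ENNReal.mul_lt_top hf.2 hg.2))⟩, hle⟩
  · have hC := TorusParaproduct.weakParaConst_ne_top (2 ^ 8 * Cm 8) (hpos h1 h2) h1 h2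
    refine ⟨(TorusParaproduct.weakParaConst (2 ^ 8 * Cm 8) p p₁ p₂).toNNReal, ?_⟩
    intro a φ ε hφ h0 hε f g hf hg
    have hD := TorusParaproduct.isParaData_of_isAdaptedFamily hφ h0 hε
    refine ⟨TorusParaproduct.exists_isParaproduct hD (hf.integrable (by simpa using h1))
      (hg.integrable (by simpa using h2)), fun h hh => ?_⟩
    rw [ENNReal.coe_toNNReal hC, mul_assoc]
    exact ⟨hh.aestronglyMeasurable hD, hh.weakLpNorm_le hD h1 h2 hp hf hg⟩
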